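/- **Setting.** Consider an MDP with countable state space $\mathcal S$, finite action space $\mathcal A$, reward $\mathcal R:\mathcal S\times\mathcal A\to\mathbb R$ (possibly unbounded), transition kernel $P(s'|s,a)$, and a policy $\pi$. Let $P(s'|s)=\sum_a\pi(a|s)P(s'|s,a)$, $\mathcal R_\pi(s)=\sum_a\pi(a|s)\mathcal R(s,a)$, and let $\psi:\mathcal S\to\mathbb R^d$ be a feature map, $(\Psi\theta)(s)=\psi(s)^T\theta$. Assume: 1. The state chain is irreducible and aperiodic with unique stationary distribution $\mu$ (put $\Lambda=\mathrm{diag}(\mu)$), and $\mathbb E_\mu[\mathcal R^4(S_k,A_k)]=\hat r^2<\infty$ with $\hat r\ge0$. Put $\bar r=\sum_s\mu(s)\mathcal R_\pi(s)$. 2. The functions $\psi_1,\dots,\psi_d$ are linearly independent and $\sum_s\mu(s)\psi_j^2(s)\le\hat\psi^2<\infty$ for every $j$ (with $\hat\psi\ge0$). 3. There are $f_1,f_2,f_3:\mathcal S\to[0,\infty)$ and $\rho\in(0,1)$ such that, for all $s_0\in\mathcal S$ and $k,m\ge0$, each of $|\mathbb E_{s_0}[\mathcal R(S_k,A_k)]-\mathbb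 E_\mu[\mathcal R_\pi(S_k)]|$, $\|\mathbb E_{s_0}[\psi(S_k)]-\mathbb E_\mu[\psi(S_k)]\|_2$, $\|\mathbb E_{s_0}[\psi(S_k)\psi(S_{k+m})^T]-\mathbb E_\mu[\psi(S_k)\psi(S_{k+m})^T]\|_2$, $\|\mathbb E_{s_0}[\psi(S_k)\mathcal R(S_{k+m},A_{k+m})]-\mathbb E_\mu[\psi(S_k)\mathcal R_\pi(S_{k+m})]\|_2$ is at most $\rho^kf_1(s_0)$; moreover $\mathbb E_{s_0}[f_1^4(S_k)]\le f_2(s_0)$, $\mathbb E_{s_0}[\|\psi(S_k)\|_2^4]\le f_3(s_0)$ and $\mathbb E_{s_0}[\mathcal R^4(S_k,A_k)]\le f_3(s_0)$. Let $\lambda\in[0,1)$, $E_\Psi=\mathrm{span}\{\theta:\psi(s)^T\theta=1\ \forall s\}$, assume $E_\Psi^\perp\ne\{0\}$, and let $\Pi_{E_\Psi^\perp}$ be the orthogonal projection onto $E_\Psi^\perp$. With $\mathcal BV=\mathcal R_\pi+PV-\bar r$, put $\mathcal B^{(\lambda)}V=(1-\lambda)\sum_{m\ge0}\lambda^m\mathcal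 B^{m+1}V$ and $P^{(\lambda)}=(1-\lambda)\sum_{m\ge0}\lambda^mP^{m+1}$. Let $$\Delta=\min_{\theta\in E_\Psi^\perp,\|\theta\|_2=1}\theta^T\Pi_{E_\Psi^\perp}\Psi^T\Lambda(I-P^{(\lambda)})\Psi\theta ,$$ and let $c_\alpha\ge\Delta+\sqrt{\frac{d^2\hat\psi^4}{\Delta^2(1-\lambda)^4}-\frac{d\hat\psi^2}{(1-\lambda)^2}}$ (the root being read as $0$ if the radicand is negative). **Algorithm** (average-reward TD($\lambda$)). Let $z_{-1}=0$, $\bar r_0\in\mathbb R$, $\theta_0\in E_\Psi^\perp$, and along a trajectory $(S_k,A_k)$ of the MDP under $\pi$ let $z_k=\lambda z_{k-1}+\psi(S_k)$, $\delta_k=\mathcal R(S_k,A_k)-\bar r_k+\psi(S_{k+1})^T\theta_k-\psi(S_k)^T\theta_k$, and $$(\bar r_{k+1},\theta_{k+1})=\Pi_{\mathcal X}\big(\bar r_k+c_\alpha\alpha_k(\mathcal R(S_k,A_k)-\bar r_k),\ \theta_k+\alpha_k\delta_k\Pi_{E_\Psi^\perp}z_k\big),$$ where $\Pi_{\mathcal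 X}$ is the projection onto the closed Euclidean ball $\mathcal X\subset\mathbb R^{d+1}$ of radius $M/2$ centred at $0$. **Theorem.** The minimum $\Delta$ is attained and positive, and there is a unique $\theta^*\in E_\Psi^\perp$ solving the projected Bellman equation $\Psi\theta=\Pi_{\Lambda,\Psi}\mathcal B^{(\lambda)}(\Psi\theta)$, where $\Pi_{\Lambda,\Psi}=\Psi(\Psi^T\Lambda\Psi)^{-1}\Psi^T\Lambda$. Let $x^*=(\bar r,\theta^*)$, let $x^*\in\mathcal X$, and let $\mathbb E[\cdot]$ denote the expectation conditional on $S_0=s_0,S_1=s_1$, for states $s_0,s_1$ such that this event has positive probability. Put $e_k=(\bar r_k-\bar r)^2+\|\theta_k-\theta^*\|_2^2$, $\varphi_{V,0}=e_0+2\hat C_V$, with $\hat C_V=\hat C_V(s_0,s_1)$ as below. (a) If $\alpha_k\equiv\alpha\in(0,1]$, then for all $k\ge0$ $$\mathbb E[e_k]\le\varphi_{V,0}\,e^{-\Delta\alpha k/2}+3\hat C_V\alpha+\frac{12\hat C_V\alpha}{\Delta}.$$ (b) If $\alpha_k=\frac{\alpha}{k+K}$ with $\alpha>\frac2\Delta$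 and $K\ge\max\{\alpha,2\}$, then for all $k\ge0$ $$\mathbb E[e_k]\le\varphi_{V,0}\Big(\frac K{k+K}\Big)^{\Delta\alpha/2}+\frac{\hat C_V\alpha}{k+K}+\frac{4(6+2\Delta)\hat C_V\,e\,\alpha^2}{(\frac{\Delta\alpha}2-1)(k+K)}.$$ Consequently, in case (b), for every $\epsilon>0$ one has $\mathbb E|\bar r_k-\bar r|\le\epsilon$ and $\mathbb E\|\theta_k-\theta^*\|_2\le\epsilon$ for every $k\ge\epsilon^{-2}\Big(\varphi_{V,0}K+\hat C_V\alpha+\frac{4(6+2\Delta)\hat C_Ve\alpha^2}{\Delta\alpha/2-1}\Big)$; i.e. $O(1/\epsilon^2)$ samples suffice. **Constants.** With $F_i=f_i(s_0)+f_i(s_1)$ and $\psi'=\sup_m\|\mathbb E_\mu[\psi(S_k)\psi(S_{k+m})^T]\|_2$: $\hat T=c_\alpha^2+\frac{\sqrt{F_3}}{(1-\lambda)^2}+\frac{4F_3}{(1-\lambda)^2}$, $\ \hat b=c_\alpha^2\sqrt{F_3}+\frac{F_3}{(1-\lambda)^2}$, $$\hat g=\frac{4\sqrt{f_2(s_1)}}{\rho^2(1-\lambda)^2(1-\rho)^2}+\frac{16\sqrt{\|\psi(s_0)\|_2^4+f_3(s_1)}\sqrt{F_2}}{\rho^2(1-\lambda\rho)^2(1-\lambda)^2}+\frac{4(1+\sqrt{\hat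 r}+\hat\psi\sqrt d)^2\sqrt{\|\psi(s_0)\|_2^4+f_3(s_1)}}{(1-\lambda)^4}+\frac{4(\hat\psi\sqrt d+\psi'+\hat\psi\sqrt{\hat r d})^2}{(1-\lambda)^4},$$ $\hat A=\max\{\hat T,1\}+\max\{9\hat g,1\}$, $\ \hat B=2\hat b+2\hat T\|x^*\|_2^2+4(9\|x^*\|_2^2+1)\hat g+\frac{16c_\alpha^2\sqrt{F_2}}{(1-\rho)^2}+4\hat b$, $\ \hat C_V=\hat AM^2+\hat B$. -/

import Mathlib

open scoped ENNReal

noncomputable section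

namespace AvgTD

/-- Feature / parameter space `ℝ^d` with the Euclidean norm. -/
abbrev Vec (d : ℕ) := EuclideanSpace ℝ (Fin d)

/-- The iterates `(r, θ)` live in `ℝ × ℝ^d = ℝ^(d+1)` with the Euclidean norm. -/
abbrev Iter (d : ℕ) := WithLp 2 (ℝ × Vec d)

/-- A Markov decision process with state space `S` and action space `A`: a real (possibly
unbounded) reward function and a transition kernel. -/
structure MDP (S A : Type*) where
  reward : S → A → ℝ
  trans : S → A → PMF S

/-! ### Expectations under discrete laws -/

/-- Expectation of a (real- or vector-valued) function under a discrete law. -/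
def expect {X E : Type*} [NormedAddCommGroup E] [NormedSpace ℝ E] (p : PMF X) (f : X → E) : E :=
  ∑' x, (p x).toReal • f x

/-- The nonnegative function `f` has a finite expectation under `p`, bounded by `c`. -/
def ExpectLE {X : Type*} (p : PMF X) (f : X → ℝ) (c : ℝ) : Prop :=
  Summable (fun x => (p x).toReal * f x) ∧ expect p f ≤ c

/-- The random variable `X` is integrable and its expectation is at most `c`. -/
def MeanLE {Ω : Type*} [MeasurableSpace Ω] (ℙ : MeasureTheory.Measure Ω) (X : Ω → ℝ)
    (c : ℝ) : Prop :=
  MeasureTheory.Integrable X ℙ ∧ ∫ ω, X ω ∂ℙ ≤ c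

section Chain

variable {S A : Type*}

/-- Transition law `P_π(· | s)` of the state chain under the policy `π`. -/
def step (M : MDP S A) (π : S → PMF A) (s : S) : PMF S :=
  (π s).bind fun a => M.trans s a

/-- `R_π(s) = ∑_a R(s,a) π(a|s)`. -/
def rewardPi (M : MDP S A) (π : S → PMF A) (s : S) : ℝ :=
  expect (π s) fun a => M.reward s a

/-- Law of `S_k` when `S_0 = s`. -/
def stateLaw (M : MDP S A) (π : S → PMF A) : ℕ → S → PMF S
  | 0, s => PMF.pure s
  | k + 1, s => (stateLaw M π k s).bind (step M π)

/-- Law of `(S_m, A_m)` when `S_0 = s`. -/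
def stateActionLaw (M : MDP S A) (π : S → PMF A) (m : ℕ) (s : S) : PMF (S × A) :=
  (stateLaw M π m s).bind fun t => (π t).map fun a => (t, a)

/-- Law of `(S_k, S_{k+m}, A_{k+m})` when `S_k` has law `ν`. -/
def jointLaw (M : MDP S A) (π : S → PMF A) (ν : PMF S) (m : ℕ) : PMF (S × S × A) :=
  ν.bind fun s => (stateActionLaw M π m s).map fun q => (s, q)

/-- `μ` is a stationary distribution of the state chain. -/
def IsStationary (M : MDP S A) (π : S → PMF A) (μ : PMF S) : Prop :=
  μ.bind (step M π) = μ

def IsIrreducible (M : MDP S A) (π : S → PMF A) : Prop :=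
  ∀ s t, ∃ k, stateLaw M π k s t ≠ 0

/-- For each state the greatest common divisor of the possible return times is `1`. -/
def IsAperiodic (M : MDP S A) (π : S → PMF A) : Prop :=
  ∀ s, ∀ g : ℕ, (∀ k, 1 ≤ k → stateLaw M π k s s ≠ 0 → g ∣ k) → g = 1

/-- Long-run average reward `r̄ = ∑_s μ(s) R_π(s)`. -/
def rbar (M : MDP S A) (π : S → PMF A) (μ : PMF S) : ℝ :=
  expect μ (rewardPi M π)

/-! ### The standing assumptions -/

/-- The chain is irreducible and aperiodic with unique stationary distribution `μ`, and
`E_μ[R(S_k, A_k)^4] = rhat^2 < ∞`. -/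
structure ChainAssumption (M : MDP S A) (π : S → PMF A) (μ : PMF S) (rhat : ℝ) : Prop where
  irreducible : IsIrreducible M π
  aperiodic : IsAperiodic M π
  stationary : IsStationary M π μ
  unique : ∀ ν : PMF S, IsStationary M π ν → ν = μ
  rhat_nonneg : 0 ≤ rhat
  reward_moment :
    HasSum (fun q : S × A => (μ q.1).toReal * (π q.1 q.2).toReal * M.reward q.1 q.2 ^ 4) (rhat ^ 2)

/-- The feature functions `ψ_1, …, ψ_d` are linearly independent, and
`∑_s μ(s) ψ_j(s)^2 ≤ ψhat^2 < ∞` for all `j`. -/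
structure FeatureAssumption {d : ℕ} (μ : PMF S) (ψ : S → Vec d) (ψhat : ℝ) : Prop where
  independent : ∀ a : Fin d → ℝ, (∀ s, ∑ j, a j * ψ s j = 0) → ∀ j, a j = 0
  ψhat_nonneg : 0 ≤ ψhat
  moment : ∀ j, ExpectLE μ (fun s => ψ s j ^ 2) (ψhat ^ 2)

/-- Geometric stability of the chain: convergence of the first and of the lagged second moments of
features and rewards, uniformly in the lag `m`, and fourth moment bounds. The matrix
`ψ(s) ψ(t)ᵀ` is the operator `rankOne ℝ (ψ s) (ψ t)`, so its norm is the spectral norm. -/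
structure StabilityAssumption {d : ℕ} (M : MDP S A) (π : S → PMF A) (μ : PMF S) (ψ : S → Vec d)
    (ρ : ℝ) (f₁ f₂ f₃ : S → ℝ) : Prop where
  rho_pos : 0 < ρ
  rho_lt_one : ρ < 1
  f₁_nonneg : ∀ s, 0 ≤ f₁ s
  f₂_nonneg : ∀ s, 0 ≤ f₂ s
  f₃_nonneg : ∀ s, 0 ≤ f₃ s
  reward_conv : ∀ s₀ k,
    |expect (stateActionLaw M π k s₀) (fun q => M.reward q.1 q.2) - expect μ (rewardPi M π)|
      ≤ ρ ^ k * f₁ s₀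
  feature_conv : ∀ s₀ k, ‖expect (stateLaw M π k s₀) ψ - expect μ ψ‖ ≤ ρ ^ k * f₁ s₀
  cross_conv : ∀ s₀ k m,
    ‖expect (jointLaw M π (stateLaw M π k s₀) m)
          (fun q => InnerProductSpace.rankOne ℝ (ψ q.1) (ψ q.2.1))
        - expect (jointLaw M π μ m) (fun q => InnerProductSpace.rankOne ℝ (ψ q.1) (ψ q.2.1))‖
      ≤ ρ ^ k * f₁ s₀
  feature_reward_conv : ∀ s₀ k m,
    ‖expect (jointLaw M π (stateLaw M π k s₀) m) (fun q => M.reward q.2.1 q.2.2 • ψ q.1)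
        - expect (jointLaw M π μ m) (fun q => rewardPi M π q.2.1 • ψ q.1)‖
      ≤ ρ ^ k * f₁ s₀
  f₁_moment : ∀ s₀ k, ExpectLE (stateLaw M π k s₀) (fun s => f₁ s ^ 4) (f₂ s₀)
  feature_moment : ∀ s₀ k, ExpectLE (stateLaw M π k s₀) (fun s => ‖ψ s‖ ^ 4) (f₃ s₀)
  reward_moment : ∀ s₀ k,
    ExpectLE (stateActionLaw M π k s₀) (fun q => M.reward q.1 q.2 ^ 4) (f₃ s₀)

/-! ### The projected Bellman equation -/

/-- The function `Ψθ`, `s ↦ ψ(s)ᵀ θ`. -/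
def lin {d : ℕ} (ψ : S → Vec d) (θ : Vec d) (s : S) : ℝ := inner ℝ (ψ s) θ

/-- Bellman operator `(B V)(s) = R_π(s) + ∑_{s'} P(s'|s) V(s') - r̄`. -/
def bellman (M : MDP S A) (π : S → PMF A) (μ : PMF S) (V : S → ℝ) (s : S) : ℝ :=
  rewardPi M π s + expect (step M π s) V - rbar M π μ

/-- `B^(λ) V = (1-λ) ∑_{m ≥ 0} λ^m B^(m+1) V`, where `B^(m+1)` is the `(m+1)`-step operator. -/
def bellmanLam (M : MDP S A) (π : S → PMF A) (μ : PMF S) (lam : ℝ) (V : S → ℝ) (s : S) : ℝ :=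
  (1 - lam) * ∑' m : ℕ, lam ^ m * (bellman M π μ)^[m + 1] V s

/-- `P^(λ) V = (1-λ) ∑_{m ≥ 0} λ^m P^(m+1) V`. -/
def transLam (M : MDP S A) (π : S → PMF A) (lam : ℝ) (V : S → ℝ) (s : S) : ℝ :=
  (1 - lam) * ∑' m : ℕ, lam ^ m * expect (stateLaw M π (m + 1) s) V

/-- The matrix `Ψᵀ Λ Ψ`. -/
def gram {d : ℕ} (μ : PMF S) (ψ : S → Vec d) : Matrix (Fin d) (Fin d) ℝ :=
  Matrix.of fun i j => expect μ fun s => ψ s i * ψ s j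

/-- The projection `Π_{Λ,Ψ} g = Ψ (Ψᵀ Λ Ψ)⁻¹ Ψᵀ Λ g` onto the span of the features. -/
def featureProj {d : ℕ} (μ : PMF S) (ψ : S → Vec d) (g : S → ℝ) : S → ℝ :=
  lin ψ (WithLp.toLp 2 (((gram μ ψ)⁻¹).mulVec fun j => expect μ fun s => ψ s j * g s))

/-- `E_Ψ`, the span of the parameters `θ` with `ψ(s)ᵀ θ = 1` for all `s`. -/
def constSpace {d : ℕ} (ψ : S → Vec d) : Submodule ℝ (Vec d) :=
  Submodule.span ℝ {θ | ∀ s, lin ψ θ s = 1}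

/-- `θ ∈ E_Ψ^⊥` solves the projected Bellman equation `Ψθ = Π_{Λ,Ψ} B^(λ)(Ψθ)`. -/
def IsTDSolution {d : ℕ} (M : MDP S A) (π : S → PMF A) (μ : PMF S) (ψ : S → Vec d) (lam : ℝ)
    (θ : Vec d) : Prop :=
  θ ∈ (constSpace ψ)ᗮ ∧ lin ψ θ = featureProj μ ψ (bellmanLam M π μ lam (lin ψ θ))

/-- The values `θᵀ Π_{2,E_Ψ^⊥} Ψᵀ Λ (I - P^(λ)) Ψ θ` over the unit vectors `θ` of `E_Ψ^⊥`. -/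
def driftValues {d : ℕ} (M : MDP S A) (π : S → PMF A) (μ : PMF S) (ψ : S → Vec d) (lam : ℝ) :
    Set ℝ :=
  (fun θ : Vec d => inner ℝ θ ((constSpace ψ)ᗮ.starProjection
      (expect μ fun s => (lin ψ θ s - transLam M π lam (lin ψ θ) s) • ψ s))) ''
    {θ | θ ∈ (constSpace ψ)ᗮ ∧ ‖θ‖ = 1}

/-- `Δ`, the minimum of the values above. -/
def drift {d : ℕ} (M : MDP S A) (π : S → PMF A) (μ : PMF S) (ψ : S → Vec d) (lam : ℝ) : ℝ :=
  sInf (driftValues M π μ ψ lam)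

/-- The lower bound `Δ + √(d² ψhat⁴ / (Δ² (1-λ)⁴) - d ψhat² / (1-λ)²)` on `c_α` (the root being
read as `0` when the radicand is negative). -/
def cThreshold (d : ℕ) (lam ψhat Δ : ℝ) : ℝ :=
  Δ + Real.sqrt ((d : ℝ) ^ 2 * ψhat ^ 4 / (Δ ^ 2 * (1 - lam) ^ 4)
    - (d : ℝ) * ψhat ^ 2 / (1 - lam) ^ 2)

/-! ### The algorithm -/

/-- Projection onto the closed Euclidean ball of radius `R` around the origin. -/
def ballProj {E : Type*} [NormedAddCommGroup E] [NormedSpace ℝ E] (R : ℝ) (x : E) : E :=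
  if ‖x‖ ≤ R then x else (R / ‖x‖) • x

/-- Eligibility trace `z_k = λ z_{k-1} + ψ(S_k)` with `z_{-1} = 0`. -/
def trace {d : ℕ} (lam : ℝ) (ψ : S → Vec d) (s : ℕ → S) : ℕ → Vec d
  | 0 => ψ (s 0)
  | k + 1 => lam • trace lam ψ s k + ψ (s (k + 1))

/-- One projected TD(λ) step with step size `α`, from `x = (r, θ)`, after observing the reward `R`
and the features `v`, `v'` of the current and of the next state, with trace `z`; the iterate is
projected onto the ball of radius `radius`. -/
def tdStep {d : ℕ} (E : Submodule ℝ (Vec d)) (cα radius α R : ℝ) (v v' z : Vec d)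
    (x : Iter d) : Iter d :=
  let δ : ℝ := R - x.fst + inner ℝ v' x.snd - inner ℝ v x.snd
  ballProj radius (WithLp.toLp 2
    (x.fst + cα * α * (R - x.fst), x.snd + (α * δ) • Eᗮ.starProjection z))

/-- The iterates `x_k = (r_k, θ_k)` of average-reward TD(λ) along the sample path
`s 0, a 0, s 1, a 1, …`, with step sizes `α k` and initialization `x₀`. -/
def iterates {d : ℕ} (M : MDP S A) (ψ : S → Vec d) (lam cα radius : ℝ) (α : ℕ → ℝ) (x₀ : Iter d)
    (s : ℕ → S) (a : ℕ → A) : ℕ → Iter d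
  | 0 => x₀
  | k + 1 => tdStep (constSpace ψ) cα radius (α k) (M.reward (s k) (a k)) (ψ (s k)) (ψ (s (k + 1)))
      (trace lam ψ s k) (iterates M ψ lam cα radius α x₀ s a k)

/-- `(X_k, U_k)` is a state-action trajectory of the MDP under `π`: given the past,
`U_k ∼ π(· | X_k)` and `X_{k+1} ∼ P(· | X_k, U_k)`. The initial law is arbitrary. -/
structure IsTrajectory {Ω : Type*} [MeasurableSpace Ω] (M : MDP S A) (π : S → PMF A)
    (ℙ : MeasureTheory.Measure Ω) (X : ℕ → Ω → S) (U : ℕ → Ω → A) : Prop where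
  measurableSet_state : ∀ k s, MeasurableSet {ω | X k ω = s}
  measurableSet_action : ∀ k a, MeasurableSet {ω | U k ω = a}
  cylinder : ∀ (n : ℕ) (s : ℕ → S) (a : ℕ → A),
    ℙ {ω | (∀ i < n, X i ω = s i ∧ U i ω = a i) ∧ X n ω = s n} =
      ℙ {ω | X 0 ω = s 0} *
        ∏ i ∈ Finset.range n, (π (s i) (a i) * M.trans (s i) (a i) (s (i + 1)))

end Chain

/-! ### The constants of the bound

Here `F₃ = f₃(s₀) + f₃(s₁)`, `F₂ = f₂(s₀) + f₂(s₁)`, `z₀ = ‖ψ(s₀)‖`, `xn = ‖x*‖`. -/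

/-- `ψ' = sup_m ‖E_μ[ψ(S_k) ψ(S_{k+m})ᵀ]‖`. -/
def psiPrime {S A : Type*} {d : ℕ} (M : MDP S A) (π : S → PMF A) (μ : PMF S) (ψ : S → Vec d) : ℝ :=
  ⨆ m : ℕ, ‖expect (jointLaw M π μ m) (fun q => InnerProductSpace.rankOne ℝ (ψ q.1) (ψ q.2.1))‖

/-- Bound on the second moment of `‖T(Y_k)‖`. -/
def That (lam cα F₃ : ℝ) : ℝ :=
  cα ^ 2 + √F₃ / (1 - lam) ^ 2 + 4 * F₃ / (1 - lam) ^ 2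

/-- Bound on the second moment of `‖b(Y_k)‖`. -/
def bhat (lam cα F₃ : ℝ) : ℝ :=
  cα ^ 2 * √F₃ + F₃ / (1 - lam) ^ 2

/-- Bound on the second moment of the (unnormalized) Poisson solution of the chain `Y_k`; here
`f₂₁ = f₂(s₁)` and `f₃₁ = f₃(s₁)`. -/
def ghat (d : ℕ) (lam ρ ψhat ψ' rhat z₀ F₂ f₂₁ f₃₁ : ℝ) : ℝ :=
  4 * √f₂₁ / (ρ ^ 2 * (1 - lam) ^ 2 * (1 - ρ) ^ 2)
    + 16 * √(z₀ ^ 4 + f₃₁) * √F₂ / (ρ ^ 2 * (1 - lam * ρ) ^ 2 * (1 - lam) ^ 2)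
    + 4 * (1 + √rhat + ψhat * √(d : ℝ)) ^ 2 * √(z₀ ^ 4 + f₃₁) / (1 - lam) ^ 4
    + 4 * (ψhat * √(d : ℝ) + ψ' + ψhat * √rhat * √(d : ℝ)) ^ 2 / (1 - lam) ^ 4

/-- `Ahat = max(That, 1) + max(9 ghat, 1)`. -/
def Ahat (T g : ℝ) : ℝ := max T 1 + max (9 * g) 1

/-- `Bhat`, the sum of the second moment bounds `2 bhat + 2 That ‖x*‖²` and
`4 (9 ‖x*‖² + 1) ghat + 16 c_α² √F₂ / (1-ρ)² + 4 bhat`. -/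
def Bhat (T g b ρ cα xn F₂ : ℝ) : ℝ :=
  (2 * b + 2 * T * xn ^ 2)
    + (4 * (9 * xn ^ 2 + 1) * g + 16 * cα ^ 2 * √F₂ / (1 - ρ) ^ 2 + 4 * b)

/-- `C_V(s₀, s₁) = Ahat * D² + Bhat`, where the ball has radius `D / 2`. -/
def CV {S A : Type*} {d : ℕ} (M : MDP S A) (π : S → PMF A) (μ : PMF S) (ψ : S → Vec d)
    (lam cα rhat ψhat ρ : ℝ) (f₂ f₃ : S → ℝ) (D xn : ℝ) (s₀ s₁ : S) : ℝ :=
  let F₂ := f₂ s₀ + f₂ s₁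
  let F₃ := f₃ s₀ + f₃ s₁
  let T := That lam cα F₃
  let b := bhat lam cα F₃
  let g := ghat d lam ρ ψhat (psiPrime M π μ ψ) rhat ‖ψ s₀‖ F₂ (f₂ s₁) (f₃ s₁)
  Ahat T g * D ^ 2 + Bhat T g b ρ cα xn F₂

/-- `(r, θ)` as a point of `ℝ^(d+1)`. -/
def pt {d : ℕ} (r : ℝ) (θ : Vec d) : Iter d := WithLp.toLp 2 (r, θ)

/-- Squared error `(r - r̄)² + ‖θ - θ*‖²`. -/
def sqErr {d : ℕ} (r : ℝ) (θ : Vec d) (x : Iter d) : ℝ := (x.fst - r) ^ 2 + ‖x.snd - θ‖ ^ 2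

/-- `φ_{V,0} = (r_0 - r̄)² + ‖θ_0 - θ*‖² + 2 C_V`. -/
def phiZero {d : ℕ} (r : ℝ) (θ : Vec d) (x₀ : Iter d) (C : ℝ) : ℝ := sqErr r θ x₀ + 2 * C

end AvgTD

end

/-! The algorithm is stochastic approximation driven by the Markov chain of states, actions and
traces. The proof is a Lyapunov argument in which the Markov noise is absorbed by an explicit
solution of a Poisson equation.

Mean field. Read forward in time, the feature ψ(S_j) that enters the trace at time j ends up
multiplied by all later temporal differences, discounted by λ; with the iterate frozen, the
conditional mean of that factor is `resolvent`. So the stationary mean of δ_k z_k is `meanField`,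
the μ-mean of `resolvent` times ψ. Summation by parts in λ identifies the resolvent with B^(λ)V - V
(`bellmanLam_sub_lin`) and, without rewards, with -(I - P^(λ))V (`lin_sub_transLam`). Hence the
projected Bellman equation says that the mean field vanishes (`isTDSolution_iff`), and Δ is the
coercivity constant of minus its linear part on E_Ψ^⊥.

Positivity of Δ. With γ(m) = E_μ[V(S_0)V(S_m)] and V = Ψθ, the quadratic form of the linear part is
(1-λ)∑ λ^m (γ(m+1) - γ(0)). Stationarity gives γ(m) ≤ γ(0). Equality at lag one makes V constant
along every possible transition, hence constant by irreducibility, hence θ = 0 on E_Ψ^⊥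
(`inner_meanField_neg`). Compactness of the sphere yields the minimum; injectivity in finite
dimension yields the unique θ* (`exists_unique_solution`). The threshold on c_α is what lets Young's
inequality absorb the coupling between the errors of the two components, leaving contraction at rate
Δ/2 (`mean_drift_le`).

Noise. For a frozen iterate, the Poisson equation is solved by λ·resolvent(s)·z, which accounts for
the trace z accumulated so far, plus ∑_i (P^i w - w̄) with w = resolvent·ψ, which accounts for the
features still to come (`paramSol`, `expect_first_order`). Stability uniform in the lag makes the
series converge geometrically. The solution is affine in the iterate, hence Lipschitz with a random
constant of bounded second moment. Adding α_k times `crossTerm` to the squared error therefore gives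
a one-step inequality with contraction 1 - Δα_k and remainder of order α_k² (`lyapunov_step_le`,
`HistLaw.lyapunov_expect_le`).

Conditionally on the first two states, the recorded history is a Markov chain on a countable set
from time one on (`IsTrajectory.exists_histLaw`), so all expectations are sums against discrete
laws. What remains are two scalar recursions, `const_step_bound` and `diminishing_step_bound`, and
Jensen's inequality for the sample complexity. -/

open scoped ENNReal

noncomputable section

namespace AvgTD

/-! ### Integration against discrete laws -/

section ExpectLibrary

set_option linter.unusedSectionVars false

variable {X Y E F : Type*} [NormedAddCommGroup E] [NormedSpace ℝ E]
  [NormedAddCommGroup F] [NormedSpace ℝ F]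

/-- `f` is absolutely summable against the discrete law `p`. -/
def Intg (p : PMF X) (f : X → E) : Prop := Summable fun x => (p x).toReal * ‖f x‖

theorem pmf_summable (p : PMF X) : Summable fun x => (p x).toReal :=
  ENNReal.summable_toReal (by rw [p.tsum_coe]; exact ENNReal.one_ne_top)

theorem pmf_tsum_toReal (p : PMF X) : ∑' x, (p x).toReal = 1 := by
  rw [← ENNReal.tsum_toReal_eq (fun x => p.apply_ne_top x), p.tsum_coe, ENNReal.toReal_one]

theorem intg_iff_abs {p : PMF X} {f : X → ℝ} (hf : ∀ x, 0 ≤ f x) :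
    Intg p f ↔ Summable fun x => (p x).toReal * f x := by
  unfold Intg
  simp only [Real.norm_eq_abs, abs_of_nonneg (hf _)]

theorem Intg.norm {p : PMF X} {f : X → E} (hf : Intg p f) : Intg p fun x => ‖f x‖ := by
  simpa [Intg] using hf

theorem Intg.summable_norm {p : PMF X} {f : X → E} (hf : Intg p f) :
    Summable fun x => ‖(p x).toReal • f x‖ := by
  simpa [Intg, norm_smul] using hf

theorem Intg.summable [CompleteSpace E] {p : PMF X} {f : X → E} (hf : Intg p f) :
    Summable fun x => (p x).toReal • f x := hf.summable_norm.of_norm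

/-- Domination on the support. -/
theorem Intg.mono {p : PMF X} {f : X → E} {g : X → F} (hg : Intg p g)
    (h : ∀ x, p x ≠ 0 → ‖f x‖ ≤ ‖g x‖) : Intg p f := by
  refine Summable.of_nonneg_of_le (fun x => by positivity) (fun x => ?_) hg
  by_cases hx : p x = 0
  · simp [hx]
  · exact mul_le_mul_of_nonneg_left (h x hx) ENNReal.toReal_nonneg

theorem Intg.const (p : PMF X) (c : E) : Intg p fun _ => c := (pmf_summable p).mul_right _

theorem Intg.add {p : PMF X} {f g : X → E} (hf : Intg p f) (hg : Intg p g) :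
    Intg p fun x => f x + g x := by
  refine Summable.of_nonneg_of_le (fun x => by positivity) (fun x => ?_) (Summable.add hf hg)
  rw [← mul_add]
  exact mul_le_mul_of_nonneg_left (norm_add_le _ _) ENNReal.toReal_nonneg

theorem Intg.neg {p : PMF X} {f : X → E} (hf : Intg p f) : Intg p fun x => -f x := by
  simpa [Intg] using hf

theorem Intg.sub {p : PMF X} {f g : X → E} (hf : Intg p f) (hg : Intg p g) :
    Intg p fun x => f x - g x := by
  simpa [sub_eq_add_neg] using hf.add hg.neg

theorem Intg.const_smul {p : PMF X} {f : X → E} (hf : Intg p f) (c : ℝ) :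
    Intg p fun x => c • f x := by
  refine (Summable.mul_left |c| hf).congr fun x => ?_
  rw [norm_smul, Real.norm_eq_abs]; ring

theorem Intg.const_mul {p : PMF X} {f : X → ℝ} (hf : Intg p f) (c : ℝ) :
    Intg p fun x => c * f x := hf.const_smul c

theorem Intg.smul_const {p : PMF X} {f : X → ℝ} (hf : Intg p f) (v : E) :
    Intg p fun x => f x • v := by
  refine (Summable.mul_right ‖v‖ hf).congr fun x => ?_
  rw [norm_smul]; ring

theorem Intg.clm {p : PMF X} {f : X → E} (hf : Intg p f) (L : E →L[ℝ] F) :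
    Intg p fun x => L (f x) := by
  refine Intg.mono (g := fun x => ‖L‖ • f x) (hf.const_smul _) fun x _ => ?_
  rw [norm_smul, norm_norm]
  exact L.le_opNorm _

theorem Intg.bounded {p : PMF X} {f : X → E} (c : ℝ) (h : ∀ x, p x ≠ 0 → ‖f x‖ ≤ c) :
    Intg p f :=
  (Intg.const p c).mono fun x hx => (h x hx).trans (le_abs_self c)

theorem intg_pure (x : X) (f : X → E) : Intg (PMF.pure x) f := by
  refine summable_of_ne_finset_zero (s := {x}) fun y hy => ?_
  simp only [Finset.mem_singleton] at hy
  simp [PMF.pure_apply, hy]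

theorem expect_pure (x : X) (f : X → E) : expect (PMF.pure x) f = f x := by
  unfold expect
  rw [tsum_eq_single x]
  · simp [PMF.pure_apply]
  · intro y hy
    simp [PMF.pure_apply, hy]

theorem expect_congr {p : PMF X} {f g : X → E} (h : ∀ x, p x ≠ 0 → f x = g x) :
    expect p f = expect p g := by
  refine tsum_congr fun x => ?_
  by_cases hx : p x = 0
  · simp [hx]
  · rw [h x hx]

theorem expect_const [CompleteSpace E] (p : PMF X) (c : E) : expect p (fun _ => c) = c := by
  unfold expect
  rw [(pmf_summable p).tsum_smul_const, pmf_tsum_toReal, one_smul]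

theorem expect_add [CompleteSpace E] {p : PMF X} {f g : X → E} (hf : Intg p f) (hg : Intg p g) :
    expect p (fun x => f x + g x) = expect p f + expect p g := by
  unfold expect
  simp only [smul_add]
  exact hf.summable.tsum_add hg.summable

theorem expect_sub [CompleteSpace E] {p : PMF X} {f g : X → E} (hf : Intg p f) (hg : Intg p g) :
    expect p (fun x => f x - g x) = expect p f - expect p g := by
  unfold expect
  simp only [smul_sub]
  exact hf.summable.tsum_sub hg.summable

theorem expect_clm [CompleteSpace E] {p : PMF X} {f : X → E}
    (hf : Intg p f) (L : E →L[ℝ] F) : expect p (fun x => L (f x)) = L (expect p f) := by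
  unfold expect
  rw [L.map_tsum hf.summable]
  simp

theorem expect_const_smul [CompleteSpace E] {p : PMF X} {f : X → E}
    (hf : Intg p f) (c : ℝ) : expect p (fun x => c • f x) = c • expect p f :=
  expect_clm hf (c • ContinuousLinearMap.id ℝ E)

theorem expect_const_mul {p : PMF X} {f : X → ℝ}
    (hf : Intg p f) (c : ℝ) : expect p (fun x => c * f x) = c * expect p f :=
  expect_const_smul hf c

theorem expect_smul_const [CompleteSpace E] {p : PMF X} {f : X → ℝ}
    (hf : Intg p f) (v : E) : expect p (fun x => f x • v) = expect p f • v :=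
  expect_clm hf ((ContinuousLinearMap.id ℝ ℝ).smulRight v)

theorem expect_inner_left {H : Type*} [NormedAddCommGroup H] [InnerProductSpace ℝ H]
    [CompleteSpace H] {p : PMF X} {f : X → H} (hf : Intg p f) (v : H) :
    expect p (fun x => inner ℝ v (f x)) = inner ℝ v (expect p f) :=
  expect_clm hf (innerSL ℝ v)

theorem expect_mono {p : PMF X} {f g : X → ℝ} (hf : Intg p f) (hg : Intg p g)
    (h : ∀ x, p x ≠ 0 → f x ≤ g x) : expect p f ≤ expect p g := by
  refine hf.summable.tsum_le_tsum (fun x => ?_) hg.summable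
  by_cases hx : p x = 0
  · simp [hx]
  · exact mul_le_mul_of_nonneg_left (h x hx) ENNReal.toReal_nonneg

theorem expect_nonneg {p : PMF X} {f : X → ℝ} (h : ∀ x, p x ≠ 0 → 0 ≤ f x) :
    0 ≤ expect p f := by
  refine tsum_nonneg fun x => ?_
  by_cases hx : p x = 0
  · simp [hx]
  · exact mul_nonneg ENNReal.toReal_nonneg (h x hx)

theorem norm_expect_le {p : PMF X} {f : X → E} (hf : Intg p f) :
    ‖expect p f‖ ≤ expect p fun x => ‖f x‖ := by
  refine (norm_tsum_le_tsum_norm hf.summable_norm).trans_eq (tsum_congr fun x => ?_)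
  rw [norm_smul, Real.norm_eq_abs, abs_of_nonneg ENNReal.toReal_nonneg, smul_eq_mul]

/-! ### Composition of laws -/

/-- Moves integrability to extended nonnegative sums, where the order of summation can be exchanged
without any hypothesis. -/
theorem intg_iff_tsum_ne_top {p : PMF X} {f : X → E} :
    Intg p f ↔ ∑' x, p x * ‖f x‖ₑ ≠ ∞ := by
  have key : ∀ x, p x * ‖f x‖ₑ = ENNReal.ofReal ((p x).toReal * ‖f x‖) := fun x => by
    rw [ENNReal.ofReal_mul ENNReal.toReal_nonneg, ENNReal.ofReal_toReal (p.apply_ne_top x),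
      ofReal_norm]
  constructor
  · intro h
    simp only [key]
    rw [← ENNReal.ofReal_tsum_of_nonneg (fun x => by positivity) h]
    exact ENNReal.ofReal_ne_top
  · intro h
    refine (ENNReal.summable_toReal h).congr fun x => ?_
    rw [key, ENNReal.toReal_ofReal (by positivity)]

theorem tsum_bind_enorm (p : PMF X) (k : X → PMF Y) (f : Y → E) :
    ∑' y, (p.bind k) y * ‖f y‖ₑ = ∑' x, p x * ∑' y, k x y * ‖f y‖ₑ := by
  simp only [PMF.bind_apply, ← ENNReal.tsum_mul_right, ← ENNReal.tsum_mul_left]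
  rw [ENNReal.tsum_comm]
  simp only [mul_assoc]

theorem summable_bind {p : PMF X} {k : X → PMF Y} {f : Y → E} (h : Intg (p.bind k) f) :
    Summable fun q : X × Y => (p q.1).toReal * ((k q.1 q.2).toReal * ‖f q.2‖) := by
  rw [intg_iff_tsum_ne_top, tsum_bind_enorm] at h
  have h2 : ∑' q : X × Y, p q.1 * (k q.1 q.2 * ‖f q.2‖ₑ) ≠ ∞ := by
    rw [ENNReal.tsum_prod (f := fun x y => p x * (k x y * ‖f y‖ₑ))]
    simpa only [ENNReal.tsum_mul_left] using h
  refine (ENNReal.summable_toReal h2).congr fun q => ?_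
  simp [ENNReal.toReal_mul]

/-- Joint summability over `X × Y` restricts to each fibre; where the weight `p x` is nonzero it can
be cancelled. At points of zero mass nothing can be said, hence the support conditions throughout.
-/
theorem Intg.of_bind {p : PMF X} {k : X → PMF Y} {f : Y → E} (h : Intg (p.bind k) f) {x : X}
    (hx : p x ≠ 0) : Intg (k x) f := by
  have := (summable_bind h).prod_factor x
  have hx' : (p x).toReal ≠ 0 := ENNReal.toReal_ne_zero.2 ⟨hx, p.apply_ne_top x⟩
  exact (summable_mul_left_iff hx').1 this

theorem Intg.expect_norm_of_bind {p : PMF X} {k : X → PMF Y} {f : Y → E}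
    (h : Intg (p.bind k) f) : Intg p fun x => expect (k x) fun y => ‖f y‖ := by
  have := (summable_bind h).prod
  refine this.congr fun x => ?_
  dsimp only
  rw [tsum_mul_left, Real.norm_eq_abs, abs_of_nonneg (expect_nonneg fun _ _ => norm_nonneg _)]
  rfl

theorem Intg.expect_of_bind {p : PMF X} {k : X → PMF Y} {f : Y → E}
    (h : Intg (p.bind k) f) : Intg p fun x => expect (k x) f :=
  h.expect_norm_of_bind.mono fun x hx =>
    (norm_expect_le (h.of_bind hx)).trans (le_abs_self _)

theorem Intg.bind {p : PMF X} {k : X → PMF Y} {f : Y → E}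
    (h₁ : ∀ x, p x ≠ 0 → Intg (k x) f) (h₂ : Intg p fun x => expect (k x) fun y => ‖f y‖) :
    Intg (p.bind k) f := by
  rw [intg_iff_tsum_ne_top, tsum_bind_enorm]
  have : ∑' x, p x * ∑' y, k x y * ‖f y‖ₑ = ∑' x, p x * ‖expect (k x) fun y => ‖f y‖‖ₑ := by
    refine tsum_congr fun x => ?_
    by_cases hx : p x = 0
    · simp [hx]
    congr 1
    have h := h₁ _ hx
    rw [Real.enorm_eq_ofReal (expect_nonneg fun _ _ => norm_nonneg _)]
    unfold expect
    simp only [smul_eq_mul]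
    rw [ENNReal.ofReal_tsum_of_nonneg (fun y => by positivity) h]
    refine tsum_congr fun y => ?_
    rw [ENNReal.ofReal_mul ENNReal.toReal_nonneg,
      ENNReal.ofReal_toReal ((k x).apply_ne_top y), ofReal_norm]
  rw [this]
  exact intg_iff_tsum_ne_top.1 h₂

/-- Fubini for a discrete kernel. It serves as the tower property of conditional expectation. -/
theorem expect_bind [CompleteSpace E] {p : PMF X} {k : X → PMF Y} {f : Y → E}
    (h : Intg (p.bind k) f) : expect (p.bind k) f = expect p fun x => expect (k x) f := by
  have hs := summable_bind h
  have hs' : Summable (Function.uncurry fun (x : X) (y : Y) =>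
      (p x).toReal • (k x y).toReal • f y) := by
    refine Summable.of_norm (hs.congr fun q => ?_)
    simp [Function.uncurry, norm_smul, abs_of_nonneg ENNReal.toReal_nonneg]
  unfold expect
  have e1 : ∀ y, ((p.bind k) y).toReal • f y
      = ∑' x, (p x).toReal • (k x y).toReal • f y := fun y => by
    rw [PMF.bind_apply, ENNReal.tsum_toReal_eq (fun x => ENNReal.mul_ne_top (p.apply_ne_top x)
      ((k x).apply_ne_top y))]
    simp only [ENNReal.toReal_mul, smul_smul]
    rw [Summable.tsum_smul_const]
    refine (pmf_summable p).of_nonneg_of_le (fun x => by positivity) fun x => ?_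
    refine mul_le_of_le_one_right ENNReal.toReal_nonneg ?_
    exact ENNReal.toReal_le_of_le_ofReal zero_le_one (by simpa using (k x).coe_le_one y)
  simp only [e1]
  rw [hs'.tsum_comm]
  refine tsum_congr fun x => ?_
  by_cases hx : p x = 0
  · simp [hx]
  · rw [(h.of_bind hx).summable.tsum_const_smul]

theorem map_eq_bind (p : PMF X) (g : X → Y) : p.map g = p.bind fun x => PMF.pure (g x) := rfl

theorem intg_map {p : PMF X} {g : X → Y} {f : Y → E} :
    Intg (p.map g) f ↔ Intg p fun x => f (g x) := by
  constructor
  · intro h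
    refine h.expect_norm_of_bind.mono fun x _ => ?_
    simp [expect_pure]
  · intro h
    refine Intg.bind (fun x _ => intg_pure _ _) ?_
    simpa [expect_pure] using h.norm

theorem expect_map [CompleteSpace E] {p : PMF X} {g : X → Y} {f : Y → E}
    (h : Intg p fun x => f (g x)) : expect (p.map g) f = expect p fun x => f (g x) := by
  have h' := intg_map.2 h
  rw [map_eq_bind] at h' ⊢
  rw [expect_bind h']
  simp [expect_pure]

/-! ### Exchange with series -/

/-- Fubini against counting measure on ℕ. It is used for both kinds of series in the argument: the
λ-discounted sums and the Poisson series. -/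
theorem intg_tsum_and_expect_tsum [CompleteSpace E] {p : PMF X} {f : ℕ → X → E}
    (hf : ∀ i, Intg p (f i)) (hs : Summable fun i => expect p fun x => ‖f i x‖) :
    (∀ x, p x ≠ 0 → Summable fun i => ‖f i x‖) ∧ (Intg p fun x => ∑' i, f i x) ∧
      expect p (fun x => ∑' i, f i x) = ∑' i, expect p (f i) := by
  have h1 : Summable fun q : ℕ × X => (p q.2).toReal * ‖f q.1 q.2‖ :=
    (summable_prod_of_nonneg (fun q => by positivity)).2 ⟨fun i => hf i, hs⟩
  have h2 : Summable fun q : X × ℕ => (p q.1).toReal * ‖f q.2 q.1‖ :=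
    (Equiv.prodComm X ℕ).summable_iff.2 h1
  have h3 : ∀ x, p x ≠ 0 → Summable fun i => ‖f i x‖ := fun x hx =>
    (summable_mul_left_iff (ENNReal.toReal_ne_zero.2 ⟨hx, p.apply_ne_top x⟩)).1
      (h2.prod_factor x)
  refine ⟨h3, ?_, ?_⟩
  · refine h2.prod.of_nonneg_of_le (fun x => by positivity) fun x => ?_
    by_cases hx : p x = 0
    · simp [hx]
    · dsimp only
      rw [tsum_mul_left]
      exact mul_le_mul_of_nonneg_left (norm_tsum_le_tsum_norm (h3 x hx)) ENNReal.toReal_nonneg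
  · unfold expect
    have h4 : Summable (Function.uncurry fun (i : ℕ) (x : X) => (p x).toReal • f i x) := by
      refine Summable.of_norm (h1.congr fun q => ?_)
      simp [Function.uncurry, norm_smul, abs_of_nonneg ENNReal.toReal_nonneg]
    rw [← h4.tsum_comm]
    refine tsum_congr fun x => ?_
    by_cases hx : p x = 0
    · simp [hx]
    · rw [(h3 x hx).of_norm.tsum_const_smul]

/-! ### Bounds on expectations of nonnegative functions -/

theorem ExpectLE.intg {p : PMF X} {f : X → ℝ} {c : ℝ} (h : ExpectLE p f c)
    (hf : ∀ x, 0 ≤ f x) : Intg p f := (intg_iff_abs hf).2 h.1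

theorem Intg.expectLE {p : PMF X} {f : X → ℝ} {c : ℝ} (h : Intg p f) (hc : expect p f ≤ c) :
    ExpectLE p f c := ⟨h.summable, hc⟩

theorem ExpectLE.mono_const {p : PMF X} {f : X → ℝ} {c c' : ℝ} (h : ExpectLE p f c)
    (hc : c ≤ c') : ExpectLE p f c' := ⟨h.1, h.2.trans hc⟩

theorem ExpectLE.mono {p : PMF X} {f g : X → ℝ} {c : ℝ} (hg : ExpectLE p g c)
    (hf : ∀ x, 0 ≤ f x) (h : ∀ x, p x ≠ 0 → f x ≤ g x) : ExpectLE p f c := by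
  have hle : ∀ x, (p x).toReal * f x ≤ (p x).toReal * g x := fun x => by
    by_cases hx : p x = 0
    · simp [hx]
    · exact mul_le_mul_of_nonneg_left (h x hx) ENNReal.toReal_nonneg
  have hs : Summable fun x => (p x).toReal * f x :=
    Summable.of_nonneg_of_le (fun x => mul_nonneg ENNReal.toReal_nonneg (hf x)) hle hg.1
  exact ⟨hs, (hs.tsum_le_tsum hle hg.1).trans hg.2⟩

theorem ExpectLE.const (p : PMF X) (c : ℝ) : ExpectLE p (fun _ => c) c :=
  ⟨(pmf_summable p).mul_right c, (expect_const p c).le⟩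

theorem ExpectLE.add {p : PMF X} {f g : X → ℝ} {a b : ℝ} (hf : ExpectLE p f a)
    (hg : ExpectLE p g b) : ExpectLE p (fun x => f x + g x) (a + b) := by
  have e : (fun x => (p x).toReal * (f x + g x))
      = fun x => (p x).toReal * f x + (p x).toReal * g x := by funext x; ring
  refine ⟨by rw [e]; exact hf.1.add hg.1, ?_⟩
  have : expect p (fun x => f x + g x) = expect p f + expect p g := by
    unfold expect
    simp only [smul_eq_mul]
    rw [e, hf.1.tsum_add hg.1]
  rw [this]
  exact add_le_add hf.2 hg.2

theorem ExpectLE.const_mul {p : PMF X} {f : X → ℝ} {a : ℝ} (hf : ExpectLE p f a) {c : ℝ}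
    (hc : 0 ≤ c) : ExpectLE p (fun x => c * f x) (c * a) := by
  have e : (fun x => (p x).toReal * (c * f x)) = fun x => c * ((p x).toReal * f x) := by
    funext x; ring
  refine ⟨by rw [e]; exact hf.1.mul_left c, ?_⟩
  have : expect p (fun x => c * f x) = c * expect p f := by
    unfold expect
    simp only [smul_eq_mul]
    rw [e, tsum_mul_left]
  rw [this]
  exact mul_le_mul_of_nonneg_left hf.2 hc

theorem ExpectLE.nonneg {p : PMF X} {f : X → ℝ} {a : ℝ} (hf : ExpectLE p f a)
    (h0 : ∀ x, 0 ≤ f x) : 0 ≤ a := (expect_nonneg fun x _ => h0 x).trans hf.2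

/-- Cauchy–Schwarz. -/
theorem ExpectLE.mul_le_sqrt {p : PMF X} {f g : X → ℝ} {a b : ℝ}
    (hf : ExpectLE p (fun x => f x ^ 2) a) (hg : ExpectLE p (fun x => g x ^ 2) b)
    (hf0 : ∀ x, 0 ≤ f x) (hg0 : ∀ x, 0 ≤ g x) :
    ExpectLE p (fun x => f x * g x) (√a * √b) := by
  have ha := hf.nonneg fun x => sq_nonneg _
  have hb := hg.nonneg fun x => sq_nonneg _
  -- AM–GM serves only to obtain summability; its constant is discarded in favour of the sharper one
  -- below.
  have hs : ExpectLE p (fun x => f x * g x) (1 / 2 * a + 1 / 2 * b) := by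
    refine ((hf.const_mul (c := 1 / 2) (by norm_num)).add
      (hg.const_mul (c := 1 / 2) (by norm_num))).mono (fun x => mul_nonneg (hf0 x) (hg0 x)) ?_
    intro x _
    nlinarith [sq_nonneg (f x - g x)]
  refine ⟨hs.1, ?_⟩
  -- The weight is split as √p·√p between the two factors, which turns the unweighted inequality
  -- into the weighted one.
  have h := Real.inner_le_Lp_mul_Lq_tsum_of_nonneg (p := 2) (q := 2)
    (f := fun x => √(p x).toReal * f x) (g := fun x => √(p x).toReal * g x)
    Real.HolderConjugate.two_two (fun x => mul_nonneg (Real.sqrt_nonneg _) (hf0 x))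
    (fun x => mul_nonneg (Real.sqrt_nonneg _) (hg0 x))
  simp only [Real.rpow_two, mul_pow, Real.sq_sqrt ENNReal.toReal_nonneg] at h
  have h' := h hf.1 hg.1
  rw [← Real.sqrt_eq_rpow, ← Real.sqrt_eq_rpow] at h'
  have e : ∀ x, √(p x).toReal * f x * (√(p x).toReal * g x) = (p x).toReal • (f x * g x) :=
    fun x => by
      rw [smul_eq_mul]
      nth_rewrite 3 [← Real.mul_self_sqrt (ENNReal.toReal_nonneg (a := p x))]
      ring
  simp only [e] at h'
  exact h'.trans (mul_le_mul (Real.sqrt_le_sqrt hf.2) (Real.sqrt_le_sqrt hg.2)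
    (Real.sqrt_nonneg _) (Real.sqrt_nonneg _))

/-- Jensen's inequality for the square. -/
theorem ExpectLE.le_sqrt {p : PMF X} {f : X → ℝ} {a : ℝ}
    (hf : ExpectLE p (fun x => f x ^ 2) a) (hf0 : ∀ x, 0 ≤ f x) : ExpectLE p f (√a) := by
  simpa using hf.mul_le_sqrt (g := fun _ => 1) (b := 1) (by simpa using ExpectLE.const p 1) hf0
    (fun _ => zero_le_one)

theorem ExpectLE.bind {p : PMF X} {k : X → PMF Y} {f : Y → ℝ} {h : X → ℝ} {c : ℝ}
    (hf0 : ∀ y, 0 ≤ f y) (hk : ∀ x, p x ≠ 0 → ExpectLE (k x) f (h x)) (hp : ExpectLE p h c) :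
    ExpectLE (p.bind k) f c := by
  have h1 : ExpectLE p (fun x => expect (k x) f) c :=
    hp.mono (fun x => expect_nonneg fun y _ => hf0 y) fun x hx => (hk x hx).2
  have h2 : Intg (p.bind k) f := by
    refine Intg.bind (fun x hx => (hk x hx).intg hf0) ?_
    simp only [Real.norm_eq_abs, abs_of_nonneg (hf0 _)]
    exact h1.intg fun x => expect_nonneg fun y _ => hf0 y
  refine h2.expectLE ?_
  rw [expect_bind h2]
  exact h1.2

theorem ExpectLE.of_bind {p : PMF X} {k : X → PMF Y} {f : Y → ℝ} {c : ℝ}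
    (h : ExpectLE (p.bind k) f c) (hf0 : ∀ y, 0 ≤ f y) :
    ExpectLE p (fun x => expect (k x) f) c := by
  have hi := h.intg hf0
  refine hi.expect_of_bind.expectLE ?_
  rw [← expect_bind hi]
  exact h.2

theorem ExpectLE.map {p : PMF X} {g : X → Y} {f : Y → ℝ} {c : ℝ} (hf0 : ∀ y, 0 ≤ f y)
    (h : ExpectLE p (fun x => f (g x)) c) : ExpectLE (p.map g) f c := by
  have hi := h.intg fun x => hf0 _
  refine (intg_map.2 hi).expectLE ?_
  rw [expect_map hi]
  exact h.2

theorem sq_norm_expect_le {p : PMF X} {f : X → E} {c : ℝ}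
    (h : ExpectLE p (fun x => ‖f x‖ ^ 2) c) : ‖expect p f‖ ^ 2 ≤ c := by
  have h1 := h.le_sqrt fun x => norm_nonneg _
  have h2 : Intg p f := by simpa [Intg] using h1.1
  have h3 := (norm_expect_le h2).trans h1.2
  calc ‖expect p f‖ ^ 2 ≤ √c ^ 2 := pow_le_pow_left₀ (norm_nonneg _) h3 2
    _ = c := Real.sq_sqrt (h.nonneg fun _ => sq_nonneg _)

theorem ExpectLE.intg_of_sq {p : PMF X} {f : X → E} {c : ℝ}
    (h : ExpectLE p (fun x => ‖f x‖ ^ 2) c) : Intg p f := by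
  simpa [Intg] using (h.le_sqrt fun x => norm_nonneg _).1

end ExpectLibrary

end AvgTD

end

open scoped ENNReal

noncomputable section

namespace AvgTD

/-! ### Laws of the chain, second moments, and convergence of lagged moments -/

section Chain

variable {S A : Type*} {d : ℕ} {M : MDP S A} {π : S → PMF A} {μ ν : PMF S} {ψ : S → Vec d}

/-! ### Composition of the laws of the chain -/

theorem stateLaw_zero (s : S) : stateLaw M π 0 s = PMF.pure s := rfl

theorem stateLaw_one (s : S) : stateLaw M π 1 s = step M π s := PMF.pure_bind _ _

theorem stateLaw_bind (k m : ℕ) (s : S) :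
    (stateLaw M π k s).bind (stateLaw M π m) = stateLaw M π (k + m) s := by
  induction m with
  | zero => exact PMF.bind_pure _
  | succ m ih =>
    rw [← add_assoc]
    change _ = (stateLaw M π (k + m) s).bind (step M π)
    rw [← ih, PMF.bind_bind]
    rfl

theorem step_bind_stateLaw (m : ℕ) (s : S) :
    (step M π s).bind (stateLaw M π m) = stateLaw M π (m + 1) s := by
  rw [← stateLaw_one, stateLaw_bind, add_comm]

theorem stateLaw_bind_stateAction (k m : ℕ) (s : S) :
    (stateLaw M π k s).bind (stateActionLaw M π m) = stateActionLaw M π (k + m) s := by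
  change (stateLaw M π k s).bind (fun t => (stateLaw M π m t).bind _) = _
  rw [← PMF.bind_bind, stateLaw_bind]
  rfl

theorem IsStationary.bind_stateLaw (h : IsStationary M π μ) (m : ℕ) :
    μ.bind (stateLaw M π m) = μ := by
  induction m with
  | zero => exact PMF.bind_pure _
  | succ m ih =>
    change μ.bind (fun s => (stateLaw M π m s).bind (step M π)) = μ
    rw [← PMF.bind_bind, ih]
    exact h

theorem stateActionLaw_fst (m : ℕ) (s : S) :
    (stateActionLaw M π m s).map Prod.fst = stateLaw M π m s := by
  unfold stateActionLaw
  rw [PMF.map_bind]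
  conv_rhs => rw [← PMF.bind_pure (stateLaw M π m s)]
  congr 1
  funext t
  rw [PMF.map_comp]
  exact PMF.map_const (π t) t

/-- Expected reward `m` steps after a visit to `s`. -/
def meanReward (M : MDP S A) (π : S → PMF A) (m : ℕ) (s : S) : ℝ :=
  expect (stateActionLaw M π m s) fun q => M.reward q.1 q.2

/-- Expected features `m` steps after a visit to `s`. -/
def meanFeature (M : MDP S A) (π : S → PMF A) (ψ : S → Vec d) (m : ℕ) (s : S) : Vec d :=
  expect (stateLaw M π m s) ψ

/-- Second moments of features and rewards that stay bounded along the chain started in `ν`. -/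
structure SecondMoments (M : MDP S A) (π : S → PMF A) (ψ : S → Vec d) (ν : PMF S)
    (a b : ℝ) : Prop where
  feature : ∀ m, ExpectLE (ν.bind (stateLaw M π m)) (fun s => ‖ψ s‖ ^ 2) a
  reward : ∀ m, ExpectLE (ν.bind (stateActionLaw M π m)) (fun q => M.reward q.1 q.2 ^ 2) b

/-- Conditional expectation contracts in L²: Jensen in each fibre, then the tower property. -/
theorem sq_expect_of_bind {X Y E : Type*} [NormedAddCommGroup E] [NormedSpace ℝ E] {p : PMF X}
    {k : X → PMF Y} {f : Y → E} {c : ℝ} (h : ExpectLE (p.bind k) (fun y => ‖f y‖ ^ 2) c) :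
    ExpectLE p (fun x => ‖expect (k x) f‖ ^ 2) c := by
  refine (h.of_bind fun _ => sq_nonneg _).mono (fun _ => sq_nonneg _) fun x hx => ?_
  refine sq_norm_expect_le ⟨?_, le_rfl⟩
  exact ((h.intg fun _ => sq_nonneg _).of_bind hx).summable

theorem intg_smul_of_sq {X E : Type*} [NormedAddCommGroup E] [NormedSpace ℝ E] {p : PMF X}
    {h : X → ℝ} {u : X → E} {a b : ℝ} (hh : ExpectLE p (fun x => h x ^ 2) b)
    (hu : ExpectLE p (fun x => ‖u x‖ ^ 2) a) :
    (Intg p fun x => h x • u x) ∧ expect p (fun x => ‖h x • u x‖) ≤ √b * √a := by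
  have h1 : ExpectLE p (fun x => |h x| ^ 2) b := by simpa using hh
  have h2 := h1.mul_le_sqrt hu (fun _ => abs_nonneg _) fun _ => norm_nonneg _
  have e : (fun x => ‖h x • u x‖) = fun x => |h x| * ‖u x‖ := by
    funext x; rw [norm_smul, Real.norm_eq_abs]
  refine ⟨?_, e ▸ h2.2⟩
  have h3 := h2.1
  simp only [Intg, norm_smul, Real.norm_eq_abs]
  exact h3

/-- Expectation of a product of a function of the first and of a function of a later stage. -/
theorem expect_lagged_smul {X Y E : Type*} [NormedAddCommGroup E] [NormedSpace ℝ E]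
    [CompleteSpace E] {p : PMF X} {k : X → PMF Y} {h : Y → ℝ} {u : X → E} {a b : ℝ}
    (hh : ExpectLE (p.bind k) (fun y => h y ^ 2) b) (hu : ExpectLE p (fun x => ‖u x‖ ^ 2) a) :
    (Intg (p.bind fun x => (k x).map fun y => (x, y)) fun q => h q.2 • u q.1) ∧
      expect (p.bind fun x => (k x).map fun y => (x, y)) (fun q => h q.2 • u q.1)
        = expect p fun x => expect (k x) h • u x := by
  have hh' : ExpectLE (p.bind k) (fun y => ‖h y‖ ^ 2) b := by simpa using hh
  have hI : ∀ x, p x ≠ 0 → Intg (k x) h := fun x hx =>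
    hh'.intg_of_sq.of_bind hx
  have hJ : Intg (p.bind fun x => (k x).map fun y => (x, y)) fun q => h q.2 • u q.1 := by
    refine Intg.bind (fun x hx => (intg_map (g := fun y => (x, y))
      (f := fun q : X × Y => h q.2 • u q.1)).2 ((hI x hx).smul_const (u x))) ?_
    have hn : ExpectLE (p.bind k) (fun y => ‖‖h y‖‖ ^ 2) b := by simpa using hh
    have h0 : ExpectLE p (fun x => (expect (k x) fun y => ‖h y‖) ^ 2) b := by
      have := sq_expect_of_bind (f := fun y => ‖h y‖) hn
      simpa only [Real.norm_eq_abs, sq_abs] using this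
    have h1 := (intg_smul_of_sq h0 hu).1
    refine h1.mono fun x hx => ?_
    rw [expect_map (g := fun y => (x, y)) (f := fun q : X × Y => ‖h q.2 • u q.1‖)
      ((hI x hx).smul_const (u x)).norm]
    simp only [norm_smul]
    have e : expect (k x) (fun y => ‖h y‖ * ‖u x‖) = expect (k x) (fun y => ‖h y‖) * ‖u x‖ := by
      simpa using expect_smul_const (hI x hx).norm ‖u x‖
    rw [e, norm_mul, norm_norm]
  refine ⟨hJ, ?_⟩
  rw [expect_bind hJ]
  refine expect_congr fun x hx => ?_
  exact (expect_map (g := fun y => (x, y)) (f := fun q : X × Y => h q.2 • u q.1)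
    ((hI x hx).smul_const (u x))).trans (expect_smul_const (hI x hx) (u x))

namespace SecondMoments

variable {a b : ℝ}

theorem feature_self (h : SecondMoments M π ψ ν a b) : ExpectLE ν (fun s => ‖ψ s‖ ^ 2) a := by
  have := h.feature 0
  rwa [show ν.bind (stateLaw M π 0) = ν from PMF.bind_pure _] at this

theorem intg_feature (h : SecondMoments M π ψ ν a b) : Intg ν ψ := h.feature_self.intg_of_sq

theorem meanFeature_sq (h : SecondMoments M π ψ ν a b) (m : ℕ) :
    ExpectLE ν (fun s => ‖meanFeature M π ψ m s‖ ^ 2) a := sq_expect_of_bind (h.feature m)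

theorem meanReward_sq (h : SecondMoments M π ψ ν a b) (m : ℕ) :
    ExpectLE ν (fun s => meanReward M π m s ^ 2) b := by
  simpa [meanReward] using sq_expect_of_bind (f := fun q : S × A => M.reward q.1 q.2)
    (by simpa using h.reward m)

theorem intg_meanFeature (h : SecondMoments M π ψ ν a b) (m : ℕ) :
    Intg ν (meanFeature M π ψ m) := (h.meanFeature_sq m).intg_of_sq

theorem intg_meanReward (h : SecondMoments M π ψ ν a b) (m : ℕ) :
    Intg ν (meanReward M π m) :=
  ExpectLE.intg_of_sq (c := b) (by simpa using h.meanReward_sq m)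

theorem intg_reward (h : SecondMoments M π ψ ν a b) (m : ℕ) :
    Intg (ν.bind (stateActionLaw M π m)) fun q => M.reward q.1 q.2 :=
  ExpectLE.intg_of_sq (c := b) (by simpa using h.reward m)

theorem expect_meanReward (h : SecondMoments M π ψ ν a b) (m : ℕ) :
    expect (ν.bind (stateActionLaw M π m)) (fun q => M.reward q.1 q.2)
      = expect ν (meanReward M π m) := expect_bind (h.intg_reward m)

theorem expect_meanFeature (h : SecondMoments M π ψ ν a b) (m : ℕ) :
    expect (ν.bind (stateLaw M π m)) ψ = expect ν (meanFeature M π ψ m) :=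
  expect_bind (h.feature m).intg_of_sq

theorem inner_sq (h : SecondMoments M π ψ ν a b) (m : ℕ) (θ : Vec d) :
    ExpectLE (ν.bind (stateLaw M π m)) (fun s => (inner ℝ (ψ s) θ : ℝ) ^ 2) (‖θ‖ ^ 2 * a) := by
  refine ((h.feature m).const_mul (sq_nonneg ‖θ‖)).mono (fun _ => sq_nonneg _) fun s _ => ?_
  rw [← mul_pow, ← sq_abs]
  refine pow_le_pow_left₀ (abs_nonneg _) ?_ 2
  rw [mul_comm]
  exact abs_real_inner_le_norm _ _

theorem joint_eq (ν : PMF S) (m : ℕ) {E : Type*} [NormedAddCommGroup E] [NormedSpace ℝ E]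
    [CompleteSpace E] {f : S × S → E}
    (h : Intg (ν.bind fun s => (stateLaw M π m s).map fun t => (s, t)) f) :
    (Intg (jointLaw M π ν m) fun q => f (q.1, q.2.1)) ∧
    expect (jointLaw M π ν m) (fun q => f (q.1, q.2.1))
      = expect (ν.bind fun s => (stateLaw M π m s).map fun t => (s, t)) f := by
  have e : (jointLaw M π ν m).map (fun q => (q.1, q.2.1))
      = ν.bind fun s => (stateLaw M π m s).map fun t => (s, t) := by
    unfold jointLaw
    rw [PMF.map_bind]
    congr 1
    funext s
    rw [PMF.map_comp, ← stateActionLaw_fst, PMF.map_comp]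
    rfl
  rw [← e] at h ⊢
  have h' := intg_map.1 h
  exact ⟨h', (expect_map h').symm⟩

/-- Applying the averaged rank-one operator to θ and conditioning on the first state replaces the
later feature by its conditional mean. Spectral-norm hypotheses thus become estimates for
vector-valued means. -/
theorem expect_cross (h : SecondMoments M π ψ ν a b) (m : ℕ) (θ : Vec d) :
    expect (jointLaw M π ν m) (fun q => InnerProductSpace.rankOne ℝ (ψ q.1) (ψ q.2.1)) θ
      = expect ν fun s => (inner ℝ (meanFeature M π ψ m s) θ : ℝ) • ψ s := by
  have h1 := (expect_lagged_smul (k := stateLaw M π m) (h := fun s => ‖ψ s‖) (h.feature m)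
    h.feature_self).1
  have h2 : Intg (ν.bind fun s => (stateLaw M π m s).map fun t => (s, t))
      fun q => InnerProductSpace.rankOne ℝ (ψ q.1) (ψ q.2) :=
    h1.mono fun q _ => by
      rw [InnerProductSpace.norm_rankOne, norm_smul, norm_norm, mul_comm]
  rw [(joint_eq ν m h2).2]
  have h3 := expect_lagged_smul (h.inner_sq m θ) h.feature_self
  have h4 := expect_clm h2 (ContinuousLinearMap.apply ℝ (Vec d) θ)
  simp only [ContinuousLinearMap.apply_apply, InnerProductSpace.rankOne_apply] at h4
  rw [← h4, h3.2]
  refine expect_congr fun s hs => ?_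
  have hi : Intg (stateLaw M π m s) ψ := (h.feature m).intg_of_sq.of_bind hs
  congr 1
  have := expect_inner_left hi θ
  simp only [real_inner_comm] at this ⊢
  exact this

theorem expect_reward_cross (h : SecondMoments M π ψ ν a b) (m : ℕ) :
    expect (jointLaw M π ν m) (fun q => M.reward q.2.1 q.2.2 • ψ q.1)
      = expect ν fun s => meanReward M π m s • ψ s :=
  (expect_lagged_smul (h.reward m) h.feature_self).2

end SecondMoments

/-! ### Rewards averaged over the actions -/

theorem intg_of_finite {X E : Type*} [Finite X] [NormedAddCommGroup E] (p : PMF X) (f : X → E) :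
    Intg p f := Summable.of_finite

theorem meanReward_zero [Finite A] (s : S) : meanReward M π 0 s = rewardPi M π s := by
  unfold meanReward stateActionLaw
  rw [stateLaw_zero, PMF.pure_bind, expect_map (intg_of_finite _ _)]
  rfl

theorem rewardPi_eq [Finite A] : rewardPi M π = meanReward M π 0 :=
  funext fun s => (meanReward_zero s).symm

variable {a b : ℝ}

theorem expect_stateLaw_meanReward {s : S} {k : ℕ}
    (h : SecondMoments M π ψ (stateLaw M π k s) a b) (m : ℕ) :
    expect (stateLaw M π k s) (meanReward M π m) = meanReward M π (k + m) s := by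
  rw [← h.expect_meanReward, stateLaw_bind_stateAction]
  rfl

theorem expect_stateLaw_meanFeature {s : S} {k : ℕ}
    (h : SecondMoments M π ψ (stateLaw M π k s) a b) (m : ℕ) :
    expect (stateLaw M π k s) (meanFeature M π ψ m) = meanFeature M π ψ (k + m) s := by
  rw [← h.expect_meanFeature, stateLaw_bind]
  rfl

/-! ### Second moments under the standing assumptions -/

/-- The fourth moment bounds hold at every time, so the law reached after k further steps inherits
them; Jensen takes the square root. -/
theorem StabilityAssumption.secondMoments {ρ : ℝ} {f₁ f₂ f₃ : S → ℝ}
    (h : StabilityAssumption M π μ ψ ρ f₁ f₂ f₃) (k : ℕ) (s : S) :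
    SecondMoments M π ψ (stateLaw M π k s) (√(f₃ s)) (√(f₃ s)) where
  feature m := by
    rw [stateLaw_bind]
    refine ExpectLE.le_sqrt ?_ fun _ => sq_nonneg _
    simpa [← pow_mul] using h.feature_moment s (k + m)
  reward m := by
    rw [stateLaw_bind_stateAction]
    refine ExpectLE.le_sqrt ?_ fun _ => sq_nonneg _
    simpa [← pow_mul] using h.reward_moment s (k + m)

theorem bind_map_mk_apply (μ : PMF S) (π : S → PMF A) (q : S × A) :
    (μ.bind fun s => (π s).map fun a => (s, a)) q = μ q.1 * π q.1 q.2 := by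
  classical
  rw [PMF.bind_apply, tsum_eq_single q.1]
  · congr 1
    rw [PMF.map_apply, tsum_eq_single q.2]
    · simp
    · intro a ha
      rw [if_neg]
      intro h
      exact ha (by rw [h])
  · intro s hs
    rw [PMF.map_apply, ENNReal.tsum_eq_zero.2, mul_zero]
    intro a
    rw [if_neg]
    intro h
    exact hs (by rw [h])

/-- Under μ the law of (S_m, A_m) does not depend on m, so the single moment hypothesis covers every
lag. -/
theorem ChainAssumption.reward_fourth {rhat : ℝ} (h : ChainAssumption M π μ rhat) (m : ℕ) :
    ExpectLE (μ.bind (stateActionLaw M π m)) (fun q => M.reward q.1 q.2 ^ 4) (rhat ^ 2) := by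
  have e : μ.bind (stateActionLaw M π m) = μ.bind fun s => (π s).map fun a => (s, a) := by
    conv_rhs => rw [← h.stationary.bind_stateLaw m, PMF.bind_bind]
    rfl
  rw [e]
  have e2 : (fun q : S × A => (((μ.bind fun s => (π s).map fun a => (s, a)) q).toReal)
      * M.reward q.1 q.2 ^ 4)
      = fun q => (μ q.1).toReal * (π q.1 q.2).toReal * M.reward q.1 q.2 ^ 4 := by
    funext q
    rw [bind_map_mk_apply, ENNReal.toReal_mul]
  refine ⟨by rw [e2]; exact h.reward_moment.summable, ?_⟩
  unfold expect
  simp only [smul_eq_mul]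
  rw [e2, h.reward_moment.tsum_eq]

theorem FeatureAssumption.feature_sq {ψhat : ℝ} (h : FeatureAssumption μ ψ ψhat) :
    ExpectLE μ (fun s => ‖ψ s‖ ^ 2) (d * ψhat ^ 2) := by
  have key : ∀ t : Finset (Fin d), ExpectLE μ (fun s => ∑ j ∈ t, ψ s j ^ 2) (t.card * ψhat ^ 2) := by
    classical
    intro t
    induction t using Finset.induction_on with
    | empty => simpa using ExpectLE.const μ 0
    | insert j t hj ih =>
      simp only [Finset.sum_insert hj, Finset.card_insert_of_notMem hj]
      refine ((h.moment j).add ih).mono_const (le_of_eq ?_)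
      push_cast
      ring
  simpa [EuclideanSpace.norm_sq_eq] using key Finset.univ

theorem stationary_secondMoments {rhat ψhat : ℝ} (hc : ChainAssumption M π μ rhat)
    (hf : FeatureAssumption μ ψ ψhat) :
    SecondMoments M π ψ μ (d * ψhat ^ 2) (√(rhat ^ 2)) where
  feature m := by
    rw [hc.stationary.bind_stateLaw]
    exact hf.feature_sq
  reward m := by
    refine ExpectLE.le_sqrt ?_ fun _ => sq_nonneg _
    simpa [← pow_mul] using hc.reward_fourth m

theorem sq_rewardPi_le [Finite A] (s : S) :
    rewardPi M π s ^ 2 ≤ expect (π s) fun a => M.reward s a ^ 2 := by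
  have := sq_norm_expect_le (p := π s) (f := fun a => M.reward s a)
    (c := expect (π s) fun a => M.reward s a ^ 2)
    (by simpa using (intg_of_finite (π s) fun a => M.reward s a ^ 2).expectLE le_rfl)
  simpa [rewardPi] using this

/-- The stability hypothesis compares a sampled reward along the chain with an averaged one under μ.
Integrating the action out shows that both have the same conditional mean, `meanReward`. -/
theorem expect_reward_cross_avg [Finite A] (h : SecondMoments M π ψ ν a b) (m : ℕ) :
    expect (jointLaw M π ν m) (fun q => rewardPi M π q.2.1 • ψ q.1)
      = expect ν fun s => meanReward M π m s • ψ s := by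
  have e : ν.bind (stateActionLaw M π m)
      = (ν.bind (stateLaw M π m)).bind fun t => (π t).map fun a => (t, a) := by
    rw [PMF.bind_bind]
    rfl
  have h1 : ExpectLE (ν.bind (stateLaw M π m)) (fun s => rewardPi M π s ^ 2) b := by
    have := h.reward m
    rw [e] at this
    refine (this.of_bind fun _ => sq_nonneg _).mono (fun _ => sq_nonneg _) fun s _ => ?_
    rw [expect_map (intg_of_finite _ _)]
    exact sq_rewardPi_le s
  have h2 := expect_lagged_smul h1 h.feature_self
  rw [(SecondMoments.joint_eq ν m h2.1).2, h2.2]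
  refine expect_congr fun s hs => ?_
  congr 1
  have hi := (h.intg_reward m).of_bind hs
  have hi' := expect_bind (show Intg ((stateLaw M π m s).bind fun t => (π t).map fun a => (t, a))
    fun q => M.reward q.1 q.2 from hi)
  refine Eq.trans ?_ hi'.symm
  refine expect_congr fun t _ => ?_
  rw [expect_map (intg_of_finite _ _)]
  rfl

/-! ### Geometric convergence of mean rewards and of mean features -/

variable {ρ rhat ψhat : ℝ} {f₁ f₂ f₃ : S → ℝ}

theorem rbar_eq [Finite A] : rbar M π μ = expect μ (meanReward M π 0) := by
  rw [rbar, rewardPi_eq]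

theorem StabilityAssumption.meanReward_conv (h : StabilityAssumption M π μ ψ ρ f₁ f₂ f₃) (k : ℕ)
    (s : S) : |meanReward M π k s - rbar M π μ| ≤ ρ ^ k * f₁ s := h.reward_conv s k

theorem StabilityAssumption.meanFeature_conv (h : StabilityAssumption M π μ ψ ρ f₁ f₂ f₃) (k : ℕ)
    (s : S) : ‖meanFeature M π ψ k s - expect μ ψ‖ ≤ ρ ^ k * f₁ s := h.feature_conv s k

theorem StabilityAssumption.cross_conv' (h : StabilityAssumption M π μ ψ ρ f₁ f₂ f₃)
    (hμ : SecondMoments M π ψ μ a b) (k m : ℕ) (s : S) (θ : Vec d) :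
    ‖expect (stateLaw M π k s) (fun t => (inner ℝ (meanFeature M π ψ m t) θ : ℝ) • ψ t)
      - expect μ (fun t => (inner ℝ (meanFeature M π ψ m t) θ : ℝ) • ψ t)‖
      ≤ ρ ^ k * f₁ s * ‖θ‖ := by
  rw [← (h.secondMoments k s).expect_cross m θ, ← hμ.expect_cross m θ, ← sub_apply]
  exact ContinuousLinearMap.le_of_opNorm_le _ (h.cross_conv s k m) θ

theorem StabilityAssumption.reward_cross_conv [Finite A]
    (h : StabilityAssumption M π μ ψ ρ f₁ f₂ f₃)
    (hμ : SecondMoments M π ψ μ a b) (k m : ℕ) (s : S) :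
    ‖expect (stateLaw M π k s) (fun t => meanReward M π m t • ψ t)
      - expect μ (fun t => meanReward M π m t • ψ t)‖ ≤ ρ ^ k * f₁ s := by
  rw [← (h.secondMoments k s).expect_reward_cross m, ← expect_reward_cross_avg hμ m]
  exact h.feature_reward_conv s k m

end Chain

end AvgTD

end

open scoped ENNReal

noncomputable section

namespace AvgTD

/-! ### Poisson equations, the discounted signal and its mean field -/

section Poisson

variable {S A : Type*} {d : ℕ} {M : MDP S A} {π : S → PMF A} {μ ν : PMF S} {ψ : S → Vec d}
  {ρ lam a b : ℝ} {f₁ f₂ f₃ : S → ℝ}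

/-! ### Poisson equations of the state chain -/

theorem StabilityAssumption.intg_f₁ (h : StabilityAssumption M π μ ψ ρ f₁ f₂ f₃) (k : ℕ) (s : S) :
    Intg (stateLaw M π k s) f₁ := by
  have h1 : ExpectLE (stateLaw M π k s) (fun s => ‖f₁ s‖ ^ 2) (√(f₂ s)) := by
    refine ExpectLE.le_sqrt ?_ fun _ => sq_nonneg _
    simpa [← pow_mul] using h.f₁_moment s k
  exact h1.intg_of_sq

/-- `∑_i (P^i w - w̄)`, a solution of the Poisson equation `u - P u = w - w̄`. -/
def poissonSol {E : Type*} [NormedAddCommGroup E] [NormedSpace ℝ E] (M : MDP S A) (π : S → PMF A)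
    (w : S → E) (wbar : E) (s : S) : E :=
  ∑' i, (expect (stateLaw M π i s) w - wbar)

/-- `w` is integrable along the chain and its mean converges to `wbar` geometrically. -/
structure GeomConv {E : Type*} [NormedAddCommGroup E] [NormedSpace ℝ E] (M : MDP S A)
    (π : S → PMF A) (ρ : ℝ) (f₁ : S → ℝ) (K : ℝ) (w : S → E) (wbar : E) : Prop where
  intg : ∀ k s, Intg (stateLaw M π k s) w
  conv : ∀ k s, ‖expect (stateLaw M π k s) w - wbar‖ ≤ ρ ^ k * (K * f₁ s)

namespace GeomConv

variable {E : Type*} [NormedAddCommGroup E] [NormedSpace ℝ E] {K K' : ℝ}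
  {w w' : S → E} {wbar wbar' : E}

theorem summable_norm (h : GeomConv M π ρ f₁ K w wbar) (h0 : 0 ≤ ρ) (h1 : ρ < 1) (s : S) :
    Summable fun i => ‖expect (stateLaw M π i s) w - wbar‖ :=
  ((summable_geometric_of_lt_one h0 h1).mul_right _).of_nonneg_of_le
    (fun _ => norm_nonneg _) fun i => h.conv i s

theorem norm_poissonSol_le (h : GeomConv M π ρ f₁ K w wbar) (h0 : 0 ≤ ρ) (h1 : ρ < 1) (s : S) :
    ‖poissonSol M π w wbar s‖ ≤ K * f₁ s / (1 - ρ) := by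
  refine (norm_tsum_le_tsum_norm (h.summable_norm h0 h1 s)).trans ?_
  refine ((h.summable_norm h0 h1 s).tsum_le_tsum (h.conv · s)
    ((summable_geometric_of_lt_one h0 h1).mul_right _)).trans_eq ?_
  rw [tsum_mul_right, tsum_geometric_of_lt_one h0 h1]
  field_simp

theorem poissonSol_sub [CompleteSpace E] (h : GeomConv M π ρ f₁ K w wbar) (h' : GeomConv M π ρ f₁ K' w' wbar')
    (h0 : 0 ≤ ρ) (h1 : ρ < 1) (s : S) :
    poissonSol M π w wbar s - poissonSol M π w' wbar' s
      = poissonSol M π (fun s => w s - w' s) (wbar - wbar') s := by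
  unfold poissonSol
  rw [← (h.summable_norm h0 h1 s).of_norm.tsum_sub (h'.summable_norm h0 h1 s).of_norm]
  refine tsum_congr fun i => ?_
  rw [expect_sub (h.intg i s) (h'.intg i s)]
  abel

/-- Applying P shifts every term of the series by one, so P u is u without its zeroth term w - w̄.
The exchange of P with the series is justified by the geometric bound and integrability of `f₁`. -/
theorem poisson_eq [CompleteSpace E] (h : GeomConv M π ρ f₁ K w wbar) (h0 : 0 ≤ ρ) (h1 : ρ < 1)
    (hf : ∀ s, Intg (step M π s) f₁) (s : S) :
    Intg (step M π s) (poissonSol M π w wbar) ∧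
      expect (step M π s) (poissonSol M π w wbar) = poissonSol M π w wbar s - (w s - wbar) := by
  have hs := fun i => (h.intg (i + 1) s)
  simp only [← step_bind_stateLaw] at hs
  have hI : ∀ i, Intg (step M π s) fun t => expect (stateLaw M π i t) w - wbar := fun i =>
    (hs i).expect_of_bind.sub (Intg.const _ _)
  have hsum : Summable fun i => expect (step M π s) fun t =>
      ‖expect (stateLaw M π i t) w - wbar‖ := by
    refine ((summable_geometric_of_lt_one h0 h1).mul_right
      (K * expect (step M π s) f₁)).of_nonneg_of_le
      (fun i => expect_nonneg fun _ _ => norm_nonneg _) fun i => ?_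
    rw [← expect_const_mul (hf s), ← expect_const_mul ((hf s).const_mul K)]
    exact expect_mono (hI i).norm (((hf s).const_mul K).const_mul _) fun t _ => h.conv i t
  have key := intg_tsum_and_expect_tsum hI hsum
  refine ⟨key.2.1, key.2.2.trans ?_⟩
  have e : ∀ i, expect (step M π s) (fun t => expect (stateLaw M π i t) w - wbar)
      = expect (stateLaw M π (i + 1) s) w - wbar := fun i => by
    rw [expect_sub (hs i).expect_of_bind (Intg.const _ _), expect_const, ← expect_bind (hs i),
      step_bind_stateLaw]
  simp only [e]
  have h3 := (h.summable_norm h0 h1 s).of_norm.tsum_eq_zero_add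
  unfold poissonSol
  rw [h3, stateLaw_zero, expect_pure]
  abel

end GeomConv

/-! ### The temporal difference signal -/

/-- Expected value, `l` steps after a visit to `s`, of
`c R(S_l, A_l) - r + (ψ(S_{l+1}) - ψ(S_l))ᵀ θ`. -/
def signal (M : MDP S A) (π : S → PMF A) (ψ : S → Vec d) (c r : ℝ) (θ : Vec d) (l : ℕ) (s : S) :
    ℝ :=
  c * meanReward M π l s - r
    + inner ℝ (meanFeature M π ψ (l + 1) s - meanFeature M π ψ l s) θ

variable {c r : ℝ} {θ : Vec d}

theorem signal_sub (c r c' r' : ℝ) (θ θ' : Vec d) (l : ℕ) (s : S) :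
    signal M π ψ c r θ l s - signal M π ψ c' r' θ' l s
      = signal M π ψ (c - c') (r - r') (θ - θ') l s := by
  unfold signal
  rw [inner_sub_right]
  ring

/-- The mean reward tends to r̄, and the mean feature increment tends to zero because both features
have the same limit. The factor 2 collects the two feature errors, using ρ^(l+1) ≤ ρ^l. -/
theorem signal_conv (h : StabilityAssumption M π μ ψ ρ f₁ f₂ f₃) (c r : ℝ) (θ : Vec d) (l : ℕ)
    (s : S) :
    |signal M π ψ c r θ l s - (c * rbar M π μ - r)| ≤ ρ ^ l * ((|c| + 2 * ‖θ‖) * f₁ s) := by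
  have h1 := h.meanReward_conv l s
  have h2 := h.meanFeature_conv l s
  have h3 := h.meanFeature_conv (l + 1) s
  have h4 : ρ ^ (l + 1) * f₁ s ≤ ρ ^ l * f₁ s := mul_le_mul_of_nonneg_right
    (pow_le_pow_of_le_one h.rho_pos.le h.rho_lt_one.le (Nat.le_succ l)) (h.f₁_nonneg s)
  have h5 : ‖meanFeature M π ψ (l + 1) s - meanFeature M π ψ l s‖ ≤ 2 * (ρ ^ l * f₁ s) := by
    have := norm_sub_le (meanFeature M π ψ (l + 1) s - expect μ ψ)
      (meanFeature M π ψ l s - expect μ ψ)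
    rw [sub_sub_sub_cancel_right] at this
    linarith
  have h6 := abs_real_inner_le_norm (meanFeature M π ψ (l + 1) s - meanFeature M π ψ l s) θ
  have h7 := mul_le_mul_of_nonneg_right h5 (norm_nonneg θ)
  have h8 : |c * (meanReward M π l s - rbar M π μ)| ≤ |c| * (ρ ^ l * f₁ s) := by
    rw [abs_mul]
    exact mul_le_mul_of_nonneg_left h1 (abs_nonneg c)
  have e : signal M π ψ c r θ l s - (c * rbar M π μ - r)
      = c * (meanReward M π l s - rbar M π μ)
        + inner ℝ (meanFeature M π ψ (l + 1) s - meanFeature M π ψ l s) θ := by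
    unfold signal; ring
  rw [e]
  refine (abs_add_le _ _).trans ?_
  nlinarith

theorem SecondMoments.signal_sq (h : SecondMoments M π ψ ν a b) (c r : ℝ) (θ : Vec d) (l : ℕ) :
    ExpectLE ν (fun s => signal M π ψ c r θ l s ^ 2)
      (3 * c ^ 2 * b + 3 * r ^ 2 + 6 * ‖θ‖ ^ 2 * (a + a)) := by
  have h1 := ((h.meanReward_sq l).const_mul (c := 3 * c ^ 2) (by positivity)).add
    (ExpectLE.const ν (3 * r ^ 2))
  have h2 := ((h.meanFeature_sq (l + 1)).add (h.meanFeature_sq l)).const_mul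
    (c := 6 * ‖θ‖ ^ 2) (by positivity)
  refine (h1.add h2).mono (fun _ => sq_nonneg _) fun s _ => ?_
  unfold signal
  set x := meanFeature M π ψ (l + 1) s
  set y := meanFeature M π ψ l s
  have h3 : (inner ℝ (x - y) θ : ℝ) ^ 2 ≤ (‖x - y‖ * ‖θ‖) ^ 2 := by
    rw [← sq_abs]
    exact pow_le_pow_left₀ (abs_nonneg _) (abs_real_inner_le_norm _ _) 2
  have h4 : ‖x - y‖ ^ 2 ≤ 2 * (‖x‖ ^ 2 + ‖y‖ ^ 2) := by
    have := pow_le_pow_left₀ (norm_nonneg _) (norm_sub_le x y) 2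
    nlinarith [sq_nonneg (‖x‖ - ‖y‖)]
  have h5 := mul_le_mul_of_nonneg_right h4 (sq_nonneg ‖θ‖)
  rw [mul_pow] at h3
  set u := c * meanReward M π l s with hu
  set i : ℝ := inner ℝ (x - y) θ
  have h6 : 3 * c ^ 2 * meanReward M π l s ^ 2 = 3 * u ^ 2 := by rw [hu]; ring
  rw [h6]
  nlinarith [sq_nonneg (u + r), sq_nonneg (u - i), sq_nonneg (r + i)]

theorem SecondMoments.expect_signal_smul (h : SecondMoments M π ψ ν a b) (c r : ℝ) (θ : Vec d)
    (l : ℕ) :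
    expect ν (fun s => signal M π ψ c r θ l s • ψ s)
      = c • expect ν (fun s => meanReward M π l s • ψ s) - r • expect ν ψ
        + (expect ν (fun s => (inner ℝ (meanFeature M π ψ (l + 1) s) θ : ℝ) • ψ s)
          - expect ν (fun s => (inner ℝ (meanFeature M π ψ l s) θ : ℝ) • ψ s)) := by
  have h1 := (intg_smul_of_sq (h.meanReward_sq l) h.feature_self).1
  have h2 : ∀ m, Intg ν fun s => (inner ℝ (meanFeature M π ψ m s) θ : ℝ) • ψ s := fun m => by
    refine (intg_smul_of_sq (h := fun s => (inner ℝ (meanFeature M π ψ m s) θ : ℝ))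
      (b := ‖θ‖ ^ 2 * a) ?_ h.feature_self).1
    refine ((h.meanFeature_sq m).const_mul (sq_nonneg ‖θ‖)).mono (fun _ => sq_nonneg _)
      fun s _ => ?_
    rw [← mul_pow, ← sq_abs, mul_comm]
    exact pow_le_pow_left₀ (abs_nonneg _) (abs_real_inner_le_norm _ _) 2
  rw [← expect_const_smul h1, ← expect_const_smul h.intg_feature, ← expect_sub (h2 _) (h2 _),
    ← expect_sub (h1.const_smul c) (h.intg_feature.const_smul r),
    ← expect_add ((h1.const_smul c).sub (h.intg_feature.const_smul r)) ((h2 _).sub (h2 _))]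
  congr 1
  funext s
  unfold signal
  rw [inner_sub_left, add_smul, sub_smul, sub_smul, smul_smul]

/-- The rate is in k alone and is uniform in the lag l. This uniformity lets the λ-sum over l be
taken without losing the factor ρ^k. -/
theorem signal_smul_conv [Finite A] (h : StabilityAssumption M π μ ψ ρ f₁ f₂ f₃)
    (hμ : SecondMoments M π ψ μ a b) (c r : ℝ) (θ : Vec d) (l k : ℕ) (s : S) :
    ‖expect (stateLaw M π k s) (fun t => signal M π ψ c r θ l t • ψ t)
      - expect μ (fun t => signal M π ψ c r θ l t • ψ t)‖
      ≤ ρ ^ k * ((|c| + |r| + 2 * ‖θ‖) * f₁ s) := by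
  rw [(h.secondMoments k s).expect_signal_smul, hμ.expect_signal_smul]
  have h1 := h.reward_cross_conv hμ k l s
  have h2 := h.meanFeature_conv k s
  have h3 := h.cross_conv' hμ k (l + 1) s θ
  have h4 := h.cross_conv' hμ k l s θ
  unfold meanFeature at h2
  have e : ∀ x x' y y' z z' w w' : Vec d, c • x - r • y + (z - w) - (c • x' - r • y' + (z' - w'))
      = c • (x - x') - r • (y - y') + ((z - z') - (w - w')) := fun x x' y y' z z' w w' => by
    rw [smul_sub, smul_sub]; abel
  rw [e]
  refine (norm_add_le _ _).trans ?_
  refine (add_le_add (norm_sub_le _ _) (norm_sub_le _ _)).trans ?_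
  rw [norm_smul, norm_smul, Real.norm_eq_abs, Real.norm_eq_abs]
  have h5 := mul_le_mul_of_nonneg_left h1 (abs_nonneg c)
  have h6 := mul_le_mul_of_nonneg_left h2 (abs_nonneg r)
  linarith

theorem expect_signal (h : StabilityAssumption M π μ ψ ρ f₁ f₂ f₃) (c r : ℝ) (θ : Vec d)
    (k l : ℕ) (s : S) :
    expect (stateLaw M π k s) (signal M π ψ c r θ l) = signal M π ψ c r θ (k + l) s := by
  have hm := h.secondMoments k s
  have h1 := (hm.intg_meanReward l).const_mul c
  have h2 := (hm.intg_meanFeature (l + 1)).sub (hm.intg_meanFeature l)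
  have h3 : Intg (stateLaw M π k s) fun t =>
      (inner ℝ (meanFeature M π ψ (l + 1) t - meanFeature M π ψ l t) θ : ℝ) := by
    simpa [real_inner_comm] using h2.clm (innerSL ℝ θ)
  have e : expect (stateLaw M π k s) (fun t =>
      (inner ℝ (meanFeature M π ψ (l + 1) t - meanFeature M π ψ l t) θ : ℝ))
      = inner ℝ (meanFeature M π ψ (k + l + 1) s - meanFeature M π ψ (k + l) s) θ := by
    have := expect_inner_left h2 θ
    rw [expect_sub (hm.intg_meanFeature _) (hm.intg_meanFeature _),
      expect_stateLaw_meanFeature hm, expect_stateLaw_meanFeature hm] at this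
    simpa only [real_inner_comm, add_assoc] using this
  unfold signal
  rw [expect_add (h1.sub (Intg.const _ r)) h3, expect_sub h1 (Intg.const _ r), expect_const, e,
    expect_const_mul (hm.intg_meanReward l), expect_stateLaw_meanReward hm]

/-! ### The discounted sum of the signal -/

/-- `∑_l λ^l E_s[signal at time l]`. -/
def resolvent (M : MDP S A) (π : S → PMF A) (ψ : S → Vec d) (lam c r : ℝ) (θ : Vec d) (s : S) :
    ℝ := ∑' l, lam ^ l * signal M π ψ c r θ l s

/-- The signal splits into its limit, discounted by λ, and a deviation that also decays like ρ^l.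
This is why both 1 - λ and 1 - λρ appear as denominators later. -/
theorem resolvent_term_le (h : StabilityAssumption M π μ ψ ρ f₁ f₂ f₃) (h0 : 0 ≤ lam)
    (c r : ℝ) (θ : Vec d) (l : ℕ) (s : S) :
    ‖lam ^ l * signal M π ψ c r θ l s‖
      ≤ lam ^ l * |c * rbar M π μ - r| + (lam * ρ) ^ l * ((|c| + 2 * ‖θ‖) * f₁ s) := by
  have h1 := signal_conv h c r θ l s
  rw [norm_mul, Real.norm_eq_abs, Real.norm_eq_abs, abs_of_nonneg (pow_nonneg h0 l), mul_pow,
    mul_assoc, ← mul_add]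
  refine mul_le_mul_of_nonneg_left ?_ (pow_nonneg h0 l)
  have := abs_sub_abs_le_abs_sub (signal M π ψ c r θ l s) (c * rbar M π μ - r)
  linarith

theorem summable_resolvent_bound (h : StabilityAssumption M π μ ψ ρ f₁ f₂ f₃) (h0 : 0 ≤ lam)
    (h1 : lam < 1) (x y : ℝ) : HasSum (fun l : ℕ => lam ^ l * x + (lam * ρ) ^ l * y)
      (x / (1 - lam) + y / (1 - lam * ρ)) := by
  have h2 : lam * ρ < 1 := by nlinarith [h.rho_pos, h.rho_lt_one]
  rw [div_eq_inv_mul, div_eq_inv_mul]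
  exact ((hasSum_geometric_of_lt_one h0 h1).mul_right x).add
    ((hasSum_geometric_of_lt_one (mul_nonneg h0 h.rho_pos.le) h2).mul_right y)

theorem summable_resolvent (h : StabilityAssumption M π μ ψ ρ f₁ f₂ f₃) (h0 : 0 ≤ lam)
    (h1 : lam < 1) (c r : ℝ) (θ : Vec d) (s : S) :
    Summable fun l => ‖lam ^ l * signal M π ψ c r θ l s‖ :=
  (summable_resolvent_bound h h0 h1 _ _).summable.of_nonneg_of_le (fun _ => norm_nonneg _)
    (resolvent_term_le h h0 c r θ · s)

theorem abs_resolvent_le (h : StabilityAssumption M π μ ψ ρ f₁ f₂ f₃) (h0 : 0 ≤ lam)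
    (h1 : lam < 1) (c r : ℝ) (θ : Vec d) (s : S) :
    |resolvent M π ψ lam c r θ s|
      ≤ |c * rbar M π μ - r| / (1 - lam) + (|c| + 2 * ‖θ‖) * f₁ s / (1 - lam * ρ) := by
  refine (norm_tsum_le_tsum_norm (summable_resolvent h h0 h1 c r θ s)).trans ?_
  have hb := summable_resolvent_bound h h0 h1 (|c * rbar M π μ - r|) ((|c| + 2 * ‖θ‖) * f₁ s)
  rw [← hb.tsum_eq]
  exact (summable_resolvent h h0 h1 c r θ s).tsum_le_tsum (resolvent_term_le h h0 c r θ · s)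
    hb.summable

theorem resolvent_sub (h : StabilityAssumption M π μ ψ ρ f₁ f₂ f₃) (h0 : 0 ≤ lam)
    (h1 : lam < 1) (c r c' r' : ℝ) (θ θ' : Vec d) (s : S) :
    resolvent M π ψ lam c r θ s - resolvent M π ψ lam c' r' θ' s
      = resolvent M π ψ lam (c - c') (r - r') (θ - θ') s := by
  unfold resolvent
  rw [← (summable_resolvent h h0 h1 c r θ s).of_norm.tsum_sub
    (summable_resolvent h h0 h1 c' r' θ' s).of_norm]
  refine tsum_congr fun l => ?_
  rw [← mul_sub, signal_sub]

/-- Separating the term l = 0 and using the tower property leaves the one-step equation u = signal₀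
+ λ P u. It is what makes the trace part of the Poisson solution work. -/
theorem resolvent_eq (h : StabilityAssumption M π μ ψ ρ f₁ f₂ f₃) (h0 : 0 ≤ lam)
    (h1 : lam < 1) (c r : ℝ) (θ : Vec d) (s : S) :
    Intg (step M π s) (resolvent M π ψ lam c r θ) ∧
    resolvent M π ψ lam c r θ s
      = signal M π ψ c r θ 0 s + lam * expect (step M π s) (resolvent M π ψ lam c r θ) := by
  have hm := h.secondMoments 1 s
  have hf := h.intg_f₁ 1 s
  have hI0 : ∀ l, Intg (stateLaw M π 1 s) (signal M π ψ c r θ l) := fun l =>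
    ExpectLE.intg_of_sq (by simpa using hm.signal_sq c r θ l)
  have hI : ∀ l, Intg (stateLaw M π 1 s) fun t => lam ^ l * signal M π ψ c r θ l t := fun l =>
    (hI0 l).const_mul _
  have hsum : Summable fun l => expect (stateLaw M π 1 s) fun t =>
      ‖lam ^ l * signal M π ψ c r θ l t‖ := by
    refine (summable_resolvent_bound h h0 h1 (|c * rbar M π μ - r|)
      ((|c| + 2 * ‖θ‖) * expect (stateLaw M π 1 s) f₁)).summable.of_nonneg_of_le
      (fun i => expect_nonneg fun _ _ => norm_nonneg _) fun l => ?_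
    have hb := (Intg.const (stateLaw M π 1 s) (lam ^ l * |c * rbar M π μ - r|)).add
      ((hf.const_mul (|c| + 2 * ‖θ‖)).const_mul ((lam * ρ) ^ l))
    refine (expect_mono (hI l).norm hb fun t _ => resolvent_term_le h h0 c r θ l t).trans_eq ?_
    rw [expect_add (Intg.const _ _) ((hf.const_mul _).const_mul _), expect_const,
      expect_const_mul (hf.const_mul _), expect_const_mul hf]
  have key := intg_tsum_and_expect_tsum hI hsum
  rw [← stateLaw_one]
  refine ⟨key.2.1, ?_⟩
  have e2 : expect (stateLaw M π 1 s) (resolvent M π ψ lam c r θ)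
      = ∑' l, lam ^ l * signal M π ψ c r θ (l + 1) s := by
    refine key.2.2.trans (tsum_congr fun l => ?_)
    rw [expect_const_mul (hI0 l), expect_signal h, add_comm 1 l]
  rw [e2, ← tsum_mul_left]
  unfold resolvent
  rw [(summable_resolvent h h0 h1 c r θ s).of_norm.tsum_eq_zero_add, pow_zero, one_mul]
  congr 1
  refine tsum_congr fun l => ?_
  rw [pow_succ]
  ring

/-- Expectation of resolvent times features, as a discounted sum of lagged moments. -/
theorem SecondMoments.expect_resolvent_smul (h : SecondMoments M π ψ ν a b) (h0 : 0 ≤ lam)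
    (h1 : lam < 1) (c r : ℝ) (θ : Vec d) :
    (Intg ν fun s => resolvent M π ψ lam c r θ s • ψ s) ∧
    (Summable fun l => ‖lam ^ l • expect ν (fun s => signal M π ψ c r θ l s • ψ s)‖) ∧
    expect ν (fun s => resolvent M π ψ lam c r θ s • ψ s)
      = ∑' l, lam ^ l • expect ν (fun s => signal M π ψ c r θ l s • ψ s) := by
  have hI0 := fun l => (intg_smul_of_sq (h.signal_sq c r θ l) h.feature_self)
  have hI : ∀ l, Intg ν fun s => lam ^ l • signal M π ψ c r θ l s • ψ s := fun l =>
    (hI0 l).1.const_smul _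
  have hle : ∀ l, expect ν (fun s => ‖lam ^ l • signal M π ψ c r θ l s • ψ s‖)
      ≤ lam ^ l * (√(3 * c ^ 2 * b + 3 * r ^ 2 + 6 * ‖θ‖ ^ 2 * (a + a)) * √a) := fun l => by
    have e : (fun s => ‖lam ^ l • signal M π ψ c r θ l s • ψ s‖)
        = fun s => lam ^ l * ‖signal M π ψ c r θ l s • ψ s‖ := by
      funext s
      rw [norm_smul, Real.norm_eq_abs, abs_of_nonneg (pow_nonneg h0 l)]
    rw [e, expect_const_mul (hI0 l).1.norm]
    exact mul_le_mul_of_nonneg_left (hI0 l).2 (pow_nonneg h0 l)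
  have hsum : Summable fun l => expect ν fun s => ‖lam ^ l • signal M π ψ c r θ l s • ψ s‖ :=
    ((summable_geometric_of_lt_one h0 h1).mul_right _).of_nonneg_of_le
      (fun i => expect_nonneg fun _ _ => norm_nonneg _) hle
  have key := intg_tsum_and_expect_tsum hI hsum
  have e : ∀ l, expect ν (fun s => lam ^ l • signal M π ψ c r θ l s • ψ s)
      = lam ^ l • expect ν (fun s => signal M π ψ c r θ l s • ψ s) := fun l =>
    expect_const_smul (hI0 l).1 _
  have e' : ∀ s, ν s ≠ 0 → resolvent M π ψ lam c r θ s • ψ s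
      = ∑' l, lam ^ l • signal M π ψ c r θ l s • ψ s := fun s hs => by
    -- Only second moments are available here, so convergence of the scalar series is extracted from
    -- that of the vector series. Where the feature vanishes, both sides are zero whether or not the
    -- scalar series converges.
    by_cases hψ : ψ s = 0
    · simp [hψ]
    · have hsm : Summable fun l => lam ^ l * signal M π ψ c r θ l s := by
        have := key.1 s hs
        simp only [smul_smul, norm_smul] at this
        exact ((summable_mul_right_iff (norm_ne_zero_iff.2 hψ)).1 this).of_norm
      unfold resolvent
      rw [← hsm.tsum_smul_const]
      simp only [smul_smul]
  refine ⟨key.2.1.mono fun s hs => by rw [e' s hs], ?_, ?_⟩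
  · refine hsum.of_nonneg_of_le (fun _ => norm_nonneg _) fun l => ?_
    rw [← e]
    exact norm_expect_le (hI l)
  · rw [expect_congr e', key.2.2]
    simp only [e]

/-- Stationary mean of the expected parameter update, `∑_l λ^l E_μ[signal_l ψ]`. -/
def meanField (M : MDP S A) (π : S → PMF A) (μ : PMF S) (ψ : S → Vec d) (lam c r : ℝ)
    (θ : Vec d) : Vec d := expect μ fun s => resolvent M π ψ lam c r θ s • ψ s

theorem resolvent_smul_geomConv [Finite A] (h : StabilityAssumption M π μ ψ ρ f₁ f₂ f₃)
    (hμ : SecondMoments M π ψ μ a b) (h0 : 0 ≤ lam) (h1 : lam < 1) (c r : ℝ) (θ : Vec d) :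
    GeomConv M π ρ f₁ ((|c| + |r| + 2 * ‖θ‖) / (1 - lam))
      (fun s => resolvent M π ψ lam c r θ s • ψ s) (meanField M π μ ψ lam c r θ) where
  intg k s := ((h.secondMoments k s).expect_resolvent_smul h0 h1 c r θ).1
  conv k s := by
    obtain ⟨-, hs, e⟩ := (h.secondMoments k s).expect_resolvent_smul h0 h1 c r θ
    obtain ⟨-, hs', e'⟩ := hμ.expect_resolvent_smul h0 h1 c r θ
    unfold meanField
    rw [e, e', ← hs.of_norm.tsum_sub hs'.of_norm]
    simp only [← smul_sub]
    have hle : ∀ l : ℕ, ‖lam ^ l • (expect (stateLaw M π k s) (fun t =>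
        signal M π ψ c r θ l t • ψ t) - expect μ (fun t => signal M π ψ c r θ l t • ψ t))‖
        ≤ lam ^ l * (ρ ^ k * ((|c| + |r| + 2 * ‖θ‖) * f₁ s)) := fun l => by
      rw [norm_smul, Real.norm_eq_abs, abs_of_nonneg (pow_nonneg h0 l)]
      exact mul_le_mul_of_nonneg_left (signal_smul_conv h hμ c r θ l k s) (pow_nonneg h0 l)
    refine (tsum_of_norm_bounded ((hasSum_geometric_of_lt_one h0 h1).mul_right _) hle).trans_eq ?_
    field_simp

theorem meanField_sub (h : StabilityAssumption M π μ ψ ρ f₁ f₂ f₃)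
    (hμ : SecondMoments M π ψ μ a b) (h0 : 0 ≤ lam) (h1 : lam < 1)
    (c r c' r' : ℝ) (θ θ' : Vec d) :
    meanField M π μ ψ lam c r θ - meanField M π μ ψ lam c' r' θ'
      = meanField M π μ ψ lam (c - c') (r - r') (θ - θ') := by
  unfold meanField
  rw [← expect_sub (hμ.expect_resolvent_smul h0 h1 c r θ).1
    (hμ.expect_resolvent_smul h0 h1 c' r' θ').1]
  simp only [← sub_smul, resolvent_sub h h0 h1]

end Poisson

end AvgTD

end

open scoped ENNReal

noncomputable section

namespace AvgTD

/-! ### The projected Bellman equation as a zero of the mean field -/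

section Fixpoint

variable {S A : Type*} {d : ℕ} {M : MDP S A} {π : S → PMF A} {μ ν : PMF S} {ψ : S → Vec d}
  {ρ lam a b rhat ψhat : ℝ} {f₁ f₂ f₃ : S → ℝ}

/-! ### Discounted sums -/

theorem summable_pow_mul_of_bounded (h0 : 0 ≤ lam) (h1 : lam < 1) {v : ℕ → ℝ} {B : ℝ}
    (hv : ∀ m, |v m| ≤ B) : Summable fun m => lam ^ m * v m := by
  refine Summable.of_norm_bounded ((summable_geometric_of_lt_one h0 h1).mul_right B) fun m => ?_
  rw [norm_mul, Real.norm_eq_abs, Real.norm_eq_abs, abs_of_nonneg (pow_nonneg h0 m)]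
  exact mul_le_mul_of_nonneg_left (hv m) (pow_nonneg h0 m)

/-- Summation by parts: increments discounted by λ^m turn into the (1-λ)λ^m averages that define
B^(λ) and P^(λ). -/
theorem tsum_pow_mul_diff (h0 : 0 ≤ lam) (h1 : lam < 1) {v : ℕ → ℝ} {B : ℝ}
    (hv : ∀ m, |v m| ≤ B) :
    ∑' m, lam ^ m * (v (m + 1) - v m) = (1 - lam) * ∑' m, lam ^ m * v (m + 1) - v 0 := by
  have s0 := summable_pow_mul_of_bounded h0 h1 hv
  have s1 := summable_pow_mul_of_bounded (v := fun m => v (m + 1)) h0 h1 fun m => hv _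
  simp only [mul_sub]
  rw [s1.tsum_sub s0, s0.tsum_eq_zero_add]
  have e : ∑' m, lam ^ (m + 1) * v (m + 1) = lam * ∑' m, lam ^ m * v (m + 1) := by
    rw [← tsum_mul_left]
    refine tsum_congr fun m => ?_
    rw [pow_succ]; ring
  rw [e]
  ring

/-! ### The operators of the theorem in terms of the signal -/

theorem StabilityAssumption.abs_inner_meanFeature_le
    (h : StabilityAssumption M π μ ψ ρ f₁ f₂ f₃) (θ : Vec d) (s : S) (m : ℕ) :
    |(inner ℝ (meanFeature M π ψ m s) θ : ℝ)| ≤ (‖expect μ ψ‖ + f₁ s) * ‖θ‖ := by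
  refine (abs_real_inner_le_norm _ _).trans (mul_le_mul_of_nonneg_right ?_ (norm_nonneg _))
  have h1 := h.meanFeature_conv m s
  have h2 : ρ ^ m * f₁ s ≤ f₁ s := mul_le_of_le_one_left (h.f₁_nonneg s)
    (pow_le_one₀ h.rho_pos.le h.rho_lt_one.le)
  have := norm_sub_norm_le (meanFeature M π ψ m s) (expect μ ψ)
  linarith

theorem expect_lin (h : StabilityAssumption M π μ ψ ρ f₁ f₂ f₃) (θ : Vec d) (m : ℕ) (s : S) :
    expect (stateLaw M π m s) (lin ψ θ) = inner ℝ (meanFeature M π ψ m s) θ := by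
  have := expect_inner_left (h.secondMoments m s).intg_feature θ
  unfold meanFeature lin
  simp only [real_inner_comm] at this ⊢
  exact this

theorem meanFeature_zero (s : S) : meanFeature M π ψ 0 s = ψ s := expect_pure s ψ

theorem lin_sub_transLam (h : StabilityAssumption M π μ ψ ρ f₁ f₂ f₃) (h0 : 0 ≤ lam)
    (h1 : lam < 1) (θ : Vec d) (s : S) :
    lin ψ θ s - transLam M π lam (lin ψ θ) s = - resolvent M π ψ lam 0 0 θ s := by
  have key := tsum_pow_mul_diff h0 h1 (h.abs_inner_meanFeature_le θ s)
  unfold resolvent signal transLam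
  simp only [expect_lin h, zero_mul, sub_self, zero_add, inner_sub_left]
  rw [key, meanFeature_zero]
  unfold lin
  ring

theorem bellman_iterate [Finite A] (h : StabilityAssumption M π μ ψ ρ f₁ f₂ f₃) (θ : Vec d)
    (m : ℕ) (s : S) :
    (bellman M π μ)^[m] (lin ψ θ) s = inner ℝ (meanFeature M π ψ m s) θ
      + ∑ i ∈ Finset.range m, (meanReward M π i s - rbar M π μ) := by
  induction m generalizing s with
  | zero => simp [meanFeature_zero, lin]
  | succ m ih =>
    have e : (bellman M π μ)^[m] (lin ψ θ) = fun s => inner ℝ (meanFeature M π ψ m s) θ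
      + ∑ i ∈ Finset.range m, (meanReward M π i s - rbar M π μ) := funext ih
    rw [Function.iterate_succ_apply', e]
    unfold bellman
    have hm := h.secondMoments 1 s
    rw [← stateLaw_one]
    have i1 : Intg (stateLaw M π 1 s) fun t => (inner ℝ (meanFeature M π ψ m t) θ : ℝ) := by
      simpa [real_inner_comm] using (hm.intg_meanFeature m).clm (innerSL ℝ θ)
    have e1 : expect (stateLaw M π 1 s) (fun t => (inner ℝ (meanFeature M π ψ m t) θ : ℝ))
        = inner ℝ (meanFeature M π ψ (m + 1) s) θ := by
      have := expect_inner_left (hm.intg_meanFeature m) θ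
      rw [expect_stateLaw_meanFeature hm, add_comm] at this
      simpa only [real_inner_comm] using this
    have e2 : ∀ n, (Intg (stateLaw M π 1 s) fun t =>
        ∑ i ∈ Finset.range n, (meanReward M π i t - rbar M π μ)) ∧
        expect (stateLaw M π 1 s) (fun t =>
          ∑ i ∈ Finset.range n, (meanReward M π i t - rbar M π μ))
          = ∑ i ∈ Finset.range n, (meanReward M π (i + 1) s - rbar M π μ) := fun n => by
      induction n with
      | zero => simpa using ⟨Intg.const (stateLaw M π 1 s) (0 : ℝ), expect_const _ (0 : ℝ)⟩
      | succ n ihn =>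
        simp only [Finset.sum_range_succ]
        have i3 := (hm.intg_meanReward n).sub (Intg.const _ (rbar M π μ))
        refine ⟨ihn.1.add i3, ?_⟩
        rw [expect_add ihn.1 i3, ihn.2, expect_sub (hm.intg_meanReward n) (Intg.const _ _),
          expect_const, expect_stateLaw_meanReward hm, add_comm 1 n]
    rw [expect_add i1 (e2 m).1, e1, (e2 m).2, Finset.sum_range_succ', ← meanReward_zero]
    ring

/-- The m-th Bellman iterate is the mean feature part plus the first m centred rewards, so its
increments in m are exactly the signals. Summation by parts then converts their discounted sum into
B^(λ)V - V. -/
theorem bellmanLam_sub_lin [Finite A] (h : StabilityAssumption M π μ ψ ρ f₁ f₂ f₃) (h0 : 0 ≤ lam)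
    (h1 : lam < 1) (θ : Vec d) (s : S) :
    bellmanLam M π μ lam (lin ψ θ) s
      = resolvent M π ψ lam 1 (rbar M π μ) θ s + lin ψ θ s := by
  have hsum : ∀ m, |∑ i ∈ Finset.range m, (meanReward M π i s - rbar M π μ)|
      ≤ (1 - ρ)⁻¹ * f₁ s := fun m => by
    refine (Finset.abs_sum_le_sum_abs _ _).trans ?_
    refine (Finset.sum_le_sum fun i _ => h.meanReward_conv i s).trans ?_
    rw [← Finset.sum_mul]
    refine mul_le_mul_of_nonneg_right ?_ (h.f₁_nonneg s)
    rw [← tsum_geometric_of_lt_one h.rho_pos.le h.rho_lt_one]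
    exact (summable_geometric_of_lt_one h.rho_pos.le h.rho_lt_one).sum_le_tsum _
      fun i _ => pow_nonneg h.rho_pos.le i
  have key := tsum_pow_mul_diff h0 h1 (v := fun m => inner ℝ (meanFeature M π ψ m s) θ
      + ∑ i ∈ Finset.range m, (meanReward M π i s - rbar M π μ)) fun m =>
    (abs_add_le _ _).trans (add_le_add (h.abs_inner_meanFeature_le θ s m) (hsum m))
  have e : resolvent M π ψ lam 1 (rbar M π μ) θ s
      = ∑' m, lam ^ m * (inner ℝ (meanFeature M π ψ (m + 1) s) θ
          + ∑ i ∈ Finset.range (m + 1), (meanReward M π i s - rbar M π μ)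
        - (inner ℝ (meanFeature M π ψ m s) θ
          + ∑ i ∈ Finset.range m, (meanReward M π i s - rbar M π μ))) := by
    unfold resolvent signal
    refine tsum_congr fun m => ?_
    rw [Finset.sum_range_succ, inner_sub_left]
    ring
  rw [e, key]
  unfold bellmanLam
  simp only [bellman_iterate h, meanFeature_zero, Finset.sum_range_zero, add_zero]
  unfold lin
  ring

/-! ### Positivity of the stationary distribution and injectivity of the features -/

/-- Some state carries mass, it reaches `t` in some number of steps, and μ is invariant under that
many steps. -/
theorem ChainAssumption.apply_ne_zero (h : ChainAssumption M π μ rhat) (t : S) : μ t ≠ 0 := by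
  obtain ⟨s, hs⟩ := μ.support_nonempty
  obtain ⟨k, hk⟩ := h.irreducible s t
  rw [← h.stationary.bind_stateLaw k, ← PMF.mem_support_iff, PMF.mem_support_bind_iff]
  exact ⟨s, hs, hk⟩

theorem FeatureAssumption.eq_zero_of_lin (h : FeatureAssumption μ ψ ψhat) {θ : Vec d}
    (hθ : ∀ s, lin ψ θ s = 0) : θ = 0 := by
  ext j
  refine h.independent θ (fun s => ?_) j
  have := hθ s
  simpa [lin, PiLp.inner_apply, mul_comm] using this

theorem FeatureAssumption.lin_injective (h : FeatureAssumption μ ψ ψhat) :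
    Function.Injective (lin ψ) := fun θ θ' e => by
  rw [← sub_eq_zero]
  refine h.eq_zero_of_lin fun s => ?_
  have := congrFun e s
  unfold lin at this ⊢
  rw [inner_sub_right, this, sub_self]

/-! ### The projected Bellman equation -/

theorem SecondMoments.intg_coord_mul (h : SecondMoments M π ψ ν a b) (i j : Fin d) :
    Intg ν fun s => ψ s i * ψ s j := by
  refine (h.feature_self.intg fun _ => sq_nonneg _).mono fun s _ => ?_
  rw [norm_mul, Real.norm_of_nonneg (sq_nonneg _), sq]
  exact mul_le_mul (PiLp.norm_apply_le _ _) (PiLp.norm_apply_le _ _) (norm_nonneg _)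
    (norm_nonneg _)

theorem SecondMoments.intg_lin_smul (h : SecondMoments M π ψ ν a b) (θ : Vec d) :
    Intg ν fun s => lin ψ θ s • ψ s := by
  refine (intg_smul_of_sq (h := lin ψ θ) (b := ‖θ‖ ^ 2 * a) ?_ h.feature_self).1
  have := h.inner_sq 0 θ
  rwa [show ν.bind (stateLaw M π 0) = ν from PMF.bind_pure _] at this

theorem SecondMoments.expect_lin_smul (h : SecondMoments M π ψ ν a b) (θ : Vec d) :
    expect ν (fun s => lin ψ θ s • ψ s) = WithLp.toLp 2 ((gram ν ψ).mulVec θ.ofLp) := by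
  ext j
  have e := expect_clm (h.intg_lin_smul θ) (EuclideanSpace.proj (𝕜 := ℝ) j)
  have hs : ∀ t : Finset (Fin d), (Intg ν fun s => ∑ i ∈ t, ψ s j * ψ s i * θ i) ∧
      expect ν (fun s => ∑ i ∈ t, ψ s j * ψ s i * θ i)
        = ∑ i ∈ t, expect ν (fun s => ψ s j * ψ s i) * θ i := by
    classical
    intro t
    induction t using Finset.induction_on with
    | empty => simpa using ⟨Intg.const ν (0 : ℝ), expect_const ν (0 : ℝ)⟩
    | insert i t hi ih =>
      simp only [Finset.sum_insert hi]
      have i1 : Intg ν fun s => ψ s j * ψ s i * θ i := (h.intg_coord_mul j i).smul_const (θ i)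
      refine ⟨i1.add ih.1, ?_⟩
      rw [expect_add i1 ih.1, ih.2]
      congr 1
      exact expect_smul_const (h.intg_coord_mul j i) (θ i)
  have e2 : ∀ s, (EuclideanSpace.proj (𝕜 := ℝ) j) (lin ψ θ s • ψ s)
      = ∑ i, ψ s j * ψ s i * θ i := fun s => by
    simp only [lin, PiLp.inner_apply, PiLp.proj_apply, PiLp.smul_apply, smul_eq_mul,
      Finset.sum_mul]
    refine Finset.sum_congr rfl fun i _ => ?_
    simp
    ring
  simp only [e2] at e
  rw [(hs Finset.univ).2] at e
  simp only [PiLp.proj_apply] at e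
  rw [← e]
  simp [Matrix.mulVec, dotProduct, gram]

theorem sum_mu_eq_zero {f : S → ℝ} (hc : ChainAssumption M π μ rhat) (hf : ∀ s, 0 ≤ f s)
    (hi : Intg μ f) (h0 : expect μ f = 0) (s : S) : f s = 0 := by
  have hs : HasSum (fun s => (μ s).toReal • f s) 0 := by
    rw [← h0]
    exact hi.summable.hasSum
  have h1 := (hasSum_zero_iff_of_nonneg
    (fun s => mul_nonneg ENNReal.toReal_nonneg (hf s))).1 hs
  have h2 := congrFun h1 s
  simp only [Pi.zero_apply, mul_eq_zero] at h2
  exact h2.resolve_left (ENNReal.toReal_ne_zero.2 ⟨hc.apply_ne_zero s, μ.apply_ne_top s⟩)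

/-- The Gram quadratic form at x is the μ-mean of (Ψx)². If it vanishes then Ψx is zero everywhere,
since μ charges every state, and independence of the features gives x = 0. -/
theorem isUnit_gram (hc : ChainAssumption M π μ rhat) (hf : FeatureAssumption μ ψ ψhat) :
    IsUnit (gram μ ψ) := by
  have hμ := stationary_secondMoments hc hf
  rw [← Matrix.mulVec_injective_iff_isUnit]
  refine (injective_iff_map_eq_zero (gram μ ψ).mulVecLin).2 fun x hx => ?_
  have e := hμ.expect_lin_smul (WithLp.toLp 2 x)
  have hx' : (gram μ ψ).mulVec x = 0 := hx
  simp only [hx', WithLp.toLp_zero] at e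
  have e2 := expect_inner_left (hμ.intg_lin_smul (WithLp.toLp 2 x)) (WithLp.toLp 2 x)
  rw [e, inner_zero_right] at e2
  have e3 : ∀ s, inner ℝ (WithLp.toLp 2 x) (lin ψ (WithLp.toLp 2 x) s • ψ s)
      = lin ψ (WithLp.toLp 2 x) s ^ 2 := fun s => by
    rw [real_inner_smul_right, real_inner_comm, sq]; rfl
  have i2 := (hμ.intg_lin_smul (WithLp.toLp 2 x)).clm (innerSL ℝ (WithLp.toLp 2 x))
  simp only [innerSL_apply_apply, e3] at e2 i2
  have h0 := sum_mu_eq_zero hc (fun s => sq_nonneg _) i2 e2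
  have := hf.eq_zero_of_lin fun s => pow_eq_zero_iff two_ne_zero |>.1 (h0 s)
  simpa using congrArg WithLp.ofLp this

/-- The feature moments of B^(λ)(Ψθ) are the mean field plus the Gram matrix times θ. After
multiplication by the inverse Gram matrix, the fixed point equation leaves only the mean field. -/
theorem isTDSolution_iff [Finite A] (hc : ChainAssumption M π μ rhat)
    (hf : FeatureAssumption μ ψ ψhat) (h : StabilityAssumption M π μ ψ ρ f₁ f₂ f₃)
    (h0 : 0 ≤ lam) (h1 : lam < 1) (θ : Vec d) :
    IsTDSolution M π μ ψ lam θ ↔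
      θ ∈ (constSpace ψ)ᗮ ∧ meanField M π μ ψ lam 1 (rbar M π μ) θ = 0 := by
  have hμ := stationary_secondMoments hc hf
  unfold IsTDSolution
  refine and_congr_right fun _ => ?_
  have i1 := (hμ.expect_resolvent_smul h0 h1 1 (rbar M π μ) θ).1
  have i2 := hμ.intg_lin_smul θ
  have e : (fun j => expect μ fun s => ψ s j * bellmanLam M π μ lam (lin ψ θ) s)
      = (meanField M π μ ψ lam 1 (rbar M π μ) θ).ofLp + (gram μ ψ).mulVec θ.ofLp := by
    funext j
    have e1 := expect_clm (i1.add i2) (EuclideanSpace.proj (𝕜 := ℝ) j)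
    rw [expect_add i1 i2, hμ.expect_lin_smul] at e1
    simp only [PiLp.proj_apply, PiLp.add_apply] at e1
    rw [Pi.add_apply]
    refine Eq.trans ?_ e1
    congr 1
    funext s
    rw [bellmanLam_sub_lin h h0 h1]
    simp
    ring
  have hu := isUnit_gram hc hf
  have hdet := (Matrix.isUnit_iff_isUnit_det _).1 hu
  unfold featureProj
  rw [hf.lin_injective.eq_iff, e, Matrix.mulVec_add, Matrix.mulVec_mulVec,
    Matrix.nonsing_inv_mul _ hdet, Matrix.one_mulVec]
  constructor
  · intro hθ
    have h2 := congrArg WithLp.ofLp hθ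
    simp only [right_eq_add] at h2
    have h3 := congrArg (gram μ ψ).mulVec h2
    rw [Matrix.mulVec_mulVec, Matrix.mul_nonsing_inv _ hdet, Matrix.one_mulVec,
      Matrix.mulVec_zero] at h3
    ext j
    exact congrFun h3 j
  · intro hm
    rw [hm]
    ext j
    simp

end Fixpoint

end AvgTD

end

open scoped ENNReal

noncomputable section

namespace AvgTD

/-! ### Positivity of Δ, existence of θ*, and negative drift -/

section Drift

variable {S A : Type*} {d : ℕ} {M : MDP S A} {π : S → PMF A} {μ ν : PMF S} {ψ : S → Vec d}
  {ρ lam a b rhat ψhat : ℝ} {f₁ f₂ f₃ : S → ℝ}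

/-! ### Negative definiteness of the linear part of the mean field -/

theorem meanField_smul (c : ℝ) (θ : Vec d)
    (hI : Intg μ fun s => resolvent M π ψ lam 0 0 θ s • ψ s) :
    meanField M π μ ψ lam 0 0 (c • θ) = c • meanField M π μ ψ lam 0 0 θ := by
  unfold meanField
  rw [← expect_const_smul hI]
  congr 1
  funext s
  rw [smul_smul]
  congr 1
  unfold resolvent signal
  rw [← tsum_mul_left]
  refine tsum_congr fun l => ?_
  rw [inner_smul_right]
  ring

/-- The linear part of the mean field. -/
def meanFieldLin (h : StabilityAssumption M π μ ψ ρ f₁ f₂ f₃)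
    (hμ : SecondMoments M π ψ μ a b) (h0 : 0 ≤ lam) (h1 : lam < 1) : Vec d →ₗ[ℝ] Vec d where
  toFun θ := meanField M π μ ψ lam 0 0 θ
  map_add' θ θ' := by
    have := meanField_sub h hμ h0 h1 0 0 0 0 (θ + θ') θ'
    rw [add_sub_cancel_right, sub_self] at this
    rw [← this, sub_add_cancel]
  map_smul' c θ := meanField_smul c θ (hμ.expect_resolvent_smul h0 h1 0 0 θ).1

/-- `E_μ[V(S_0) V(S_m)]` for `V = Ψθ`. -/
def autoCov (M : MDP S A) (π : S → PMF A) (μ : PMF S) (ψ : S → Vec d) (θ : Vec d) (m : ℕ) : ℝ :=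
  inner ℝ θ (expect μ fun s => (inner ℝ (meanFeature M π ψ m s) θ : ℝ) • ψ s)

theorem inner_meanField (hμ : SecondMoments M π ψ μ a b) (h0 : 0 ≤ lam) (h1 : lam < 1)
    (c r : ℝ) (θ η : Vec d) :
    inner ℝ η (meanField M π μ ψ lam c r θ)
      = ∑' l, lam ^ l * inner ℝ η (expect μ fun s => signal M π ψ c r θ l s • ψ s) := by
  obtain ⟨-, hs, e⟩ := hμ.expect_resolvent_smul h0 h1 c r θ
  unfold meanField
  rw [e]
  have := (innerSL ℝ η).map_tsum hs.of_norm
  simp only [innerSL_apply_apply, inner_smul_right] at this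
  exact this

/-- By stationarity both marginals of the law of (S_0, S_m) are μ, so expanding the square leaves
only the lag-zero and lag-m moments. The cases c = 1 and c = -1 give the autocovariance bound; c =
-1 also gives its equality case. -/
theorem lagged_pair (hs : IsStationary M π μ) (hμ : SecondMoments M π ψ μ a b) (θ : Vec d)
    (m : ℕ) {f : S → ℝ} (hf : f = lin ψ θ) :
    ∀ c : ℝ, (Intg (μ.bind fun s => (stateLaw M π m s).map fun t => (s, t))
        fun q => (f q.1 + c * f q.2) ^ 2) ∧
      expect (μ.bind fun s => (stateLaw M π m s).map fun t => (s, t))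
          (fun q => (f q.1 + c * f q.2) ^ 2)
        = (1 + c ^ 2) * autoCov M π μ ψ θ 0 + 2 * c * autoCov M π μ ψ θ m := by
  subst hf
  intro c
  set J := μ.bind fun s => (stateLaw M π m s).map fun t => (s, t) with hJ
  have hm : ∀ n, ExpectLE (μ.bind (stateLaw M π n)) (fun s => lin ψ θ s ^ 2) (‖θ‖ ^ 2 * a) :=
    fun n => hμ.inner_sq n θ
  have hμ0 : ExpectLE μ (fun s => lin ψ θ s ^ 2) (‖θ‖ ^ 2 * a) := by
    have := hm 0
    rwa [hs.bind_stateLaw] at this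
  have hsq : Intg μ fun s => lin ψ θ s ^ 2 := hμ0.intg fun _ => sq_nonneg _
  have f1 : J.map Prod.fst = μ := by
    rw [hJ, PMF.map_bind]
    conv_rhs => rw [← PMF.bind_pure μ]
    congr 1
    funext s
    rw [PMF.map_comp]
    exact PMF.map_const _ s
  have f2 : J.map Prod.snd = μ := by
    rw [hJ, PMF.map_bind]
    conv_rhs => rw [← hs.bind_stateLaw m]
    congr 1
    funext s
    rw [PMF.map_comp]
    exact PMF.map_id _
  have i1 : Intg J fun q => lin ψ θ q.1 ^ 2 :=
    (intg_map (g := Prod.fst) (f := fun s => lin ψ θ s ^ 2)).1 (by rw [f1]; exact hsq)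
  have i2 : Intg J fun q => lin ψ θ q.2 ^ 2 :=
    (intg_map (g := Prod.snd) (f := fun s => lin ψ θ s ^ 2)).1 (by rw [f2]; exact hsq)
  have e1 : expect J (fun q => lin ψ θ q.1 ^ 2) = expect μ fun s => lin ψ θ s ^ 2 := by
    rw [← expect_map (g := Prod.fst) (f := fun s => lin ψ θ s ^ 2) i1, f1]
  have e2 : expect J (fun q => lin ψ θ q.2 ^ 2) = expect μ fun s => lin ψ θ s ^ 2 := by
    rw [← expect_map (g := Prod.snd) (f := fun s => lin ψ θ s ^ 2) i2, f2]
  obtain ⟨i3, e3⟩ := expect_lagged_smul (h := lin ψ θ) (hm m) (u := lin ψ θ)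
    (a := ‖θ‖ ^ 2 * a) (by simpa using hμ0)
  have hcov : ∀ n, autoCov M π μ ψ θ n
      = expect μ fun s => (inner ℝ (meanFeature M π ψ n s) θ : ℝ) * lin ψ θ s := fun n => by
    have hn : ExpectLE μ (fun s => (inner ℝ (meanFeature M π ψ n s) θ : ℝ) ^ 2)
        (‖θ‖ ^ 2 * a) := by
      refine ((hμ.meanFeature_sq n).const_mul (sq_nonneg ‖θ‖)).mono (fun _ => sq_nonneg _)
        fun s _ => ?_
      rw [← mul_pow, ← sq_abs, mul_comm]
      exact pow_le_pow_left₀ (abs_nonneg _) (abs_real_inner_le_norm _ _) 2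
    unfold autoCov
    rw [← expect_inner_left (intg_smul_of_sq hn hμ.feature_self).1]
    congr 1
    funext s
    rw [inner_smul_right, real_inner_comm (ψ s) θ]
    rfl
  have e0 : autoCov M π μ ψ θ 0 = expect μ fun s => lin ψ θ s ^ 2 := by
    rw [hcov]
    congr 1
    funext s
    rw [meanFeature_zero, sq]
    rfl
  have em : autoCov M π μ ψ θ m = expect J fun q => lin ψ θ q.2 * lin ψ θ q.1 := by
    rw [hcov]
    refine Eq.trans (expect_congr fun s hs' => ?_) e3.symm
    have hi : Intg (stateLaw M π m s) ψ := (hμ.feature m).intg_of_sq.of_bind hs'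
    rw [smul_eq_mul]
    congr 1
    have := expect_inner_left hi θ
    unfold lin
    simp only [real_inner_comm] at this ⊢
    exact this.symm
  have i3' : Intg J fun q => lin ψ θ q.2 * lin ψ θ q.1 := i3
  have e4 : (fun q : S × S => (lin ψ θ q.1 + c * lin ψ θ q.2) ^ 2)
      = fun q => lin ψ θ q.1 ^ 2 + c ^ 2 * lin ψ θ q.2 ^ 2
        + 2 * c * (lin ψ θ q.2 * lin ψ θ q.1) := by funext q; ring
  rw [e4]
  refine ⟨(i1.add (i2.const_mul _)).add (i3'.const_mul _), ?_⟩
  rw [expect_add (i1.add (i2.const_mul _)) (i3'.const_mul _), expect_add i1 (i2.const_mul _),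
    expect_const_mul i2, expect_const_mul i3', e1, e2, e0, em]
  ring

theorem abs_autoCov_le (hs : IsStationary M π μ) (hμ : SecondMoments M π ψ μ a b) (θ : Vec d)
    (m : ℕ) : |autoCov M π μ ψ θ m| ≤ autoCov M π μ ψ θ 0 := by
  have h1 := (lagged_pair hs hμ θ m rfl 1).2
  have h2 := (lagged_pair hs hμ θ m rfl (-1)).2
  have h3 := h1 ▸ expect_nonneg fun q _ => sq_nonneg _
  have h4 := h2 ▸ expect_nonneg fun q _ => sq_nonneg _
  rw [abs_le]
  constructor <;> linarith

/-- Equality in the autocovariance bound at lag one forces `Ψθ` to be constant. -/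
theorem lin_const_of_autoCov_eq (hc : ChainAssumption M π μ rhat)
    (hμ : SecondMoments M π ψ μ a b) (θ : Vec d)
    (he : autoCov M π μ ψ θ 1 = autoCov M π μ ψ θ 0) (s t : S) : lin ψ θ s = lin ψ θ t := by
  obtain ⟨hi, h1⟩ := lagged_pair hc.stationary hμ θ 1 rfl (-1)
  -- For c = -1 the mean squared increment is 2γ(0) - 2γ(1) = 0, so the increment vanishes at every
  -- pair of states of positive joint mass.
  have h0 : expect (μ.bind fun s => (stateLaw M π 1 s).map fun t => (s, t))
      (fun q => (lin ψ θ q.1 + (-1) * lin ψ θ q.2) ^ 2) = 0 := by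
    rw [h1, he]; ring
  have hs := hi.summable.hasSum
  rw [show ∑' q, _ = (0 : ℝ) from h0] at hs
  have h2 := (hasSum_zero_iff_of_nonneg
    (fun q => mul_nonneg ENNReal.toReal_nonneg (sq_nonneg _))).1 hs
  have hstep : ∀ s t, step M π s t ≠ 0 → lin ψ θ s = lin ψ θ t := fun s t hst => by
    have h3 := congrFun h2 (s, t)
    simp only [Pi.zero_apply, mul_eq_zero] at h3
    have h4 : (μ.bind fun s => (stateLaw M π 1 s).map fun t => (s, t)) (s, t) ≠ 0 := by
      rw [← PMF.mem_support_iff, PMF.mem_support_bind_iff]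
      refine ⟨s, hc.apply_ne_zero s, ?_⟩
      rw [PMF.mem_support_map_iff]
      exact ⟨t, by rw [stateLaw_one]; exact hst, rfl⟩
    have h5 := h3.resolve_left (ENNReal.toReal_ne_zero.2 ⟨h4, PMF.apply_ne_top _ _⟩)
    have h6 := pow_eq_zero_iff two_ne_zero |>.1 h5
    linarith
  have hk : ∀ k t, stateLaw M π k s t ≠ 0 → lin ψ θ s = lin ψ θ t := fun k => by
    induction k with
    | zero =>
      intro t ht
      rw [stateLaw_zero, ← PMF.mem_support_iff, PMF.mem_support_pure_iff] at ht
      rw [ht]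
    | succ k ih =>
      intro t ht
      rw [← PMF.mem_support_iff] at ht
      obtain ⟨u, hu, hut⟩ := (PMF.mem_support_bind_iff _ _ _).1 ht
      exact (ih u hu).trans (hstep u t hut)
  obtain ⟨k, hk'⟩ := hc.irreducible s t
  exact hk k t hk'

/-- A nonzero constant value could be rescaled to 1, which would put θ in E_Ψ as well as in its
orthogonal complement. -/
theorem constSpace_orthogonal_lin_const (hf : FeatureAssumption μ ψ ψhat) {θ : Vec d}
    (hθ : θ ∈ (constSpace ψ)ᗮ) {c : ℝ} (hcst : ∀ s, lin ψ θ s = c) : θ = 0 := by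
  by_cases h0 : c = 0
  · exact hf.eq_zero_of_lin fun s => by rw [hcst, h0]
  · have hmem : c⁻¹ • θ ∈ constSpace ψ := by
      refine Submodule.subset_span fun s => ?_
      have := hcst s
      unfold lin at this ⊢
      rw [inner_smul_right, this, inv_mul_cancel₀ h0]
    have h1 := (Submodule.mem_orthogonal _ _).1 hθ _ hmem
    rw [inner_smul_left, real_inner_self_eq_norm_sq] at h1
    simpa [h0] using h1

/-- By stationarity the l-th signal contributes γ(l+1) - γ(l). Summation by parts gives a weighted
sum of γ(m+1) - γ(0) ≤ 0, whose first term has weight 1 for every λ, including λ = 0, and is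
strictly negative. -/
theorem inner_meanField_neg (hc : ChainAssumption M π μ rhat) (hf : FeatureAssumption μ ψ ψhat)
    (h0 : 0 ≤ lam) (h1 : lam < 1)
    {θ : Vec d} (hθ : θ ∈ (constSpace ψ)ᗮ) (hne : θ ≠ 0) :
    inner ℝ θ (meanField M π μ ψ lam 0 0 θ) < 0 := by
  have hμ := stationary_secondMoments hc hf
  obtain ⟨s₀, -⟩ := μ.support_nonempty
  set g : ℕ → ℝ := fun m => autoCov M π μ ψ θ m - autoCov M π μ ψ θ 0 with hg
  have hle : ∀ m, autoCov M π μ ψ θ m ≤ autoCov M π μ ψ θ 0 := fun m =>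
    (le_abs_self _).trans (abs_autoCov_le hc.stationary hμ θ m)
  have hgB : ∀ m, |g m| ≤ 2 * autoCov M π μ ψ θ 0 := fun m => by
    have h2 := abs_autoCov_le hc.stationary hμ θ m
    have h3 := (abs_le.1 h2).1
    rw [abs_le]
    constructor <;> simp only [hg] <;> linarith [hle m, (abs_nonneg _).trans h2]
  have e : inner ℝ θ (meanField M π μ ψ lam 0 0 θ) = (1 - lam) * ∑' m, lam ^ m * g (m + 1) := by
    rw [inner_meanField hμ h0 h1]
    have e1 : ∀ l, (inner ℝ θ (expect μ fun s => signal M π ψ 0 0 θ l s • ψ s) : ℝ)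
        = g (l + 1) - g l := fun l => by
      rw [hμ.expect_signal_smul, zero_smul, zero_smul, sub_zero, zero_add, inner_sub_right]
      simp only [hg, autoCov]
      ring
    simp only [e1]
    rw [tsum_pow_mul_diff h0 h1 hgB]
    simp [hg]
  rw [e]
  refine mul_neg_of_pos_of_neg (by linarith) ?_
  have hs := summable_pow_mul_of_bounded (v := fun m => g (m + 1)) h0 h1 fun m => hgB _
  have hg1 : g 1 < 0 := by
    refine lt_of_le_of_ne (sub_nonpos.2 (hle 1)) fun h => hne ?_
    exact constSpace_orthogonal_lin_const hf hθ fun s =>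
      lin_const_of_autoCov_eq hc hμ θ (sub_eq_zero.1 h) s s₀
  have hpos : 0 < ∑' m, -(lam ^ m * g (m + 1)) := by
    refine hs.neg.tsum_pos (fun m => ?_) 0 ?_
    · have : g (m + 1) ≤ 0 := sub_nonpos.2 (hle _)
      nlinarith [pow_nonneg h0 m]
    · simpa using hg1
  rw [tsum_neg] at hpos
  linarith

/-! ### The drift coefficient -/

/-- The projection can be dropped: it is self-adjoint and fixes θ. -/
theorem driftValues_eq (hc : ChainAssumption M π μ rhat) (hf : FeatureAssumption μ ψ ψhat)
    (h : StabilityAssumption M π μ ψ ρ f₁ f₂ f₃) (h0 : 0 ≤ lam) (h1 : lam < 1) :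
    driftValues M π μ ψ lam = (fun θ => -inner ℝ θ (meanField M π μ ψ lam 0 0 θ)) ''
      {θ | θ ∈ (constSpace ψ)ᗮ ∧ ‖θ‖ = 1} := by
  have hμ := stationary_secondMoments hc hf
  refine Set.image_congr fun θ hθ => ?_
  have e : (expect μ fun s => (lin ψ θ s - transLam M π lam (lin ψ θ) s) • ψ s)
      = -meanField M π μ ψ lam 0 0 θ := by
    simp only [lin_sub_transLam h h0 h1, neg_smul]
    have := expect_const_smul (hμ.expect_resolvent_smul h0 h1 0 0 θ).1 (-1)
    simpa [meanField] using this
  rw [e, map_neg, inner_neg_right, ← Submodule.inner_starProjection_left_eq_right,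
    Submodule.starProjection_eq_self_iff.2 hθ.1]

theorem drift_isLeast (hc : ChainAssumption M π μ rhat) (hf : FeatureAssumption μ ψ ψhat)
    (h : StabilityAssumption M π μ ψ ρ f₁ f₂ f₃) (h0 : 0 ≤ lam) (h1 : lam < 1)
    (hne : (constSpace ψ)ᗮ ≠ ⊥) :
    IsLeast (driftValues M π μ ψ lam) (drift M π μ ψ lam) ∧ 0 < drift M π μ ψ lam := by
  have hμ := stationary_secondMoments hc hf
  have hcont : Continuous fun θ : Vec d => -inner ℝ θ (meanField M π μ ψ lam 0 0 θ) := by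
    have := (meanFieldLin h hμ h0 h1).continuous_of_finiteDimensional
    exact (continuous_id.inner this).neg
  have hcpt : IsCompact {θ | θ ∈ (constSpace ψ)ᗮ ∧ ‖θ‖ = 1} := by
    have e : {θ | θ ∈ (constSpace ψ)ᗮ ∧ ‖θ‖ = 1}
        = Metric.sphere (0 : Vec d) 1 ∩ ((constSpace ψ)ᗮ : Set (Vec d)) := by
      ext θ
      simp [and_comm]
    rw [e]
    exact (isCompact_sphere 0 1).inter_right (Submodule.isClosed_orthogonal _)
  have hnon : {θ | θ ∈ (constSpace ψ)ᗮ ∧ ‖θ‖ = 1}.Nonempty := by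
    obtain ⟨v, hv, hv0⟩ := Submodule.exists_mem_ne_zero_of_ne_bot hne
    refine ⟨‖v‖⁻¹ • v, Submodule.smul_mem _ _ hv, ?_⟩
    rw [norm_smul, norm_inv, norm_norm, inv_mul_cancel₀ (norm_ne_zero_iff.2 hv0)]
  have hleast : IsLeast (driftValues M π μ ψ lam) (drift M π μ ψ lam) := by
    have hd : drift M π μ ψ lam = sInf (driftValues M π μ ψ lam) := rfl
    rw [hd, driftValues_eq hc hf h h0 h1]
    exact (hcpt.image hcont).isLeast_sInf (hnon.image _)
  refine ⟨hleast, ?_⟩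
  have hm := hleast.1
  rw [driftValues_eq hc hf h h0 h1] at hm
  obtain ⟨θ, hθ, e⟩ := hm
  rw [← e]
  have := inner_meanField_neg (lam := lam) hc hf h0 h1 hθ.1 (by
    rintro rfl
    simpa using hθ.2)
  linarith

theorem inner_meanField_le_drift (hc : ChainAssumption M π μ rhat)
    (hf : FeatureAssumption μ ψ ψhat)
    (h : StabilityAssumption M π μ ψ ρ f₁ f₂ f₃) (h0 : 0 ≤ lam) (h1 : lam < 1)
    (hne : (constSpace ψ)ᗮ ≠ ⊥) {θ : Vec d} (hθ : θ ∈ (constSpace ψ)ᗮ) :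
    inner ℝ θ (meanField M π μ ψ lam 0 0 θ) ≤ -(drift M π μ ψ lam) * ‖θ‖ ^ 2 := by
  by_cases hz : θ = 0
  · simp [hz]
  have hn : ‖θ‖ ≠ 0 := norm_ne_zero_iff.2 hz
  have hmem : -inner ℝ (‖θ‖⁻¹ • θ) (meanField M π μ ψ lam 0 0 (‖θ‖⁻¹ • θ))
      ∈ driftValues M π μ ψ lam := by
    rw [driftValues_eq hc hf h h0 h1]
    refine ⟨‖θ‖⁻¹ • θ, ⟨Submodule.smul_mem _ _ hθ, ?_⟩, rfl⟩
    rw [norm_smul, norm_inv, norm_norm, inv_mul_cancel₀ hn]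
  have hle := (drift_isLeast hc hf h h0 h1 hne).1.2 hmem
  have hμ := stationary_secondMoments hc hf
  rw [meanField_smul _ _ (hμ.expect_resolvent_smul h0 h1 0 0 θ).1, inner_smul_left,
    inner_smul_right] at hle
  simp only [conj_trivial] at hle
  have h2 := mul_le_mul_of_nonneg_right hle (sq_nonneg ‖θ‖)
  have e : -(‖θ‖⁻¹ * (‖θ‖⁻¹ * inner ℝ θ (meanField M π μ ψ lam 0 0 θ))) * ‖θ‖ ^ 2
      = -inner ℝ θ (meanField M π μ ψ lam 0 0 θ) := by
    field_simp
  rw [e] at h2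
  linarith

/-! ### Solvability of the projected Bellman equation -/

theorem expect_mu_meanFeature (hs : IsStationary M π μ) (hμ : SecondMoments M π ψ μ a b) (m : ℕ) :
    expect μ (meanFeature M π ψ m) = expect μ ψ := by
  rw [← hμ.expect_meanFeature, hs.bind_stateLaw]

theorem expect_mu_meanReward [Finite A] (hs : IsStationary M π μ)
    (hμ : SecondMoments M π ψ μ a b) (m : ℕ) :
    expect μ (meanReward M π m) = rbar M π μ := by
  rw [rbar_eq, ← hμ.expect_meanReward, ← hμ.expect_meanReward]
  congr 1
  have e : ∀ m, μ.bind (stateActionLaw M π m) = μ.bind fun s => (π s).map fun a => (s, a) := by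
    intro m
    conv_rhs => rw [← hs.bind_stateLaw m, PMF.bind_bind]
    rfl
  rw [e, e]

/-- If Ψη = 1, pairing with η erases the feature and leaves the discounted stationary means of the
signal. These are c r̄ - r = 0, since feature increments have mean zero under μ. -/
theorem meanField_mem_orthogonal [Finite A] (hs : IsStationary M π μ)
    (hμ : SecondMoments M π ψ μ a b) (h0 : 0 ≤ lam) (h1 : lam < 1) {c r : ℝ}
    (hr : c * rbar M π μ = r) (θ : Vec d) :
    meanField M π μ ψ lam c r θ ∈ (constSpace ψ)ᗮ := by
  have key : ∀ η : Vec d, (∀ s, lin ψ η s = 1) →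
      inner ℝ η (meanField M π μ ψ lam c r θ) = 0 := fun η hη => by
    rw [inner_meanField hμ h0 h1]
    have e : ∀ l, (inner ℝ η (expect μ fun s => signal M π ψ c r θ l s • ψ s) : ℝ) = 0 :=
        fun l => by
      rw [← expect_inner_left (intg_smul_of_sq (hμ.signal_sq c r θ l) hμ.feature_self).1]
      have e1 : ∀ s, (inner ℝ η (signal M π ψ c r θ l s • ψ s) : ℝ) = signal M π ψ c r θ l s :=
          fun s => by
        have := hη s
        unfold lin at this
        rw [inner_smul_right, real_inner_comm, this, mul_one]
      simp only [e1]
      have i2 := (hμ.intg_meanFeature (l + 1)).sub (hμ.intg_meanFeature l)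
      have i3 : Intg μ fun t =>
          (inner ℝ (meanFeature M π ψ (l + 1) t - meanFeature M π ψ l t) θ : ℝ) := by
        simpa [real_inner_comm] using i2.clm (innerSL ℝ θ)
      have e3 : expect μ (fun t =>
          (inner ℝ (meanFeature M π ψ (l + 1) t - meanFeature M π ψ l t) θ : ℝ)) = 0 := by
        have := expect_inner_left i2 θ
        rw [expect_sub (hμ.intg_meanFeature _) (hμ.intg_meanFeature _),
          expect_mu_meanFeature hs hμ, expect_mu_meanFeature hs hμ, sub_self,
          inner_zero_right] at this
        simpa only [real_inner_comm] using this
      have i1 := (hμ.intg_meanReward l).const_mul c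
      unfold signal
      rw [expect_add (i1.sub (Intg.const _ r)) i3, expect_sub i1 (Intg.const _ r), expect_const,
        e3, expect_const_mul (hμ.intg_meanReward l), expect_mu_meanReward hs hμ, hr]
      ring
    simp [e]
  rw [Submodule.mem_orthogonal]
  intro u hu
  unfold constSpace at hu
  induction hu using Submodule.span_induction with
  | mem x hx => exact key x hx
  | zero => exact inner_zero_left _
  | add x y _ _ hx hy => rw [inner_add_left, hx, hy, add_zero]
  | smul t x _ hx => rw [inner_smul_left, hx, mul_zero]

theorem exists_unique_solution [Finite A] (hc : ChainAssumption M π μ rhat)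
    (hf : FeatureAssumption μ ψ ψhat)
    (h : StabilityAssumption M π μ ψ ρ f₁ f₂ f₃) (h0 : 0 ≤ lam) (h1 : lam < 1) :
    ∃ θstar, IsTDSolution M π μ ψ lam θstar ∧
      ∀ θ, IsTDSolution M π μ ψ lam θ → θ = θstar := by
  have hμ := stationary_secondMoments hc hf
  set P := (constSpace ψ)ᗮ
  set L := meanFieldLin h hμ h0 h1 with hL
  have hmap : ∀ θ ∈ P, L θ ∈ P := fun θ _ =>
    meanField_mem_orthogonal hc.stationary hμ h0 h1 (zero_mul _) θ
  set L' : P →ₗ[ℝ] P := L.restrict hmap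
  have hinj : Function.Injective L' := by
    refine (injective_iff_map_eq_zero L').2 fun x hx => ?_
    by_contra hne
    have h2 := inner_meanField_neg (lam := lam) hc hf h0 h1 x.2 (by simpa using hne)
    have h3 : meanField M π μ ψ lam 0 0 (x : Vec d) = 0 := congrArg Subtype.val hx
    rw [h3, inner_zero_right] at h2
    exact lt_irrefl _ h2
  -- The linear part preserves E_Ψ^⊥ and is injective there by strict negativity, so finite
  -- dimension makes it bijective. The constant part also lies in E_Ψ^⊥.
  have hsurj := LinearMap.injective_iff_surjective.1 hinj
  have hbmem : meanField M π μ ψ lam 1 (rbar M π μ) 0 ∈ P :=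
    meanField_mem_orthogonal hc.stationary hμ h0 h1 (one_mul _) 0
  have hdiff : ∀ θ, meanField M π μ ψ lam 1 (rbar M π μ) θ
      = L θ + meanField M π μ ψ lam 1 (rbar M π μ) 0 := fun θ => by
    have := meanField_sub h hμ h0 h1 1 (rbar M π μ) 1 (rbar M π μ) θ 0
    rw [sub_self, sub_self, sub_zero] at this
    rw [sub_eq_iff_eq_add] at this
    exact this
  obtain ⟨θ, hθ⟩ := hsurj (-⟨_, hbmem⟩)
  have hθ' : L θ = -meanField M π μ ψ lam 1 (rbar M π μ) 0 := congrArg Subtype.val hθ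
  refine ⟨θ, ?_, fun θ' hθ'' => ?_⟩
  · rw [isTDSolution_iff hc hf h h0 h1]
    exact ⟨θ.2, by rw [hdiff, hθ', neg_add_cancel]⟩
  · rw [isTDSolution_iff hc hf h h0 h1] at hθ''
    have h4 : L' ⟨θ', hθ''.1⟩ = L' θ := by
      rw [hθ]
      refine Subtype.ext ?_
      have := hθ''.2
      rw [hdiff] at this
      exact eq_neg_of_add_eq_zero_left this
    exact congrArg Subtype.val (hinj h4)

/-! ### Negative drift of the mean field of the algorithm -/

/-- Put w = dψ̂²/(1-λ)². If w ≤ Δ², then c ≥ Δ already gives w ≤ Δc. Otherwise (w/Δ - Δ)² = w²/Δ² -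
2w + Δ² is at most the radicand, so the threshold is at least w/Δ. -/
theorem cThreshold_bound {lam ψhat Δ c : ℝ} (hΔ : 0 < Δ) (h1 : lam < 1)
    (hc : cThreshold d lam ψhat Δ ≤ c) :
    Δ ≤ c ∧ d * ψhat ^ 2 / (1 - lam) ^ 2 ≤ Δ * c := by
  have hl : 0 < 1 - lam := by linarith
  set w := (d : ℝ) * ψhat ^ 2 / (1 - lam) ^ 2 with hw
  have hw0 : 0 ≤ w := by positivity
  have e : (d : ℝ) ^ 2 * ψhat ^ 4 / (Δ ^ 2 * (1 - lam) ^ 4) = w ^ 2 / Δ ^ 2 := by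
    rw [hw]; field_simp
  unfold cThreshold at hc
  rw [e] at hc
  have hs := Real.sqrt_nonneg (w ^ 2 / Δ ^ 2 - w)
  refine ⟨by linarith, ?_⟩
  by_cases hcase : w ≤ Δ ^ 2
  · nlinarith
  · have hsq : w / Δ - Δ ≤ √(w ^ 2 / Δ ^ 2 - w) := by
      refine Real.le_sqrt_of_sq_le ?_
      have e2 : (w / Δ - Δ) ^ 2 = w ^ 2 / Δ ^ 2 - 2 * w + Δ ^ 2 := by
        field_simp
        ring
      rw [e2]
      push Not at hcase
      linarith
    have h3 : w / Δ ≤ c := by linarith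
    rw [div_le_iff₀ hΔ] at h3
    linarith

theorem mean_drift_le [Finite A] (hc : ChainAssumption M π μ rhat)
    (hf : FeatureAssumption μ ψ ψhat)
    (h : StabilityAssumption M π μ ψ ρ f₁ f₂ f₃) (h0 : 0 ≤ lam) (h1 : lam < 1)
    (hne : (constSpace ψ)ᗮ ≠ ⊥) {cα : ℝ}
    (hcα : cThreshold d lam ψhat (drift M π μ ψ lam) ≤ cα)
    {θstar θ : Vec d} (hstar : IsTDSolution M π μ ψ lam θstar) (hθ : θ ∈ (constSpace ψ)ᗮ)
    (r : ℝ) :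
    (r - rbar M π μ) * (cα * (rbar M π μ - r))
      + inner ℝ (θ - θstar) (meanField M π μ ψ lam 1 r θ)
      ≤ -(drift M π μ ψ lam / 2) * ((r - rbar M π μ) ^ 2 + ‖θ - θstar‖ ^ 2) := by
  have hμ := stationary_secondMoments hc hf
  obtain ⟨hs1, hs2⟩ := (isTDSolution_iff hc hf h h0 h1 θstar).1 hstar
  set Δ := drift M π μ ψ lam
  have hΔ : 0 < Δ := (drift_isLeast hc hf h h0 h1 hne).2
  set u := r - rbar M π μ with hu
  set v := θ - θstar with hv
  -- Subtracting the vanishing mean field at (r̄, θ*) leaves the linear part at v and the effect of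
  -- the constant signal -u, whose discounted sum is -u/(1-λ).
  have e1 : meanField M π μ ψ lam 1 r θ = meanField M π μ ψ lam 0 0 v
      - (u / (1 - lam)) • expect μ ψ := by
    have e2 := meanField_sub h hμ h0 h1 1 r 1 (rbar M π μ) θ θstar
    rw [hs2, sub_zero, sub_self, ← hu, ← hv] at e2
    have e4 := meanField_sub h hμ h0 h1 0 u 0 0 v v
    rw [sub_self, sub_self, sub_zero] at e4
    have e5 : meanField M π μ ψ lam 0 u (0 : Vec d) = -((u / (1 - lam)) • expect μ ψ) := by
      have er : ∀ s, resolvent M π ψ lam 0 u (0 : Vec d) s = -(u / (1 - lam)) := fun s => by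
        unfold resolvent signal
        simp only [inner_zero_right, zero_mul, zero_sub, add_zero]
        rw [tsum_mul_right, tsum_geometric_of_lt_one h0 h1]
        field_simp
      unfold meanField
      simp only [er]
      rw [expect_const_smul hμ.intg_feature, neg_smul]
    rw [e2, sub_eq_add_neg, ← e5, ← e4]
    abel
  have hvP : v ∈ (constSpace ψ)ᗮ := Submodule.sub_mem _ hθ hs1
  have h2 := inner_meanField_le_drift hc hf h h0 h1 hne hvP
  obtain ⟨hc1, hc2⟩ := cThreshold_bound hΔ h1 hcα
  have hm : ‖expect μ ψ‖ ^ 2 ≤ d * ψhat ^ 2 := sq_norm_expect_le hf.feature_sq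
  have hl : 0 < 1 - lam := by linarith
  set z := ‖expect μ ψ‖ / (1 - lam) with hz
  have hz2 : z ^ 2 ≤ Δ * cα := by
    refine le_trans ?_ hc2
    rw [hz, div_pow]
    exact div_le_div_of_nonneg_right hm (by positivity)
  have h3 : -(u / (1 - lam)) * inner ℝ v (expect μ ψ) ≤ |u| * ‖v‖ * z := by
    refine (le_abs_self _).trans ?_
    rw [abs_mul, abs_neg, abs_div, abs_of_pos hl]
    have := abs_real_inner_le_norm v (expect μ ψ)
    have h4 : |u| / (1 - lam) * |(inner ℝ v (expect μ ψ) : ℝ)|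
        ≤ |u| / (1 - lam) * (‖v‖ * ‖expect μ ψ‖) :=
      mul_le_mul_of_nonneg_left this (by positivity)
    refine h4.trans_eq ?_
    rw [hz]; ring
  rw [e1, inner_sub_right, inner_smul_right]
  have e6 : u * (cα * (rbar M π μ - r)) = -cα * u ^ 2 := by rw [hu]; ring
  rw [e6]
  have hsq : u ^ 2 = |u| ^ 2 := (sq_abs u).symm
  -- Young's inequality, with z² ≤ Δ c_α supplied by the threshold, gives half of each negative
  -- square to the coupling term. The remaining halves are at least Δ/2 each because c_α ≥ Δ.
  have h5 : |u| * ‖v‖ * z ≤ cα / 2 * |u| ^ 2 + Δ / 2 * ‖v‖ ^ 2 := by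
    have h6 : 2 * Δ * (|u| * ‖v‖ * z) ≤ (|u| * z) ^ 2 + (Δ * ‖v‖) ^ 2 := by
      nlinarith [sq_nonneg (|u| * z - Δ * ‖v‖)]
    have h7 : (|u| * z) ^ 2 ≤ |u| ^ 2 * (Δ * cα) := by
      rw [mul_pow]
      exact mul_le_mul_of_nonneg_left hz2 (sq_nonneg _)
    have h8 : 2 * Δ * (|u| * ‖v‖ * z) ≤ 2 * Δ * (cα / 2 * |u| ^ 2 + Δ / 2 * ‖v‖ ^ 2) := by
      linarith
    exact le_of_mul_le_mul_left h8 (by positivity)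
  have h9 : Δ * |u| ^ 2 ≤ cα * |u| ^ 2 := mul_le_mul_of_nonneg_right hc1 (sq_nonneg _)
  rw [hsq]
  linarith

end Drift

end AvgTD

end

open scoped ENNReal

noncomputable section

namespace AvgTD

/-! ### The history as a Markov chain on a countable set -/

section Paths

open MeasureTheory

variable {S A Ω : Type*} {d : ℕ} {M : MDP S A} {π : S → PMF A} {ψ : S → Vec d}

/-! ### Trace and iterates as functions of the history -/

/-- The trace `z_{k-1}` as a function of the list of the past state-action pairs, last one first. -/
def histTrace (lam : ℝ) (ψ : S → Vec d) : List (S × A) → Vec d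
  | [] => 0
  | q :: l => lam • histTrace lam ψ l + ψ q.1

/-- The iterate `x_k` as a function of the past state-action pairs and of the current state. -/
def histIter (M : MDP S A) (ψ : S → Vec d) (lam cα radius : ℝ) (α : ℕ → ℝ) (x₀ : Iter d) :
    List (S × A) → S → Iter d
  | [], _ => x₀
  | q :: l, s => tdStep (constSpace ψ) cα radius (α l.length) (M.reward q.1 q.2) (ψ q.1) (ψ s)
      (lam • histTrace lam ψ l + ψ q.1) (histIter M ψ lam cα radius α x₀ l q.1)

/-- The list of the first `k` state-action pairs, last one first. -/
def hist (s : ℕ → S) (a : ℕ → A) : ℕ → List (S × A)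
  | 0 => []
  | k + 1 => (s k, a k) :: hist s a k

theorem hist_length (s : ℕ → S) (a : ℕ → A) (k : ℕ) : (hist s a k).length = k := by
  induction k with
  | zero => rfl
  | succ k ih => rw [hist, List.length_cons, ih]

theorem hist_eq_iff (s s' : ℕ → S) (a a' : ℕ → A) (k : ℕ) :
    hist s a k = hist s' a' k ↔ ∀ i < k, s i = s' i ∧ a i = a' i := by
  induction k with
  | zero => simp [hist]
  | succ k ih =>
    rw [hist, hist, List.cons.injEq, ih, Prod.mk.injEq]
    constructor
    · rintro ⟨h1, h2⟩ i hi
      rcases Nat.lt_succ_iff_lt_or_eq.1 hi with h | rfl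
      · exact h2 i h
      · exact h1
    · intro h
      exact ⟨h k (Nat.lt_succ_self k), fun i hi => h i (hi.trans (Nat.lt_succ_self k))⟩

theorem trace_eq_histTrace (lam : ℝ) (s : ℕ → S) (a : ℕ → A) (k : ℕ) :
    trace lam ψ s k = lam • histTrace lam ψ (hist s a k) + ψ (s k) := by
  induction k with
  | zero => simp [trace, hist, histTrace]
  | succ k ih => rw [trace, ih, hist, histTrace]

theorem iterates_eq_histIter (lam cα radius : ℝ) (α : ℕ → ℝ) (x₀ : Iter d) (s : ℕ → S)
    (a : ℕ → A) (k : ℕ) :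
    iterates M ψ lam cα radius α x₀ s a k
      = histIter M ψ lam cα radius α x₀ (hist s a k) (s k) := by
  induction k with
  | zero => rfl
  | succ k ih =>
    rw [iterates, ih, hist, histIter, trace_eq_histTrace lam s a k, hist_length]

/-! ### The law of the history -/

/-- Joint law of the action in state `s` and of the next state. -/
def stepAction (M : MDP S A) (π : S → PMF A) (s : S) : PMF (A × S) :=
  (π s).bind fun a => (M.trans s a).map fun t => (a, t)

/-- The history after one more action and transition. -/
def extendHist (p : List (S × A) × S) (q : A × S) : List (S × A) × S := ((p.2, q.1) :: p.1, q.2)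

/-- One step of the chain of histories. -/
def histStep (M : MDP S A) (π : S → PMF A) (p : List (S × A) × S) : PMF (List (S × A) × S) :=
  (stepAction M π p.2).map (extendHist p)

theorem histStep_cons (l : List (S × A)) (s t : S) (a : A) :
    histStep M π (l, s) ((s, a) :: l, t) = π s a * M.trans s a t := by
  classical
  unfold histStep
  rw [PMF.map_apply, tsum_eq_single (a, t)]
  · rw [if_pos (show ((s, a) :: l, t) = extendHist (l, s) (a, t) from rfl)]
    exact bind_map_mk_apply (π s) (M.trans s) (a, t)
  · rintro ⟨a', t'⟩ h
    rw [if_neg]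
    intro e
    simp only [extendHist, Prod.mk.injEq, List.cons.injEq] at e
    exact h (by rw [e.1.1.2, e.2])

/-- A history records its whole past, so it has exactly one predecessor and the sum over
predecessors collapses. -/
theorem bind_histStep_cons (H : PMF (List (S × A) × S)) (l : List (S × A)) (s t : S) (a : A) :
    (H.bind (histStep M π)) ((s, a) :: l, t) = H (l, s) * (π s a * M.trans s a t) := by
  rw [PMF.bind_apply, tsum_eq_single (l, s), histStep_cons]
  rintro ⟨l', s'⟩ h
  rw [mul_eq_zero]
  right
  rw [PMF.apply_eq_zero_iff]
  intro e
  obtain ⟨q, -, e⟩ := (PMF.mem_support_map_iff _ _ _).1 e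
  simp only [extendHist, Prod.mk.injEq, List.cons.injEq] at e
  exact h (by rw [e.1.1.1, e.1.2])

theorem bind_histStep_nil (H : PMF (List (S × A) × S)) (t : S) :
    (H.bind (histStep M π)) ([], t) = 0 := by
  rw [PMF.apply_eq_zero_iff]
  intro h
  obtain ⟨p, -, h⟩ := (PMF.mem_support_bind_iff _ _ _).1 h
  obtain ⟨q, -, e⟩ := (PMF.mem_support_map_iff _ _ _).1 h
  simp [extendHist] at e

variable [MeasurableSpace Ω] {ℙ : Measure Ω} {X : ℕ → Ω → S} {U : ℕ → Ω → A}

theorem IsTrajectory.measurableSet_hist (h : IsTrajectory M π ℙ X U) (k : ℕ)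
    (l : List (S × A)) : MeasurableSet {ω | hist (fun i => X i ω) (fun i => U i ω) k = l} := by
  induction k generalizing l with
  | zero => simp [hist]
  | succ k ih =>
    cases l with
    | nil => simp [hist]
    | cons q l =>
      have e : {ω | hist (fun i => X i ω) (fun i => U i ω) (k + 1) = q :: l}
          = ({ω | X k ω = q.1} ∩ {ω | U k ω = q.2})
            ∩ {ω | hist (fun i => X i ω) (fun i => U i ω) k = l} := by
        ext ω
        simp [hist, Prod.ext_iff]
      rw [e]
      exact ((h.measurableSet_state k _).inter (h.measurableSet_action k _)).inter (ih l)

/-- The Markov property, on atoms of the history. -/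
theorem IsTrajectory.atom_succ (h : IsTrajectory M π ℙ X U) (s₀ s₁ : S) {k : ℕ} (hk : 1 ≤ k)
    (l : List (S × A)) (s t : S) (a : A) :
    ℙ ({ω | X 0 ω = s₀ ∧ X 1 ω = s₁} ∩
        {ω | hist (fun i => X i ω) (fun i => U i ω) (k + 1) = (s, a) :: l ∧ X (k + 1) ω = t})
      = ℙ ({ω | X 0 ω = s₀ ∧ X 1 ω = s₁} ∩
        {ω | hist (fun i => X i ω) (fun i => U i ω) k = l ∧ X k ω = s})
        * (π s a * M.trans s a t) := by
  rcases Set.eq_empty_or_nonempty ({ω | X 0 ω = s₀ ∧ X 1 ω = s₁} ∩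
        {ω | hist (fun i => X i ω) (fun i => U i ω) k = l ∧ X k ω = s}) with he | ⟨ω₀, hω, hl, hs⟩
  · rw [he, measure_empty, zero_mul]
    refine measure_mono_null ?_ (measure_empty (μ := ℙ))
    rw [← he]
    rintro ω ⟨h1, h2, h3⟩
    simp only [hist, List.cons.injEq, Prod.mk.injEq] at h2
    exact ⟨h1, h2.2, h2.1.1⟩
  -- The cylinder formula needs full sequences: they follow a sample point ω₀ of the atom up to time
  -- k and are then continued by `a` and `t`. Since k ≥ 1, this prefix fixes the first two states,
  -- so the conditioning event holds on the whole cylinder.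
  · set s' : ℕ → S := fun i => if i ≤ k then X i ω₀ else t with hs'
    set a' : ℕ → A := fun i => if i < k then U i ω₀ else a with ha'
    have hcond : ∀ ω, (∀ i < k, X i ω = X i ω₀ ∧ U i ω = U i ω₀) → X k ω = X k ω₀ →
        X 0 ω = s₀ ∧ X 1 ω = s₁ := fun ω h1 h2 => by
      have h3 : ∀ i ≤ k, X i ω = X i ω₀ := fun i hi => by
        rcases hi.lt_or_eq with hlt | rfl
        · exact (h1 i hlt).1
        · exact h2
      rw [h3 0 (Nat.zero_le _), h3 1 hk]
      exact hω
    have e1 : ({ω | X 0 ω = s₀ ∧ X 1 ω = s₁} ∩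
        {ω | hist (fun i => X i ω) (fun i => U i ω) k = l ∧ X k ω = s})
        = {ω | (∀ i < k, X i ω = X i ω₀ ∧ U i ω = U i ω₀) ∧ X k ω = X k ω₀} := by
      ext ω
      simp only [Set.mem_inter_iff, Set.mem_ofPred_eq, ← hl, ← hs, hist_eq_iff]
      exact ⟨fun h => h.2, fun h => ⟨hcond ω h.1 h.2, h⟩⟩
    have e2 : ({ω | X 0 ω = s₀ ∧ X 1 ω = s₁} ∩
        {ω | hist (fun i => X i ω) (fun i => U i ω) (k + 1) = (s, a) :: l ∧ X (k + 1) ω = t})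
        = {ω | (∀ i < k + 1, X i ω = s' i ∧ U i ω = a' i) ∧ X (k + 1) ω = s' (k + 1)} := by
      ext ω
      have h1 : (∀ i < k + 1, X i ω = s' i ∧ U i ω = a' i) ↔
          (X k ω = X k ω₀ ∧ U k ω = a) ∧ ∀ i < k, X i ω = X i ω₀ ∧ U i ω = U i ω₀ := by
        rw [Nat.forall_lt_succ_right, and_comm]
        refine and_congr (by simp [hs', ha']) (forall₂_congr fun i hi => ?_)
        simp [hs', ha', hi, hi.le]
      have h2 : s' (k + 1) = t := by simp [hs']
      simp only [Set.mem_inter_iff, Set.mem_ofPred_eq, h1, h2, hist, List.cons.injEq,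
        Prod.mk.injEq, ← hl, ← hs, hist_eq_iff]
      constructor
      · rintro ⟨-, h⟩
        exact h
      · rintro ⟨⟨h3, h4⟩, h5⟩
        exact ⟨hcond ω h4 h3.1, ⟨h3, h4⟩, h5⟩
    rw [e1, e2, h.cylinder, h.cylinder, Finset.prod_range_succ, ← mul_assoc]
    have h3 : s' 0 = X 0 ω₀ := by simp [hs']
    have h4 : ∏ i ∈ Finset.range k, (π (s' i) (a' i) * M.trans (s' i) (a' i) (s' (i + 1)))
        = ∏ i ∈ Finset.range k,
          (π (X i ω₀) (U i ω₀) * M.trans (X i ω₀) (U i ω₀) (X (i + 1) ω₀)) := by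
      refine Finset.prod_congr rfl fun i hi => ?_
      have hi' := Finset.mem_range.1 hi
      simp [hs', ha', hi', hi'.le, Nat.succ_le_of_lt hi']
    have h5 : π (s' k) (a' k) * M.trans (s' k) (a' k) (s' (k + 1)) = π s a * M.trans s a t := by
      simp [hs', ha', hs]
    rw [h3, h4, h5]

/-- Along a trajectory conditioned on its first two states, the history is a Markov chain, whose
laws compute the conditional expectations. -/
theorem IsTrajectory.exists_histLaw [Countable S] [Finite A] (h : IsTrajectory M π ℙ X U)
    [IsProbabilityMeasure ℙ] (s₀ s₁ : S) (hev : ℙ {ω | X 0 ω = s₀ ∧ X 1 ω = s₁} ≠ 0) :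
    ∃ H : ℕ → PMF (List (S × A) × S),
      (∀ p, H 1 p ≠ 0 → p.2 = s₁ ∧ ∃ a, p.1 = [(s₀, a)]) ∧
      (∀ k, 1 ≤ k → H (k + 1) = (H k).bind (histStep M π)) ∧
      ∀ k (g : List (S × A) × S → ℝ), (∀ p, 0 ≤ g p) → ∀ c, ExpectLE (H k) g c →
        MeanLE (ProbabilityTheory.cond ℙ {ω | X 0 ω = s₀ ∧ X 1 ω = s₁})
          (fun ω => g (hist (fun i => X i ω) (fun i => U i ω) k, X k ω)) c := by
  set ev := {ω | X 0 ω = s₀ ∧ X 1 ω = s₁} with hevd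
  have hevm : MeasurableSet ev :=
    (h.measurableSet_state 0 s₀).inter (h.measurableSet_state 1 s₁)
  set E := ProbabilityTheory.cond ℙ ev with hE
  have hprob : IsProbabilityMeasure E := ProbabilityTheory.cond_isProbabilityMeasure hev
  -- Histories form a countable set, so with the discrete σ-algebra every function is measurable and
  -- every law is a `PMF`.
  let _ : MeasurableSpace (List (S × A) × S) := ⊤
  have hcount : Countable (List (S × A) × S) := inferInstance
  have hsing : MeasurableSingletonClass (List (S × A) × S) := ⟨fun _ => trivial⟩
  set Z : ℕ → Ω → List (S × A) × S :=
    fun k ω => (hist (fun i => X i ω) (fun i => U i ω) k, X k ω) with hZ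
  have hpre : ∀ k p, Z k ⁻¹' {p}
      = {ω | hist (fun i => X i ω) (fun i => U i ω) k = p.1 ∧ X k ω = p.2} := fun k p => by
    ext ω
    simp [hZ, Prod.ext_iff]
  have hZm : ∀ k, Measurable (Z k) := fun k => by
    refine measurable_to_countable' fun p => ?_
    rw [hpre]
    exact (h.measurableSet_hist k p.1).inter (h.measurableSet_state k p.2)
  have hmp : ∀ k, IsProbabilityMeasure (E.map (Z k)) := fun k =>
    Measure.isProbabilityMeasure_map (hZm k).aemeasurable
  have happ : ∀ k p, (E.map (Z k)).toPMF p
      = (ℙ ev)⁻¹ * ℙ (ev ∩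
        {ω | hist (fun i => X i ω) (fun i => U i ω) k = p.1 ∧ X k ω = p.2}) := fun k p => by
    rw [Measure.toPMF_apply, Measure.map_apply (hZm k) (measurableSet_singleton p), hpre, hE,
      ProbabilityTheory.cond_apply hevm]
  refine ⟨fun k => (E.map (Z k)).toPMF, ?_, ?_, ?_⟩
  · intro p hp
    rw [happ] at hp
    obtain ⟨ω, hω, h1, h2⟩ := nonempty_of_measure_ne_zero (right_ne_zero_of_mul hp)
    refine ⟨h2 ▸ hω.2, U 0 ω, ?_⟩
    rw [← h1, ← hω.1]
    rfl
  · intro k hk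
    ext p
    rcases p with ⟨l, t⟩
    cases l with
    | nil =>
      rw [bind_histStep_nil, happ]
      simp [hist]
    | cons q l =>
      rcases q with ⟨s, a⟩
      rw [bind_histStep_cons, happ, happ, h.atom_succ s₀ s₁ hk, mul_assoc]
  · intro k g hg c hc
    have hgm : Measurable g := fun _ _ => trivial
    have hi : Intg (E.map (Z k)).toPMF g := hc.intg hg
    have hi' : Integrable g (E.map (Z k)) := by
      refine ⟨hgm.aestronglyMeasurable, ?_⟩
      rw [hasFiniteIntegral_iff_enorm, lintegral_countable', lt_top_iff_ne_top]
      have e : ∀ p, ‖g p‖ₑ * (E.map (Z k)) {p} = (E.map (Z k)).toPMF p * ‖g p‖ₑ := fun p => by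
        rw [mul_comm, Measure.toPMF_apply]
      simpa only [e] using intg_iff_tsum_ne_top.1 hi
    refine ⟨(integrable_map_measure hgm.aestronglyMeasurable (hZm k).aemeasurable).1 hi', ?_⟩
    rw [← integral_map (f := g) (hZm k).aemeasurable hgm.aestronglyMeasurable,
      integral_countable hi']
    exact hc.2

end Paths

end AvgTD

end

open scoped ENNReal

noncomputable section

namespace AvgTD

/-! ### One step of the algorithm and the Poisson equation for its update -/

section OneStep

variable {S A : Type*} {d : ℕ} {M : MDP S A} {π : S → PMF A} {μ ν : PMF S} {ψ : S → Vec d}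
  {ρ lam a b rhat ψhat : ℝ} {f₁ f₂ f₃ : S → ℝ}

/-! ### Geometry of the projection -/

/-- Outside the ball, with t = R/‖x‖, the difference of the two squared distances is (1-t)(‖x‖² +
R‖x‖ - 2⟨x, c⟩), which is nonnegative because ⟨x, c⟩ ≤ R‖x‖. -/
theorem norm_ballProj_sub_le {E : Type*} [NormedAddCommGroup E] [InnerProductSpace ℝ E] {R : ℝ}
    (x : E) {c : E} (hc : ‖c‖ ≤ R) : ‖ballProj R x - c‖ ≤ ‖x - c‖ := by
  unfold ballProj
  split_ifs with hx
  · exact le_rfl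
  · push Not at hx
    have hR : 0 ≤ R := (norm_nonneg c).trans hc
    have hx0 : 0 < ‖x‖ := hR.trans_lt hx
    set t := R / ‖x‖ with ht
    have htx : t * ‖x‖ = R := by rw [ht]; field_simp
    have ht1 : t ≤ 1 := (div_le_one hx0).2 hx.le
    refine (sq_le_sq₀ (norm_nonneg _) (norm_nonneg _)).1 ?_
    rw [norm_sub_sq_real, norm_sub_sq_real, norm_smul, real_inner_smul_left, Real.norm_eq_abs,
      abs_of_nonneg (by positivity), htx]
    have hin : inner ℝ x c ≤ ‖x‖ * R :=
      (real_inner_le_norm x c).trans (mul_le_mul_of_nonneg_left hc hx0.le)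
    nlinarith [mul_le_mul_of_nonneg_left hin (sub_nonneg.2 ht1)]

theorem norm_ballProj_le {E : Type*} [NormedAddCommGroup E] [NormedSpace ℝ E] {R : ℝ} (hR : 0 ≤ R)
    (x : E) : ‖ballProj R x‖ ≤ R := by
  unfold ballProj
  split_ifs with hx
  · exact hx
  · push Not at hx
    have hx0 : 0 < ‖x‖ := hR.trans_lt hx
    rw [norm_smul, norm_div, norm_norm, Real.norm_of_nonneg hR, div_mul_cancel₀ _ hx0.ne']

theorem iter_norm_sq (x : Iter d) : ‖x‖ ^ 2 = x.fst ^ 2 + ‖x.snd‖ ^ 2 := by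
  rw [WithLp.prod_norm_sq_eq_of_L2, Real.norm_eq_abs, sq_abs]

theorem sqErr_eq (r : ℝ) (θ : Vec d) (x : Iter d) : sqErr r θ x = ‖x - pt r θ‖ ^ 2 := by
  rw [iter_norm_sq]
  rfl

theorem abs_fst_le (x : Iter d) : |x.fst| ≤ ‖x‖ := by
  refine abs_le_of_sq_le_sq ?_ (norm_nonneg _)
  rw [iter_norm_sq]
  exact le_add_of_nonneg_right (sq_nonneg _)

theorem norm_snd_le (x : Iter d) : ‖x.snd‖ ≤ ‖x‖ := by
  refine (sq_le_sq₀ (norm_nonneg _) (norm_nonneg _)).1 ?_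
  rw [iter_norm_sq]
  exact le_add_of_nonneg_left (sq_nonneg _)

/-- The temporal difference error. -/
def tdErr (R : ℝ) (v v' : Vec d) (x : Iter d) : ℝ :=
  R - x.fst + inner ℝ v' x.snd - inner ℝ v x.snd

/-- Square of the bound on the length of an update. -/
def updSq (cα R : ℝ) (v v' z : Vec d) (x : Iter d) : ℝ :=
  cα ^ 2 * (R - x.fst) ^ 2 + tdErr R v v' x ^ 2 * ‖z‖ ^ 2

theorem updSq_nonneg (cα R : ℝ) (v v' z : Vec d) (x : Iter d) : 0 ≤ updSq cα R v v' z x := by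
  unfold updSq; positivity

variable {E : Submodule ℝ (Vec d)} {cα radius α : ℝ}

theorem norm_starProjection_sq_le (z : Vec d) : ‖Eᗮ.starProjection z‖ ^ 2 ≤ ‖z‖ ^ 2 :=
  pow_le_pow_left₀ (norm_nonneg _) (Submodule.norm_starProjection_apply_le _ z) 2

/-- The ball projection does not increase the distance to the target. In the linear term the
projection of the trace is invisible, since the error already lies in E_Ψ^⊥; in the quadratic term
it only shortens the trace. -/
theorem sqErr_tdStep_le (R : ℝ) (v v' z : Vec d) (x : Iter d) {r : ℝ} {θ : Vec d}
    (hpt : ‖pt r θ‖ ≤ radius) (hθ : x.snd - θ ∈ Eᗮ) :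
    sqErr r θ (tdStep E cα radius α R v v' z x)
      ≤ sqErr r θ x + 2 * α * ((x.fst - r) * (cα * (R - x.fst))
          + tdErr R v v' x * inner ℝ (x.snd - θ) z) + α ^ 2 * updSq cα R v v' z x := by
  have h1 : sqErr r θ (tdStep E cα radius α R v v' z x) ≤ sqErr r θ (WithLp.toLp 2
    (x.fst + cα * α * (R - x.fst), x.snd + (α * tdErr R v v' x) • Eᗮ.starProjection z)) := by
    rw [sqErr_eq, sqErr_eq]
    exact pow_le_pow_left₀ (norm_nonneg _) (norm_ballProj_sub_le _ hpt) 2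
  refine h1.trans ?_
  unfold sqErr
  have e : (x.snd + (α * tdErr R v v' x) • Eᗮ.starProjection z) - θ
      = (x.snd - θ) + (α * tdErr R v v' x) • Eᗮ.starProjection z := by abel
  have e2 : inner ℝ (x.snd - θ) (Eᗮ.starProjection z) = inner ℝ (x.snd - θ) z := by
    rw [← Submodule.inner_starProjection_left_eq_right,
      Submodule.starProjection_eq_self_iff.2 hθ]
  simp only [WithLp.toLp_fst, WithLp.toLp_snd]
  rw [e, norm_add_sq_real, real_inner_smul_right, e2, norm_smul, mul_pow, Real.norm_eq_abs, sq_abs]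
  have h2 := mul_le_mul_of_nonneg_left (norm_starProjection_sq_le (E := E) z)
    (sq_nonneg (α * tdErr R v v' x))
  unfold updSq
  nlinarith

theorem norm_tdStep_sub_le (R : ℝ) (v v' z : Vec d) (x : Iter d) (hα : 0 ≤ α)
    (hx : ‖x‖ ≤ radius) :
    ‖tdStep E cα radius α R v v' z x - x‖ ≤ α * √(updSq cα R v v' z x) := by
  refine (norm_ballProj_sub_le _ hx).trans ?_
  refine (sq_le_sq₀ (norm_nonneg _) (by positivity)).1 ?_
  rw [mul_pow, Real.sq_sqrt (updSq_nonneg _ _ _ _ _ _), iter_norm_sq]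
  have e1 : ((WithLp.toLp 2 (x.fst + cα * α * (R - x.fst),
      x.snd + (α * tdErr R v v' x) • Eᗮ.starProjection z) : Iter d) - x).fst
      = cα * α * (R - x.fst) := by simp
  have e2 : ((WithLp.toLp 2 (x.fst + cα * α * (R - x.fst),
      x.snd + (α * tdErr R v v' x) • Eᗮ.starProjection z) : Iter d) - x).snd
      = (α * tdErr R v v' x) • Eᗮ.starProjection z := by simp
  have h2 := mul_le_mul_of_nonneg_left (norm_starProjection_sq_le (E := E) z)
    (sq_nonneg (α * tdErr R v v' x))
  unfold tdErr at e1 e2 h2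
  unfold updSq tdErr
  rw [e1, e2, norm_smul, mul_pow ‖_‖, Real.norm_eq_abs, sq_abs]
  nlinarith

theorem norm_tdStep_le (hr : 0 ≤ radius) (R : ℝ) (v v' z : Vec d) (x : Iter d) :
    ‖tdStep E cα radius α R v v' z x‖ ≤ radius := norm_ballProj_le hr _

/-- The update is projected onto E_Ψ^⊥ and the ball projection merely rescales, so the parameter
never leaves this subspace. -/
theorem tdStep_snd_mem (R : ℝ) (v v' z : Vec d) {x : Iter d} (hx : x.snd ∈ Eᗮ) :
    (tdStep E cα radius α R v v' z x).snd ∈ Eᗮ := by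
  have h1 : x.snd + (α * tdErr R v v' x) • Eᗮ.starProjection z ∈ Eᗮ :=
    Submodule.add_mem _ hx (Submodule.smul_mem _ _ (Submodule.starProjection_apply_mem _ _))
  unfold tdStep ballProj
  dsimp only
  split_ifs
  · exact h1
  · exact Submodule.smul_mem _ _ h1

/-! ### The solution of the Poisson equation for the update -/

/-- Second component of the Poisson solution, at the previous trace `z` and the state `s`. -/
def paramSol (M : MDP S A) (π : S → PMF A) (μ : PMF S) (ψ : S → Vec d) (lam c r : ℝ) (θ z : Vec d)
    (s : S) : Vec d :=
  (lam * resolvent M π ψ lam c r θ s) • z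
    + poissonSol M π (fun s => resolvent M π ψ lam c r θ s • ψ s) (meanField M π μ ψ lam c r θ) s

/-- First component of the Poisson solution. -/
def rewardSol (M : MDP S A) (π : S → PMF A) (μ : PMF S) (s : S) : ℝ :=
  poissonSol M π (rewardPi M π) (rbar M π μ) s

/-- Twice the scalar product of the error with the Poisson solution. -/
def crossTerm (M : MDP S A) (π : S → PMF A) (μ : PMF S) (ψ : S → Vec d) (lam cα : ℝ)
    (θstar : Vec d) (x : Iter d) (z : Vec d) (s : S) : ℝ :=
  2 * ((x.fst - rbar M π μ) * (cα * rewardSol M π μ s)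
    + inner ℝ (x.snd - θstar) (paramSol M π μ ψ lam 1 x.fst x.snd z s))

/-- Size of the Poisson solution. -/
def solSize (lam ρ : ℝ) (f₁ : S → ℝ) (z : Vec d) (s : S) : ℝ :=
  f₁ s / ((1 - lam) * (1 - ρ)) + ‖z‖ * f₁ s / (1 - lam * ρ) + ‖z‖ / (1 - lam)

theorem reward_geomConv [Finite A] (h : StabilityAssumption M π μ ψ ρ f₁ f₂ f₃) :
    GeomConv M π ρ f₁ 1 (rewardPi M π) (rbar M π μ) where
  intg k s := by
    rw [rewardPi_eq]
    exact (h.secondMoments k s).intg_meanReward 0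
  conv k s := by
    rw [rewardPi_eq, expect_stateLaw_meanReward (h.secondMoments k s), one_mul]
    exact h.meanReward_conv k s

theorem abs_rewardSol_le [Finite A] (h : StabilityAssumption M π μ ψ ρ f₁ f₂ f₃) (s : S) :
    |rewardSol M π μ s| ≤ f₁ s / (1 - ρ) := by
  simpa [rewardSol] using (reward_geomConv h).norm_poissonSol_le h.rho_pos.le h.rho_lt_one s

theorem StabilityAssumption.one_sub_mul_pos (h : StabilityAssumption M π μ ψ ρ f₁ f₂ f₃)
    (h0 : 0 ≤ lam) (h1 : lam < 1) : 0 < 1 - lam * ρ := by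
  nlinarith [h.rho_pos, h.rho_lt_one]

theorem solSize_nonneg (h : StabilityAssumption M π μ ψ ρ f₁ f₂ f₃) (h0 : 0 ≤ lam)
    (h1 : lam < 1) (z : Vec d) (s : S) : 0 ≤ solSize lam ρ f₁ z s := by
  have := h.one_sub_mul_pos h0 h1
  have := h.f₁_nonneg s
  have h2 : 0 < 1 - lam := by linarith
  have h3 : 0 < 1 - ρ := by linarith [h.rho_lt_one]
  unfold solSize
  positivity

/-- One number `L` dominates every occurrence of the coefficients. It is applied to the solution at
an iterate in the ball and to a difference of two solutions, where c = 0. -/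
theorem norm_paramSol_le [Finite A] (h : StabilityAssumption M π μ ψ ρ f₁ f₂ f₃)
    (hμ : SecondMoments M π ψ μ a b) (h0 : 0 ≤ lam) (h1 : lam < 1) {c r L : ℝ} {θ : Vec d}
    (hL1 : |c * rbar M π μ - r| ≤ L) (hL2 : |c| + |r| + 2 * ‖θ‖ ≤ L) (z : Vec d) (s : S) :
    ‖paramSol M π μ ψ lam c r θ z s‖ ≤ L * solSize lam ρ f₁ z s := by
  have hlr := h.one_sub_mul_pos h0 h1
  have hf := h.f₁_nonneg s
  have hl : 0 < 1 - lam := by linarith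
  have hr : 0 < 1 - ρ := by linarith [h.rho_lt_one]
  have b1 := abs_resolvent_le h h0 h1 c r θ s
  have b2 := (resolvent_smul_geomConv h hμ h0 h1 c r θ).norm_poissonSol_le h.rho_pos.le
    h.rho_lt_one s
  unfold paramSol
  refine (norm_add_le _ _).trans ?_
  rw [norm_smul, norm_mul, Real.norm_eq_abs, Real.norm_eq_abs, abs_of_nonneg h0]
  have b3 : |resolvent M π ψ lam c r θ s| ≤ L / (1 - lam) + L * f₁ s / (1 - lam * ρ) := by
    refine b1.trans (add_le_add ?_ ?_)
    · exact div_le_div_of_nonneg_right hL1 hl.le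
    · refine div_le_div_of_nonneg_right (mul_le_mul_of_nonneg_right ?_ hf) hlr.le
      linarith [abs_nonneg r]
  have b4 : lam * |resolvent M π ψ lam c r θ s| * ‖z‖
      ≤ (L / (1 - lam) + L * f₁ s / (1 - lam * ρ)) * ‖z‖ := by
    refine mul_le_mul_of_nonneg_right ?_ (norm_nonneg z)
    exact (mul_le_of_le_one_left (abs_nonneg _) h1.le).trans b3
  have b5 : (|c| + |r| + 2 * ‖θ‖) / (1 - lam) * f₁ s / (1 - ρ)
      ≤ L / (1 - lam) * f₁ s / (1 - ρ) := by
    refine div_le_div_of_nonneg_right (mul_le_mul_of_nonneg_right ?_ hf) hr.le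
    exact div_le_div_of_nonneg_right hL2 hl.le
  refine (add_le_add b4 (b2.trans b5)).trans_eq ?_
  unfold solSize
  field_simp
  ring

theorem paramSol_sub [Finite A] (h : StabilityAssumption M π μ ψ ρ f₁ f₂ f₃)
    (hμ : SecondMoments M π ψ μ a b) (h0 : 0 ≤ lam) (h1 : lam < 1) (c r c' r' : ℝ)
    (θ θ' z : Vec d) (s : S) :
    paramSol M π μ ψ lam c r θ z s - paramSol M π μ ψ lam c' r' θ' z s
      = paramSol M π μ ψ lam (c - c') (r - r') (θ - θ') z s := by
  unfold paramSol
  have e := (resolvent_smul_geomConv h hμ h0 h1 c r θ).poissonSol_sub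
    (resolvent_smul_geomConv h hμ h0 h1 c' r' θ') h.rho_pos.le h.rho_lt_one s
  simp only [← sub_smul, resolvent_sub h h0 h1, meanField_sub h hμ h0 h1] at e
  rw [← e, ← resolvent_sub h h0 h1, mul_sub, sub_smul]
  abel

/-! ### Expectations over one step -/

theorem stepAction_snd (s : S) : (stepAction M π s).map Prod.snd = step M π s := by
  unfold stepAction step
  rw [PMF.map_bind]
  congr 1
  funext a
  rw [PMF.map_comp]
  exact PMF.map_id _

theorem stepAction_fst (s : S) : (stepAction M π s).map Prod.fst = π s := by
  unfold stepAction
  rw [PMF.map_bind]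
  conv_rhs => rw [← PMF.bind_pure (π s)]
  congr 1
  funext a
  rw [PMF.map_comp]
  exact PMF.map_const _ a

theorem stepAction_of_fst {F : Type*} [NormedAddCommGroup F] [NormedSpace ℝ F] [CompleteSpace F]
    (s : S) {f : A → F} (hf : Intg (π s) f) :
    (Intg (stepAction M π s) fun q => f q.1) ∧
      expect (stepAction M π s) (fun q => f q.1) = expect (π s) f := by
  rw [← stepAction_fst (M := M) (π := π) s] at hf
  have hi := intg_map.1 hf
  exact ⟨hi, by rw [← expect_map hi, stepAction_fst]⟩

theorem stepAction_of_snd {F : Type*} [NormedAddCommGroup F] [NormedSpace ℝ F] [CompleteSpace F]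
    (s : S) {f : S → F} (hf : Intg (step M π s) f) :
    (Intg (stepAction M π s) fun q => f q.2) ∧
      expect (stepAction M π s) (fun q => f q.2) = expect (step M π s) f := by
  rw [← stepAction_snd] at hf
  have hi := intg_map.1 hf
  exact ⟨hi, by rw [← expect_map hi, stepAction_snd]⟩

/-- The Poisson equation for the first-order term of one step of the algorithm. -/
theorem expect_first_order [Finite A] (h : StabilityAssumption M π μ ψ ρ f₁ f₂ f₃)
    (hμ : SecondMoments M π ψ μ a b) (h0 : 0 ≤ lam) (h1 : lam < 1) (θstar : Vec d) (x : Iter d)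
    (z : Vec d) (s : S) :
    expect (stepAction M π s) (fun q =>
        2 * ((x.fst - rbar M π μ) * (cα * (M.reward s q.1 - x.fst))
          + tdErr (M.reward s q.1) (ψ s) (ψ q.2) x * inner ℝ (x.snd - θstar) (lam • z + ψ s))
        + crossTerm M π μ ψ lam cα θstar x (lam • z + ψ s) q.2)
      = crossTerm M π μ ψ lam cα θstar x z s
        + 2 * ((x.fst - rbar M π μ) * (cα * (rbar M π μ - x.fst))
          + inner ℝ (x.snd - θstar) (meanField M π μ ψ lam 1 x.fst x.snd)) := by
  set u := x.fst - rbar M π μ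
  set v := x.snd - θstar
  set zn := lam • z + ψ s with hzn
  set κ := stepAction M π s
  have hm := h.secondMoments 1 s
  rw [stateLaw_one] at hm
  have hf : ∀ s, Intg (step M π s) f₁ := fun s => by
    have := h.intg_f₁ 1 s
    rwa [stateLaw_one] at this
  obtain ⟨iR, eR⟩ := stepAction_of_fst (M := M) s (intg_of_finite (π s) (M.reward s))
  have iψ0 : Intg (step M π s) fun t => (inner ℝ (ψ t) x.snd : ℝ) := by
    simpa [real_inner_comm] using hm.intg_feature.clm (innerSL ℝ x.snd)
  obtain ⟨iψ, eψ⟩ := stepAction_of_snd s iψ0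
  have eψ0 : expect (step M π s) (fun t => (inner ℝ (ψ t) x.snd : ℝ))
      = inner ℝ (meanFeature M π ψ 1 s) x.snd := by
    rw [← stateLaw_one]
    exact expect_lin h x.snd 1 s
  obtain ⟨ig0, eg0⟩ := (reward_geomConv h).poisson_eq h.rho_pos.le h.rho_lt_one hf s
  obtain ⟨ig, eg⟩ := stepAction_of_snd s ig0
  obtain ⟨ir0, er0⟩ := resolvent_eq h h0 h1 1 x.fst x.snd s
  obtain ⟨ir, er⟩ := stepAction_of_snd s ir0
  obtain ⟨iu0, eu0⟩ := (resolvent_smul_geomConv h hμ h0 h1 1 x.fst x.snd).poisson_eq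
    h.rho_pos.le h.rho_lt_one hf s
  obtain ⟨iu, eu⟩ := stepAction_of_snd s iu0
  have ip := ((ir.const_mul lam).smul_const zn).add iu
  have ep : expect κ (fun q => paramSol M π μ ψ lam 1 x.fst x.snd zn q.2)
      = (lam * expect (step M π s) (resolvent M π ψ lam 1 x.fst x.snd)) • zn
        + (poissonSol M π (fun s => resolvent M π ψ lam 1 x.fst x.snd s • ψ s)
            (meanField M π μ ψ lam 1 x.fst x.snd) s
          - (resolvent M π ψ lam 1 x.fst x.snd s • ψ s
            - meanField M π μ ψ lam 1 x.fst x.snd)) := by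
    unfold paramSol
    rw [expect_add ((ir.const_mul lam).smul_const zn) iu, eu, eu0,
      expect_smul_const (ir.const_mul lam), expect_const_mul ir, er]
  have iv : Intg κ fun q => inner ℝ v (paramSol M π μ ψ lam 1 x.fst x.snd zn q.2) :=
    ip.clm (innerSL ℝ v)
  have ev := expect_inner_left ip v
  rw [show expect κ (fun q => (lam * resolvent M π ψ lam 1 x.fst x.snd q.2) • zn
      + poissonSol M π (fun s => resolvent M π ψ lam 1 x.fst x.snd s • ψ s)
            (meanField M π μ ψ lam 1 x.fst x.snd) q.2) = _ from ep] at ev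
  -- Grouped by random quantity: the reward depends on the action alone, and all other random terms
  -- on the next state alone, so each expectation reduces to one marginal.
  have e1 : (fun q : A × S =>
        2 * (u * (cα * (M.reward s q.1 - x.fst))
          + tdErr (M.reward s q.1) (ψ s) (ψ q.2) x * inner ℝ v zn)
        + crossTerm M π μ ψ lam cα θstar x zn q.2)
      = fun q => (2 * (u * cα + inner ℝ v zn)) * M.reward s q.1
        + (2 * inner ℝ v zn) * inner ℝ (ψ q.2) x.snd
        + (2 * u * cα) * rewardSol M π μ q.2
        + 2 * inner ℝ v (paramSol M π μ ψ lam 1 x.fst x.snd zn q.2)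
        + (2 * (-(u * cα * x.fst) - (x.fst + inner ℝ (ψ s) x.snd) * inner ℝ v zn)) := by
    funext q
    unfold crossTerm tdErr
    ring
  rw [e1]
  have j1 := (iR.const_mul (2 * (u * cα + inner ℝ v zn))).add (iψ.const_mul (2 * inner ℝ v zn))
  have j2 := j1.add (show Intg κ fun q => (2 * u * cα) * rewardSol M π μ q.2 from
    ig.const_mul _)
  have j3 := j2.add (iv.const_mul 2)
  rw [expect_add j3 (Intg.const _ _), expect_const, expect_add j2 (iv.const_mul 2),
    expect_add j1 (show Intg κ fun q => (2 * u * cα) * rewardSol M π μ q.2 from ig.const_mul _),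
    expect_add (iR.const_mul _) (iψ.const_mul _), expect_const_mul iR, expect_const_mul iψ,
    expect_const_mul iv, eR, eψ, eψ0]
  have eg' : expect κ (fun q => (2 * u * cα) * rewardSol M π μ q.2)
      = (2 * u * cα) * (rewardSol M π μ s - (rewardPi M π s - rbar M π μ)) := by
    rw [expect_const_mul (show Intg κ fun q => rewardSol M π μ q.2 from ig)]
    congr 1
    exact eg.trans eg0
  have ev' : expect κ (fun q => inner ℝ v (paramSol M π μ ψ lam 1 x.fst x.snd zn q.2)) = _ := ev
  rw [eg', ev']
  have hsig : lam * expect (step M π s) (resolvent M π ψ lam 1 x.fst x.snd)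
      = resolvent M π ψ lam 1 x.fst x.snd s
        - (rewardPi M π s - x.fst + (inner ℝ (meanFeature M π ψ 1 s) x.snd
          - inner ℝ (ψ s) x.snd)) := by
    rw [er0]
    unfold signal
    rw [← meanReward_zero, meanFeature_zero, inner_sub_left]
    ring
  rw [hsig]
  unfold crossTerm paramSol
  rw [show expect (π s) (M.reward s) = rewardPi M π s from rfl]
  simp only [inner_add_right, inner_sub_right, inner_smul_right, hzn]
  ring

end OneStep

end AvgTD

end

open scoped ENNReal

noncomputable section

namespace AvgTD

/-! ### Pointwise Lyapunov inequality and moments along the history -/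

section Recursion

variable {S A : Type*} {d : ℕ} {M : MDP S A} {π : S → PMF A} {μ ν : PMF S} {ψ : S → Vec d}
  {ρ lam a b rhat ψhat cα D α : ℝ} {f₁ f₂ f₃ : S → ℝ} {θstar : Vec d}

/-! ### Pointwise estimates for one step -/

/-- Bound for the Lipschitz constant of the cross term on the ball. -/
def lipSize (lam ρ cα D : ℝ) (f₁ : S → ℝ) (z : Vec d) (s : S) : ℝ :=
  cα * (f₁ s / (1 - ρ)) + (9 / 2 * D + 1) * solSize lam ρ f₁ z s

/-- Bound for the absolute value of the cross term on the ball. -/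
def crossSize (lam ρ cα D : ℝ) (f₁ : S → ℝ) (z : Vec d) (s : S) : ℝ :=
  2 * D * (cα * (f₁ s / (1 - ρ)) + (3 / 2 * D + 1) * solSize lam ρ f₁ z s)

/-- In a ball of radius D/2, 1 + |r| + 2‖θ‖ ≤ 1 + 3D/2, which is the coefficient here. -/
theorem norm_paramSol_ball_le [Finite A] (h : StabilityAssumption M π μ ψ ρ f₁ f₂ f₃)
    (hμ : SecondMoments M π ψ μ a b) (h0 : 0 ≤ lam) (h1 : lam < 1)
    (hpt : ‖pt (rbar M π μ) θstar‖ ≤ D / 2) {x : Iter d} (hx : ‖x‖ ≤ D / 2) (z : Vec d) (s : S) :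
    ‖paramSol M π μ ψ lam 1 x.fst x.snd z s‖ ≤ (3 / 2 * D + 1) * solSize lam ρ f₁ z s := by
  have h2 := abs_fst_le x
  have h3 := norm_snd_le x
  have h4 : |rbar M π μ| ≤ ‖pt (rbar M π μ) θstar‖ := abs_fst_le (pt (rbar M π μ) θstar)
  refine norm_paramSol_le h hμ h0 h1 ?_ ?_ z s
  · rw [one_mul]
    have := abs_sub (rbar M π μ) x.fst
    linarith [norm_nonneg x]
  · rw [abs_one]
    linarith

theorem norm_error_le {r : ℝ} (hpt : ‖pt r θstar‖ ≤ D / 2) {x : Iter d} (hx : ‖x‖ ≤ D / 2) :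
    |x.fst - r| ≤ D ∧ ‖x.snd - θstar‖ ≤ D := by
  have h1 : ‖x - pt r θstar‖ ≤ D := by linarith [norm_sub_le x (pt r θstar)]
  exact ⟨(abs_fst_le (x - pt r θstar)).trans h1, (norm_snd_le (x - pt r θstar)).trans h1⟩

theorem abs_crossTerm_le [Finite A] (h : StabilityAssumption M π μ ψ ρ f₁ f₂ f₃)
    (hμ : SecondMoments M π ψ μ a b) (h0 : 0 ≤ lam) (h1 : lam < 1) (hcα : 0 ≤ cα)
    (hpt : ‖pt (rbar M π μ) θstar‖ ≤ D / 2) {x : Iter d} (hx : ‖x‖ ≤ D / 2) (z : Vec d) (s : S) :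
    |crossTerm M π μ ψ lam cα θstar x z s| ≤ crossSize lam ρ cα D f₁ z s := by
  have hg := abs_rewardSol_le h s
  have hp := norm_paramSol_ball_le h hμ h0 h1 hpt hx z s
  obtain ⟨hu, hv⟩ := norm_error_le hpt hx
  have hD : 0 ≤ D := by linarith [norm_nonneg x]
  unfold crossTerm crossSize
  rw [abs_mul, abs_two, mul_assoc 2 D]
  refine mul_le_mul_of_nonneg_left ?_ zero_le_two
  rw [mul_add]
  refine (abs_add_le _ _).trans (add_le_add ?_ ?_)
  · rw [abs_mul, abs_mul, abs_of_nonneg hcα]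
    exact mul_le_mul hu (mul_le_mul_of_nonneg_left hg hcα) (by positivity) hD
  · exact (abs_real_inner_le_norm _ _).trans (mul_le_mul hv hp (norm_nonneg _) hD)

/-- The cross term is a product of the error and the solution. Moving the error costs 3D/2 + 1, the
size of the solution; moving the solution costs 3D, its Lipschitz constant times the size of the
error. Their sum is the 9D/2 + 1 of `lipSize`. -/
theorem crossTerm_sub_le [Finite A] (h : StabilityAssumption M π μ ψ ρ f₁ f₂ f₃)
    (hμ : SecondMoments M π ψ μ a b) (h0 : 0 ≤ lam) (h1 : lam < 1) (hcα : 0 ≤ cα)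
    (hpt : ‖pt (rbar M π μ) θstar‖ ≤ D / 2) {x x' : Iter d} (hx : ‖x‖ ≤ D / 2)
    (hx' : ‖x'‖ ≤ D / 2) (z : Vec d) (s : S) :
    crossTerm M π μ ψ lam cα θstar x' z s - crossTerm M π μ ψ lam cα θstar x z s
      ≤ 2 * (‖x' - x‖ * lipSize lam ρ cα D f₁ z s) := by
  have hg := abs_rewardSol_le h s
  have hp := norm_paramSol_ball_le h hμ h0 h1 hpt hx' z s
  obtain ⟨-, hv⟩ := norm_error_le hpt hx
  have hD : 0 ≤ D := by linarith [norm_nonneg x]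
  have d1 : |x'.fst - x.fst| ≤ ‖x' - x‖ := abs_fst_le (x' - x)
  have d2 : ‖x'.snd - x.snd‖ ≤ ‖x' - x‖ := norm_snd_le (x' - x)
  have hd : ‖paramSol M π μ ψ lam 0 (x'.fst - x.fst) (x'.snd - x.snd) z s‖
      ≤ (3 * ‖x' - x‖) * solSize lam ρ f₁ z s := by
    refine norm_paramSol_le h hμ h0 h1 ?_ ?_ z s
    · rw [zero_mul, zero_sub, abs_neg]
      linarith [norm_nonneg (x' - x)]
    · rw [abs_zero]
      linarith
  have hsub := paramSol_sub h hμ h0 h1 1 x'.fst 1 x.fst x'.snd x.snd z s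
  rw [sub_self] at hsub
  have e : crossTerm M π μ ψ lam cα θstar x' z s - crossTerm M π μ ψ lam cα θstar x z s
      = 2 * ((x'.fst - x.fst) * (cα * rewardSol M π μ s)
        + inner ℝ (x'.snd - x.snd) (paramSol M π μ ψ lam 1 x'.fst x'.snd z s)
        + inner ℝ (x.snd - θstar)
          (paramSol M π μ ψ lam 0 (x'.fst - x.fst) (x'.snd - x.snd) z s)) := by
    rw [← hsub]
    unfold crossTerm
    simp only [inner_sub_left, inner_sub_right]
    ring
  rw [e]
  refine mul_le_mul_of_nonneg_left ?_ zero_le_two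
  have t1 : (x'.fst - x.fst) * (cα * rewardSol M π μ s)
      ≤ ‖x' - x‖ * (cα * (f₁ s / (1 - ρ))) := by
    refine (le_abs_self _).trans ?_
    rw [abs_mul, abs_mul, abs_of_nonneg hcα]
    exact mul_le_mul d1 (mul_le_mul_of_nonneg_left hg hcα) (by positivity) (norm_nonneg _)
  have t2 : inner ℝ (x'.snd - x.snd) (paramSol M π μ ψ lam 1 x'.fst x'.snd z s)
      ≤ ‖x' - x‖ * ((3 / 2 * D + 1) * solSize lam ρ f₁ z s) :=
    (real_inner_le_norm _ _).trans (mul_le_mul d2 hp (norm_nonneg _) (norm_nonneg _))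
  have t3 : inner ℝ (x.snd - θstar)
      (paramSol M π μ ψ lam 0 (x'.fst - x.fst) (x'.snd - x.snd) z s)
      ≤ D * ((3 * ‖x' - x‖) * solSize lam ρ f₁ z s) :=
    (real_inner_le_norm _ _).trans (mul_le_mul hv hd (norm_nonneg _) hD)
  unfold lipSize
  linarith

/-- The squared error contributes α²Φ. Replacing the old iterate by the new one in the cross term
costs 2α·‖x' - x‖·L ≤ 2α²√Φ·L ≤ α²(Φ + L²), so all remainders are of second order in α. -/
theorem lyapunov_step_le [Finite A] (h : StabilityAssumption M π μ ψ ρ f₁ f₂ f₃)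
    (hμ : SecondMoments M π ψ μ a b) (h0 : 0 ≤ lam) (h1 : lam < 1) (hcα : 0 ≤ cα) (hα : 0 ≤ α)
    (hpt : ‖pt (rbar M π μ) θstar‖ ≤ D / 2) {x : Iter d} (hx : ‖x‖ ≤ D / 2)
    (hθ : x.snd - θstar ∈ (constSpace ψ)ᗮ) (z : Vec d) (s t : S) (R : ℝ) {x' : Iter d}
    (hx' : x' = tdStep (constSpace ψ) cα (D / 2) α R (ψ s) (ψ t) z x) :
    sqErr (rbar M π μ) θstar x' + α * crossTerm M π μ ψ lam cα θstar x' z t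
      ≤ sqErr (rbar M π μ) θstar x + α * (2 * ((x.fst - rbar M π μ) * (cα * (R - x.fst))
          + tdErr R (ψ s) (ψ t) x * inner ℝ (x.snd - θstar) z)
        + crossTerm M π μ ψ lam cα θstar x z t)
        + α ^ 2 * (2 * updSq cα R (ψ s) (ψ t) z x + lipSize lam ρ cα D f₁ z t ^ 2) := by
  have hD : 0 ≤ D / 2 := (norm_nonneg x).trans hx
  have h2 := sqErr_tdStep_le (cα := cα) (α := α) R (ψ s) (ψ t) z x hpt hθ
  have h3 := norm_tdStep_sub_le (E := constSpace ψ) (cα := cα) R (ψ s) (ψ t) z x hα hx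
  have h4 := crossTerm_sub_le h hμ h0 h1 hcα hpt hx
    (norm_tdStep_le (E := constSpace ψ) (cα := cα) (α := α) hD R (ψ s) (ψ t) z x) z t
  rw [← hx'] at h2 h3 h4
  set Φ := updSq cα R (ψ s) (ψ t) z x
  set L := lipSize lam ρ cα D f₁ z t with hL
  have hL0 : 0 ≤ L := by
    have h5 := h.f₁_nonneg t
    have h6 := solSize_nonneg h h0 h1 z t
    have h7 : 0 < 1 - ρ := by linarith [h.rho_lt_one]
    have h8 : 0 ≤ D := by linarith
    rw [hL]
    unfold lipSize
    positivity
  have h5 : ‖x' - x‖ * L ≤ α * √Φ * L := mul_le_mul_of_nonneg_right h3 hL0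
  have h6 : 2 * (√Φ * L) ≤ Φ + L ^ 2 := by
    have := Real.sq_sqrt (updSq_nonneg cα R (ψ s) (ψ t) z x)
    nlinarith [sq_nonneg (√Φ - L)]
  have h7 := mul_le_mul_of_nonneg_left (h4.trans (mul_le_mul_of_nonneg_left h5 zero_le_two)) hα
  have h8 := mul_le_mul_of_nonneg_left h6 (sq_nonneg α)
  nlinarith

/-! ### Moments along the history -/

theorem ExpectLE.of_map {X Y : Type*} {p : PMF X} {g : X → Y} {f : Y → ℝ} {c : ℝ}
    (hf0 : ∀ y, 0 ≤ f y) (h : ExpectLE (p.map g) f c) : ExpectLE p (fun x => f (g x)) c := by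
  have hi := intg_map.1 (h.intg hf0)
  refine hi.expectLE ?_
  rw [← expect_map hi]
  exact h.2

/-- Properties of the law of the history after `n + 1` steps: law of the state and moment of the
trace. -/
structure HistLaw (M : MDP S A) (π : S → PMF A) (ψ : S → Vec d) (lam B : ℝ) (s₁ : S) (n : ℕ)
    (H : PMF (List (S × A) × S)) : Prop where
  snd : H.map Prod.snd = stateLaw M π n s₁
  length : ∀ p, H p ≠ 0 → p.1.length = n + 1
  trace_moment : ExpectLE H (fun p => ‖histTrace lam ψ p.1‖ ^ 4) (B / (1 - lam) ^ 4)

/-- λz + v is the convex combination of z and v/(1-λ) with weights λ and 1-λ; convexity of the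
fourth power does the rest. Consequently a moment bound B/(1-λ)⁴ propagates unchanged from one trace
to the next. -/
theorem norm_trace_step_le (h0 : 0 ≤ lam) (h1 : lam < 1) (z v : Vec d) :
    ‖lam • z + v‖ ^ 4 ≤ lam * ‖z‖ ^ 4 + (1 - lam) / (1 - lam) ^ 4 * ‖v‖ ^ 4 := by
  have hl : 0 < 1 - lam := by linarith
  have h2 : ‖lam • z + v‖ ≤ lam * ‖z‖ + (1 - lam) * (‖v‖ / (1 - lam)) := by
    refine (norm_add_le _ _).trans (le_of_eq ?_)
    rw [norm_smul, Real.norm_of_nonneg h0]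
    field_simp
  refine (pow_le_pow_left₀ (norm_nonneg _) h2 4).trans ?_
  have h3 := (convexOn_pow 4).2 (show ‖z‖ ∈ Set.Ici 0 from norm_nonneg z)
    (show ‖v‖ / (1 - lam) ∈ Set.Ici 0 from div_nonneg (norm_nonneg v) hl.le) h0 hl.le
    (by ring)
  simp only [smul_eq_mul] at h3
  refine h3.trans_eq ?_
  rw [div_pow]
  ring

variable {s₀ s₁ : S} {n : ℕ} {H : PMF (List (S × A) × S)} {B : ℝ}

theorem HistLaw.of_state (hH : HistLaw M π ψ lam B s₁ n H) {f : S → ℝ} {c : ℝ}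
    (hf0 : ∀ s, 0 ≤ f s) (h : ExpectLE (stateLaw M π n s₁) f c) :
    ExpectLE H (fun p => f p.2) c :=
  ExpectLE.of_map (g := Prod.snd) hf0 (hH.snd.symm ▸ h)

theorem HistLaw.trace_next (hH : HistLaw M π ψ lam B s₁ n H)
    (h : StabilityAssumption M π μ ψ ρ f₁ f₂ f₃) (h0 : 0 ≤ lam) (h1 : lam < 1)
    (hB : f₃ s₁ ≤ B) :
    ExpectLE H (fun p => ‖lam • histTrace lam ψ p.1 + ψ p.2‖ ^ 4) (B / (1 - lam) ^ 4) := by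
  have hl : 0 < 1 - lam := by linarith
  have hψ := hH.of_state (f := fun s => ‖ψ s‖ ^ 4) (fun s => by positivity) (h.feature_moment s₁ n)
  refine (((hH.trace_moment.const_mul h0).add (hψ.const_mul
    (c := (1 - lam) / (1 - lam) ^ 4) (by positivity))).mono (fun _ => by positivity)
    fun p _ => norm_trace_step_le h0 h1 _ _).mono_const ?_
  have h2 : (1 - lam) / (1 - lam) ^ 4 * f₃ s₁ ≤ (1 - lam) / (1 - lam) ^ 4 * B :=
    mul_le_mul_of_nonneg_left hB (by positivity)
  refine (add_le_add le_rfl h2).trans_eq ?_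
  ring

/-- After one step the trace is ψ(s₀) whatever the first action was, so the conditional law of that
action plays no role. Dividing by (1-λ)⁴ ≤ 1 only enlarges the bound. -/
theorem HistLaw.init (h0 : 0 ≤ lam) (h1 : lam < 1) (hB : ‖ψ s₀‖ ^ 4 ≤ B)
    (hH : ∀ p, H p ≠ 0 → p.2 = s₁ ∧ ∃ a, p.1 = [(s₀, a)]) :
    HistLaw M π ψ lam B s₁ 0 H where
  snd := by
    have e : H.map Prod.snd = H.bind fun _ => PMF.pure s₁ := by
      ext t
      rw [map_eq_bind, PMF.bind_apply, PMF.bind_apply]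
      refine tsum_congr fun p => ?_
      by_cases hp : H p = 0
      · simp [hp]
      · rw [(hH p hp).1]
    rw [e, PMF.bind_const, stateLaw_zero]
  length p hp := by
    obtain ⟨-, a, e⟩ := hH p hp
    rw [e]; rfl
  trace_moment := by
    refine (ExpectLE.const H B).mono (fun _ => by positivity) (fun p hp => ?_) |>.mono_const ?_
    · obtain ⟨-, a, e⟩ := hH p hp
      rw [e]
      simpa [histTrace] using hB
    · have hB0 : 0 ≤ B := le_trans (by positivity) hB
      refine le_div_self hB0 (by have : 0 < 1 - lam := by linarith
                                 positivity) ?_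
      exact pow_le_one₀ (by linarith) (by linarith)

theorem HistLaw.next (hH : HistLaw M π ψ lam B s₁ n H)
    (h : StabilityAssumption M π μ ψ ρ f₁ f₂ f₃) (h0 : 0 ≤ lam) (h1 : lam < 1)
    (hB : f₃ s₁ ≤ B) : HistLaw M π ψ lam B s₁ (n + 1) (H.bind (histStep M π)) where
  snd := by
    rw [PMF.map_bind]
    have e : (fun p => (histStep M π p).map Prod.snd) = (step M π) ∘ Prod.snd := by
      funext p
      unfold histStep
      rw [PMF.map_comp, Function.comp_apply, ← stepAction_snd]
      rfl
    rw [e, ← PMF.bind_map, hH.snd]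
    rfl
  length p hp := by
    obtain ⟨p', hp', h2⟩ := (PMF.mem_support_bind_iff _ _ _).1 hp
    obtain ⟨q, -, rfl⟩ := (PMF.mem_support_map_iff _ _ _).1 h2
    simp [extendHist, hH.length p' hp']
  trace_moment := by
    have hnext := hH.trace_next h h0 h1 hB
    refine ExpectLE.bind (f := fun p : List (S × A) × S => ‖histTrace lam ψ p.1‖ ^ 4)
      (h := fun p : List (S × A) × S => ‖lam • histTrace lam ψ p.1 + ψ p.2‖ ^ 4)
      (fun _ => pow_nonneg (norm_nonneg _) 4) (fun p _ => ?_) hnext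
    refine ExpectLE.map (g := extendHist p)
      (f := fun p : List (S × A) × S => ‖histTrace lam ψ p.1‖ ^ 4)
      (fun _ => pow_nonneg (norm_nonneg _) 4) ?_
    exact ExpectLE.const (stepAction M π p.2) (‖lam • histTrace lam ψ p.1 + ψ p.2‖ ^ 4)

/-- Joint law of the history and of the next action and state. -/
def pairLaw (M : MDP S A) (π : S → PMF A) (H : PMF (List (S × A) × S)) :
    PMF ((List (S × A) × S) × (A × S)) :=
  H.bind fun p => (stepAction M π p.2).map fun q => (p, q)

theorem pairLaw_extend : (pairLaw M π H).map (fun j => extendHist j.1 j.2)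
    = H.bind (histStep M π) := by
  unfold pairLaw
  rw [PMF.map_bind]
  congr 1
  funext p
  rw [PMF.map_comp]
  rfl

theorem pairLaw_fst : (pairLaw M π H).map Prod.fst = H := by
  unfold pairLaw
  rw [PMF.map_bind]
  conv_rhs => rw [← PMF.bind_pure H]
  congr 1
  funext p
  rw [PMF.map_comp]
  exact PMF.map_const _ p

theorem ExpectLE.pairLaw_fst {f : List (S × A) × S → ℝ} {c : ℝ} (hf0 : ∀ p, 0 ≤ f p)
    (hf : ExpectLE H f c) : ExpectLE (pairLaw M π H) (fun j => f j.1) c := by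
  refine ExpectLE.of_map (g := Prod.fst) hf0 ?_
  rw [AvgTD.pairLaw_fst]
  exact hf

theorem HistLaw.pairLaw_action (hH : HistLaw M π ψ lam B s₁ n H) :
    (pairLaw M π H).map (fun j => (j.1.2, j.2.1)) = stateActionLaw M π n s₁ := by
  unfold pairLaw stateActionLaw
  rw [PMF.map_bind, ← hH.snd, PMF.bind_map]
  congr 1
  funext p
  rw [PMF.map_comp, Function.comp_apply, ← stepAction_fst (M := M) (π := π), PMF.map_comp]
  rfl

theorem HistLaw.pairLaw_state (hH : HistLaw M π ψ lam B s₁ n H) :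
    (pairLaw M π H).map (fun j => j.2.2) = stateLaw M π (n + 1) s₁ := by
  unfold pairLaw
  rw [PMF.map_bind]
  have e : (fun p : List (S × A) × S => ((stepAction M π p.2).map fun q => (p, q)).map
      fun j => j.2.2) = (step M π) ∘ Prod.snd := by
    funext p
    rw [PMF.map_comp, Function.comp_apply, ← stepAction_snd]
    rfl
  rw [e, ← PMF.bind_map, hH.snd]
  rfl

theorem ExpectLE.sq_of_fourth {X : Type*} {p : PMF X} {f : X → ℝ} {c : ℝ}
    (h : ExpectLE p (fun x => f x ^ 4) c) : ExpectLE p (fun x => f x ^ 2) (√c) :=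
  ExpectLE.le_sqrt (by simpa [← pow_mul] using h) fun _ => sq_nonneg _

theorem ExpectLE.mul_of_fourth {X : Type*} {p : PMF X} {f g : X → ℝ} {c c' : ℝ}
    (hf : ExpectLE p (fun x => f x ^ 4) c) (hg : ExpectLE p (fun x => g x ^ 4) c') :
    ExpectLE p (fun x => f x ^ 2 * g x ^ 2) (√c * √c') :=
  ExpectLE.mul_le_sqrt (by simpa [← pow_mul] using hf) (by simpa [← pow_mul] using hg)
    (fun _ => sq_nonneg _) fun _ => sq_nonneg _

theorem sqrt_div_pow_four {l : ℝ} (B : ℝ) : √(B / l ^ 4) = √B / l ^ 2 := by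
  rw [Real.sqrt_div' _ (by positivity), show l ^ 4 = (l ^ 2) ^ 2 by ring,
    Real.sqrt_sq (sq_nonneg l)]

/-- The quantities depending on the iterate are removed by r² + ‖θ‖² ≤ D²/4. Cauchy–Schwarz in the
pairs (r, ‖θ‖) and (1, ‖v' - v‖) handles the value part of the temporal difference, leaving only
random variables with fourth moments. -/
theorem updSq_le {R : ℝ} {v v' z : Vec d} {x : Iter d} (hD : 0 ≤ D) (hx : ‖x‖ ≤ D / 2) :
    updSq cα R v v' z x ≤ 2 * cα ^ 2 * R ^ 2 + 2 * (R ^ 2 * ‖z‖ ^ 2)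
      + D ^ 2 / 2 * (cα ^ 2 + ‖z‖ ^ 2 + ‖v' - v‖ ^ 2 * ‖z‖ ^ 2) := by
  have hx2 : x.fst ^ 2 + ‖x.snd‖ ^ 2 ≤ D ^ 2 / 4 := by
    rw [← iter_norm_sq]
    nlinarith [norm_nonneg x]
  set r := x.fst
  set w := ‖x.snd‖
  set i : ℝ := inner ℝ (v' - v) x.snd with hi
  have hiw : i ^ 2 ≤ ‖v' - v‖ ^ 2 * w ^ 2 := by
    rw [← sq_abs, ← mul_pow]
    exact pow_le_pow_left₀ (abs_nonneg _) (abs_real_inner_le_norm _ _) 2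
  have e : tdErr R v v' x = R - r + i := by
    unfold tdErr
    rw [hi, inner_sub_left]
    ring
  unfold updSq
  rw [e]
  set y := ‖v' - v‖ ^ 2
  have hy : 0 ≤ y := sq_nonneg _
  have hri : (r - i) ^ 2 ≤ (1 + y) * (D ^ 2 / 4) := by
    have h1 : (r - i) ^ 2 ≤ (1 + y) * (r ^ 2 + w ^ 2) := by
      have h3 : (‖v' - v‖ * |r| - w) ^ 2 ≥ 0 := sq_nonneg _
      have h4 : 2 * (|r| * |i|) ≤ y * r ^ 2 + w ^ 2 := by
        have h5 : |i| ≤ ‖v' - v‖ * w := abs_real_inner_le_norm _ _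
        have h6 := mul_le_mul_of_nonneg_left h5 (abs_nonneg r)
        have h7 : |r| ^ 2 = r ^ 2 := sq_abs r
        nlinarith
      have h8 : -(2 * (r * i)) ≤ 2 * (|r| * |i|) := by
        rw [← abs_mul]
        linarith [neg_abs_le (r * i)]
      nlinarith [sq_nonneg w]
    exact h1.trans (mul_le_mul_of_nonneg_left hx2 (by positivity))
  have hδ : (R - r + i) ^ 2 ≤ 2 * R ^ 2 + 2 * ((1 + y) * (D ^ 2 / 4)) := by
    nlinarith [sq_nonneg (R + (r - i))]
  have hr : (R - r) ^ 2 ≤ 2 * R ^ 2 + 2 * (D ^ 2 / 4) := by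
    nlinarith [sq_nonneg (R + r), sq_nonneg w]
  have h2 := mul_le_mul_of_nonneg_left hr (sq_nonneg cα)
  have h3 := mul_le_mul_of_nonneg_right hδ (sq_nonneg ‖z‖)
  nlinarith

theorem HistLaw.reward_fourth (hH : HistLaw M π ψ lam B s₁ n H)
    (h : StabilityAssumption M π μ ψ ρ f₁ f₂ f₃) :
    ExpectLE (pairLaw M π H) (fun j => M.reward j.1.2 j.2.1 ^ 4) (f₃ s₁) := by
  refine ExpectLE.of_map (g := fun j : (List (S × A) × S) × (A × S) => (j.1.2, j.2.1))
    (f := fun q => M.reward q.1 q.2 ^ 4) (fun _ => by positivity) ?_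
  rw [hH.pairLaw_action]
  exact h.reward_moment s₁ n

theorem HistLaw.feature_diff_fourth (hH : HistLaw M π ψ lam B s₁ n H)
    (h : StabilityAssumption M π μ ψ ρ f₁ f₂ f₃) :
    ExpectLE (pairLaw M π H) (fun j => ‖ψ j.2.2 - ψ j.1.2‖ ^ 4) (16 * f₃ s₁) := by
  have mψ' : ExpectLE (pairLaw M π H) (fun j => ‖ψ j.2.2‖ ^ 4) (f₃ s₁) := by
    refine ExpectLE.of_map (g := fun j : (List (S × A) × S) × (A × S) => j.2.2)
      (f := fun s => ‖ψ s‖ ^ 4) (fun _ => by positivity) ?_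
    rw [hH.pairLaw_state]
    exact h.feature_moment s₁ (n + 1)
  have mψ : ExpectLE (pairLaw M π H) (fun j => ‖ψ j.1.2‖ ^ 4) (f₃ s₁) := by
    have h2 := hH.of_state (f := fun s => ‖ψ s‖ ^ 4) (fun s => by positivity)
      (h.feature_moment s₁ n)
    exact h2.pairLaw_fst fun _ => pow_nonneg (norm_nonneg _) 4
  refine (((mψ'.add mψ).const_mul (c := 8) (by norm_num)).mono (fun _ => by positivity)
    fun j _ => ?_).mono_const (by linarith)
  have h2 := pow_le_pow_left₀ (norm_nonneg _) (norm_sub_le (ψ j.2.2) (ψ j.1.2)) 4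
  refine h2.trans ?_
  exact (add_pow_le (norm_nonneg _) (norm_nonneg _) 4).trans_eq (by norm_num)

theorem HistLaw.trace_fourth (hH : HistLaw M π ψ lam B s₁ n H)
    (h : StabilityAssumption M π μ ψ ρ f₁ f₂ f₃) (h0 : 0 ≤ lam) (h1 : lam < 1)
    (hB : f₃ s₁ ≤ B) :
    ExpectLE (pairLaw M π H) (fun j => ‖lam • histTrace lam ψ j.1.1 + ψ j.1.2‖ ^ 4)
      (B / (1 - lam) ^ 4) := by
  have h2 := hH.trace_next h h0 h1 hB
  exact h2.pairLaw_fst fun _ => pow_nonneg (norm_nonneg _) 4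

/-- The feature increment has fourth moment at most 16 f, and √(16 f) = 4√f produces the term
4F₃/(1-λ)² of `That`. -/
theorem updSq_const_le {l f F₃ : ℝ} (hl : 0 < l) (hf : 0 ≤ f) (hB : f ≤ B) (hF : B ≤ F₃)
    {lam : ℝ} (hlam : l = 1 - lam) :
    2 * cα ^ 2 * √f + 2 * (√f * (√B / l ^ 2))
      + D ^ 2 / 2 * (cα ^ 2 + √B / l ^ 2 + √(16 * f) * (√B / l ^ 2))
      ≤ 2 * bhat lam cα F₃ + D ^ 2 / 2 * That lam cα F₃ := by
  have s1 : √f ≤ √F₃ := Real.sqrt_le_sqrt (hB.trans hF)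
  have s2 : √B ≤ √F₃ := Real.sqrt_le_sqrt hF
  have s3 : √F₃ * √F₃ = F₃ := Real.mul_self_sqrt (hf.trans (hB.trans hF))
  have s4 : √(16 * f) = 4 * √f := by
    rw [Real.sqrt_mul (by norm_num), show (16 : ℝ) = 4 ^ 2 by norm_num,
      Real.sqrt_sq (by norm_num)]
  have s5 : √f * √B ≤ F₃ :=
    (mul_le_mul s1 s2 (Real.sqrt_nonneg _) (Real.sqrt_nonneg _)).trans_eq s3
  have s6 : √f * (√B / l ^ 2) ≤ F₃ / l ^ 2 := by
    rw [← mul_div_assoc]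
    exact div_le_div_of_nonneg_right s5 (by positivity)
  have s7 : √B / l ^ 2 ≤ √F₃ / l ^ 2 := div_le_div_of_nonneg_right s2 (by positivity)
  rw [s4]
  unfold bhat That
  rw [← hlam]
  have s8 := mul_le_mul_of_nonneg_left s1 (show 0 ≤ 2 * cα ^ 2 by positivity)
  have s9 : cα ^ 2 + √B / l ^ 2 + 4 * √f * (√B / l ^ 2)
      ≤ cα ^ 2 + √F₃ / l ^ 2 + 4 * F₃ / l ^ 2 := by
    rw [mul_assoc 4, mul_div_assoc 4]
    linarith
  have s10 := mul_le_mul_of_nonneg_left s9 (show 0 ≤ D ^ 2 / 2 by positivity)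
  linarith

theorem HistLaw.updSq_moment (hH : HistLaw M π ψ lam B s₁ n H)
    (h : StabilityAssumption M π μ ψ ρ f₁ f₂ f₃) (h0 : 0 ≤ lam) (h1 : lam < 1)
    (hB : f₃ s₁ ≤ B) {F₃ : ℝ} (hF : B ≤ F₃) (hD : 0 ≤ D) (x : List (S × A) × S → Iter d)
    (hx : ∀ p, H p ≠ 0 → ‖x p‖ ≤ D / 2) :
    ExpectLE (pairLaw M π H) (fun j => updSq cα (M.reward j.1.2 j.2.1) (ψ j.1.2) (ψ j.2.2)
      (lam • histTrace lam ψ j.1.1 + ψ j.1.2) (x j.1))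
      (2 * bhat lam cα F₃ + D ^ 2 / 2 * That lam cα F₃) := by
  have mR := hH.reward_fourth h
  have mz := hH.trace_fourth h h0 h1 hB
  have md := hH.feature_diff_fourth h
  have mR2 := mR.sq_of_fourth
  have mz2 := mz.sq_of_fourth
  have mRz := mR.mul_of_fourth mz
  have mdz := md.mul_of_fourth mz
  rw [sqrt_div_pow_four] at mz2 mRz mdz
  have key := ((mR2.const_mul (c := 2 * cα ^ 2) (by positivity)).add
    (mRz.const_mul zero_le_two)).add
    ((((ExpectLE.const (pairLaw M π H) (cα ^ 2)).add mz2).add mdz).const_mul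
      (c := D ^ 2 / 2) (by positivity))
  refine ExpectLE.mono_const (ExpectLE.mono key (fun _ => updSq_nonneg _ _ _ _ _ _)
    fun j hj => ?_) (updSq_const_le (by linarith) (h.f₃_nonneg s₁) hB hF rfl)
  have hp : H j.1 ≠ 0 := by
    rw [← pairLaw_fst (M := M) (π := π) (H := H), ← PMF.mem_support_iff,
      PMF.mem_support_map_iff]
    exact ⟨j, hj, rfl⟩
  exact updSq_le hD (hx _ hp)

theorem HistLaw.f₁_sq (hH : HistLaw M π ψ lam B s₁ n H)
    (h : StabilityAssumption M π μ ψ ρ f₁ f₂ f₃) :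
    ExpectLE H (fun p => f₁ p.2 ^ 2) (√(f₂ s₁)) :=
  (hH.of_state (f := fun s => f₁ s ^ 4) (fun s => by positivity) (h.f₁_moment s₁ n)).sq_of_fourth

/-- The square of a sum of three terms is at most three times the sum of squares, and the product of
trace and f₁ is handled by Cauchy–Schwarz on fourth moments. These three terms are dominated one by
one by the first three of `ghat`; the last one is only used as nonnegative. -/
theorem HistLaw.solSize_sq (hH : HistLaw M π ψ lam B s₁ n H)
    (h : StabilityAssumption M π μ ψ ρ f₁ f₂ f₃) (h0 : 0 ≤ lam) (h1 : lam < 1)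
    (hB : B = ‖ψ s₀‖ ^ 4 + f₃ s₁) (ψhat ψ' rhat : ℝ) (hψ : 0 ≤ ψhat) :
    ExpectLE H (fun p => solSize lam ρ f₁ (histTrace lam ψ p.1) p.2 ^ 2)
      (ghat d lam ρ ψhat ψ' rhat ‖ψ s₀‖ (f₂ s₀ + f₂ s₁) (f₂ s₁) (f₃ s₁)) := by
  have hl : 0 < 1 - lam := by linarith
  have hr : 0 < 1 - ρ := by linarith [h.rho_lt_one]
  have hρ := h.rho_pos
  have hlr := h.one_sub_mul_pos h0 h1
  have m1 := hH.f₁_sq h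
  have m2 := hH.trace_moment.sq_of_fourth
  have m3 := hH.trace_moment.mul_of_fourth
    (hH.of_state (f := fun s => f₁ s ^ 4) (fun s => by positivity) (h.f₁_moment s₁ n))
  rw [sqrt_div_pow_four] at m2 m3
  have key := ((m1.const_mul (c := 3 / ((1 - lam) * (1 - ρ)) ^ 2) (by positivity)).add
    (m3.const_mul (c := 3 / (1 - lam * ρ) ^ 2) (by positivity))).add
    (m2.const_mul (c := 3 / (1 - lam) ^ 2) (by positivity))
  refine (key.mono (fun _ => sq_nonneg _) fun p _ => ?_).mono_const ?_
  · unfold solSize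
    set x := f₁ p.2 / ((1 - lam) * (1 - ρ)) with hx
    set y := ‖histTrace lam ψ p.1‖ * f₁ p.2 / (1 - lam * ρ) with hy
    set w := ‖histTrace lam ψ p.1‖ / (1 - lam) with hw
    have e1 : 3 / ((1 - lam) * (1 - ρ)) ^ 2 * f₁ p.2 ^ 2 = 3 * x ^ 2 := by
      rw [hx, div_pow]; ring
    have e2 : 3 / (1 - lam * ρ) ^ 2 * (‖histTrace lam ψ p.1‖ ^ 2 * f₁ p.2 ^ 2) = 3 * y ^ 2 := by
      rw [hy, div_pow]; ring
    have e3 : 3 / (1 - lam) ^ 2 * ‖histTrace lam ψ p.1‖ ^ 2 = 3 * w ^ 2 := by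
      rw [hw, div_pow]; ring
    rw [e1, e2, e3]
    nlinarith [sq_nonneg (x - y), sq_nonneg (y - w), sq_nonneg (x - w)]
  · unfold ghat
    rw [← hB]
    have hs1 := Real.sqrt_nonneg (f₂ s₁)
    have hsB := Real.sqrt_nonneg B
    have hF2 : √(f₂ s₁) ≤ √(f₂ s₀ + f₂ s₁) :=
      Real.sqrt_le_sqrt (le_add_of_nonneg_left (h.f₂_nonneg s₀))
    have hρ2 : ρ ^ 2 ≤ 1 := pow_le_one₀ hρ.le h.rho_lt_one.le
    have t1 : 3 / ((1 - lam) * (1 - ρ)) ^ 2 * √(f₂ s₁)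
        ≤ 4 * √(f₂ s₁) / (ρ ^ 2 * (1 - lam) ^ 2 * (1 - ρ) ^ 2) := by
      have e : 3 / ((1 - lam) * (1 - ρ)) ^ 2 * √(f₂ s₁)
          = 3 * √(f₂ s₁) / (1 * ((1 - lam) ^ 2 * (1 - ρ) ^ 2)) := by ring
      rw [e, mul_assoc (ρ ^ 2)]
      refine div_le_div₀ (by positivity) (by linarith) (by positivity) ?_
      exact mul_le_mul_of_nonneg_right hρ2 (by positivity)
    have t2 : 3 / (1 - lam * ρ) ^ 2 * (√B / (1 - lam) ^ 2 * √(f₂ s₁))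
        ≤ 16 * √B * √(f₂ s₀ + f₂ s₁) / (ρ ^ 2 * (1 - lam * ρ) ^ 2 * (1 - lam) ^ 2) := by
      have e : 3 / (1 - lam * ρ) ^ 2 * (√B / (1 - lam) ^ 2 * √(f₂ s₁))
          = 3 * √B * √(f₂ s₁) / (1 * ((1 - lam * ρ) ^ 2 * (1 - lam) ^ 2)) := by field_simp
      rw [e, mul_assoc (ρ ^ 2)]
      refine div_le_div₀ (by positivity) ?_ (by positivity) ?_
      · refine mul_le_mul (by linarith) hF2 hs1 (by positivity)
      · exact mul_le_mul_of_nonneg_right hρ2 (by positivity)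
    have t3 : 3 / (1 - lam) ^ 2 * (√B / (1 - lam) ^ 2)
        ≤ 4 * (1 + √rhat + ψhat * √(d : ℝ)) ^ 2 * √B / (1 - lam) ^ 4 := by
      have e : 3 / (1 - lam) ^ 2 * (√B / (1 - lam) ^ 2) = 3 * 1 * √B / (1 - lam) ^ 4 := by
        field_simp
      rw [e]
      refine div_le_div_of_nonneg_right (mul_le_mul_of_nonneg_right ?_ hsB) (by positivity)
      have : 1 ≤ (1 + √rhat + ψhat * √(d : ℝ)) ^ 2 := by
        refine one_le_pow₀ ?_
        have : 0 ≤ √rhat + ψhat * √(d : ℝ) := by positivity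
        linarith
      linarith
    have t4 : 0 ≤ 4 * (ψhat * √(d : ℝ) + ψ' + ψhat * √rhat * √(d : ℝ)) ^ 2 / (1 - lam) ^ 4 := by
      positivity
    linarith

end Recursion

end AvgTD

end

open scoped ENNReal

noncomputable section

namespace AvgTD

/-! ### Recursion for the expected Lyapunov function -/

section ErrorRecursion

variable {S A : Type*} {d : ℕ} {M : MDP S A} {π : S → PMF A} {μ : PMF S} {ψ : S → Vec d}
  {ρ lam a b rhat ψhat cα D α B g F : ℝ} {f₁ f₂ f₃ : S → ℝ} {θstar : Vec d}
  {s₀ s₁ : S} {n : ℕ} {H : PMF (List (S × A) × S)}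

/-- The square of three summands gives the factor 3, and 243/4 = 3·(9/2)². -/
theorem expectLE_lipSize_sq (hf : ExpectLE H (fun p => f₁ p.2 ^ 2) F)
    (hg : ExpectLE H (fun p => solSize lam ρ f₁ (histTrace lam ψ p.1) p.2 ^ 2) g) :
    ExpectLE H (fun p => lipSize lam ρ cα D f₁ (histTrace lam ψ p.1) p.2 ^ 2)
      (3 * (cα ^ 2 * F / (1 - ρ) ^ 2) + (243 / 4 * D ^ 2 + 3) * g) := by
  have key := (hf.const_mul (c := 3 * (cα ^ 2 / (1 - ρ) ^ 2)) (by positivity)).add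
    (hg.const_mul (c := 243 / 4 * D ^ 2 + 3) (by positivity))
  refine (key.mono (fun _ => sq_nonneg _) fun p _ => ?_).mono_const (le_of_eq (by ring))
  unfold lipSize
  set y := solSize lam ρ f₁ (histTrace lam ψ p.1) p.2
  set u := cα * (f₁ p.2 / (1 - ρ)) with hu
  have e : 3 * (cα ^ 2 / (1 - ρ) ^ 2) * f₁ p.2 ^ 2 = 3 * u ^ 2 := by
    rw [hu, mul_pow, div_pow]; ring
  rw [e]
  nlinarith [sq_nonneg (u - 9 / 2 * D * y), sq_nonneg (u - y), sq_nonneg (9 / 2 * D * y - y)]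

/-- Each of the three products in `crossSize` is split by Young's inequality with D²/2 on one side,
whence 3D²/2 in total. -/
theorem expectLE_crossSize (hD : 0 ≤ D) (hcα : 0 ≤ cα) (hρ : ρ < 1) (hf0 : ∀ s, 0 ≤ f₁ s)
    (hs : ∀ z s, 0 ≤ solSize lam ρ f₁ (z : Vec d) s) (hf : ExpectLE H (fun p => f₁ p.2 ^ 2) F)
    (hg : ExpectLE H (fun p => solSize lam ρ f₁ (histTrace lam ψ p.1) p.2 ^ 2) g) :
    ExpectLE H (fun p => crossSize lam ρ cα D f₁ (histTrace lam ψ p.1) p.2)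
      (3 / 2 * D ^ 2 + 2 * (cα ^ 2 * F / (1 - ρ) ^ 2) + (9 / 2 * D ^ 2 + 2) * g) := by
  have hr : 0 < 1 - ρ := by linarith
  have key := ((ExpectLE.const H (3 / 2 * D ^ 2)).add
    (hf.const_mul (c := 2 * (cα ^ 2 / (1 - ρ) ^ 2)) (by positivity))).add
    (hg.const_mul (c := 9 / 2 * D ^ 2 + 2) (by positivity))
  refine (key.mono (fun p => ?_) fun p _ => ?_).mono_const (le_of_eq (by ring))
  · have := hf0 p.2
    have := hs (histTrace lam ψ p.1) p.2
    unfold crossSize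
    positivity
  · unfold crossSize
    set y := solSize lam ρ f₁ (histTrace lam ψ p.1) p.2
    set u := cα * (f₁ p.2 / (1 - ρ)) with hu
    have e : 2 * (cα ^ 2 / (1 - ρ) ^ 2) * f₁ p.2 ^ 2 = 2 * u ^ 2 := by
      rw [hu, mul_pow, div_pow]; ring
    rw [e]
    nlinarith [sq_nonneg (D - 2 * u), sq_nonneg (D - 3 * D * y), sq_nonneg (D - 2 * y)]

theorem abs_first_order_le {R r : ℝ} {v v' z : Vec d} {x : Iter d} (hpt : ‖pt r θstar‖ ≤ D / 2)
    (hx : ‖x‖ ≤ D / 2) :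
    |2 * ((x.fst - r) * (cα * (R - x.fst)) + tdErr R v v' x * inner ℝ (x.snd - θstar) z)|
      ≤ 2 * D ^ 2 + updSq cα R v v' z x := by
  obtain ⟨hu, hv⟩ := norm_error_le hpt hx
  have hD : 0 ≤ D := by linarith [norm_nonneg x]
  have h1 : |(x.fst - r) * (cα * (R - x.fst))| ≤ D * |cα * (R - x.fst)| := by
    rw [abs_mul]
    exact mul_le_mul_of_nonneg_right hu (abs_nonneg _)
  have h2 : |tdErr R v v' x * inner ℝ (x.snd - θstar) z| ≤ |tdErr R v v' x| * (D * ‖z‖) := by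
    rw [abs_mul]
    exact mul_le_mul_of_nonneg_left ((abs_real_inner_le_norm _ _).trans
      (mul_le_mul_of_nonneg_right hv (norm_nonneg _))) (abs_nonneg _)
  rw [abs_mul, abs_two]
  have h3 := abs_add_le ((x.fst - r) * (cα * (R - x.fst)))
    (tdErr R v v' x * inner ℝ (x.snd - θstar) z)
  have h4 : |cα * (R - x.fst)| ^ 2 = cα ^ 2 * (R - x.fst) ^ 2 := by rw [sq_abs, mul_pow]
  have h5 : (|tdErr R v v' x| * ‖z‖) ^ 2 = tdErr R v v' x ^ 2 * ‖z‖ ^ 2 := by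
    rw [mul_pow, sq_abs]
  unfold updSq
  nlinarith [sq_nonneg (D - |cα * (R - x.fst)|), sq_nonneg (D - |tdErr R v v' x| * ‖z‖)]

theorem sqErr_le_sq {r : ℝ} {x : Iter d} (hpt : ‖pt r θstar‖ ≤ D / 2) (hx : ‖x‖ ≤ D / 2) :
    sqErr r θstar x ≤ D ^ 2 := by
  rw [sqErr_eq]
  exact pow_le_pow_left₀ (norm_nonneg _) (by linarith [norm_sub_le x (pt r θstar)]) 2

theorem sqErr_nonneg (r : ℝ) (θ : Vec d) (x : Iter d) : 0 ≤ sqErr r θ x := by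
  rw [sqErr_eq]; positivity

theorem intg_sqErr {r : ℝ} (hpt : ‖pt r θstar‖ ≤ D / 2) {x : List (S × A) × S → Iter d}
    (hx : ∀ p, H p ≠ 0 → ‖x p‖ ≤ D / 2) : Intg H (fun p => sqErr r θstar (x p)) :=
  Intg.bounded (D ^ 2) fun p hp => by
    rw [Real.norm_of_nonneg (sqErr_nonneg _ _ _)]
    exact sqErr_le_sq hpt (hx p hp)

theorem intg_crossTerm [Finite A] (h : StabilityAssumption M π μ ψ ρ f₁ f₂ f₃)
    (hμ : SecondMoments M π ψ μ a b) (h0 : 0 ≤ lam) (h1 : lam < 1) (hcα : 0 ≤ cα)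
    (hpt : ‖pt (rbar M π μ) θstar‖ ≤ D / 2) {x : List (S × A) × S → Iter d}
    (hx : ∀ p, H p ≠ 0 → ‖x p‖ ≤ D / 2) {c : ℝ}
    (hc : ExpectLE H (fun p => crossSize lam ρ cα D f₁ (histTrace lam ψ p.1) p.2) c)
    (hc0 : ∀ p : List (S × A) × S, 0 ≤ crossSize lam ρ cα D f₁ (histTrace lam ψ p.1) p.2) :
    (Intg H fun p => crossTerm M π μ ψ lam cα θstar (x p) (histTrace lam ψ p.1) p.2) ∧
      |expect H fun p => crossTerm M π μ ψ lam cα θstar (x p) (histTrace lam ψ p.1) p.2| ≤ c := by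
  have hle : ∀ p, H p ≠ 0 → |crossTerm M π μ ψ lam cα θstar (x p) (histTrace lam ψ p.1) p.2|
      ≤ crossSize lam ρ cα D f₁ (histTrace lam ψ p.1) p.2 := fun p hp =>
    abs_crossTerm_le h hμ h0 h1 hcα hpt (hx p hp) _ _
  have hi : Intg H fun p => crossTerm M π μ ψ lam cα θstar (x p) (histTrace lam ψ p.1) p.2 :=
    (hc.intg hc0).mono fun p hp => (hle p hp).trans (le_abs_self _)
  refine ⟨hi, ?_⟩
  have h2 := norm_expect_le hi
  exact h2.trans ((expect_mono hi.norm (hc.intg hc0) hle).trans hc.2)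

theorem pairLaw_support {j : (List (S × A) × S) × (A × S)} (hj : pairLaw M π H j ≠ 0) :
    H j.1 ≠ 0 := by
  rw [← pairLaw_fst (M := M) (π := π) (H := H), ← PMF.mem_support_iff, PMF.mem_support_map_iff]
  exact ⟨j, hj, rfl⟩

theorem crossSize_nonneg (h : StabilityAssumption M π μ ψ ρ f₁ f₂ f₃) (h0 : 0 ≤ lam)
    (h1 : lam < 1) (hcα : 0 ≤ cα) (hD : 0 ≤ D) (z : Vec d) (s : S) :
    0 ≤ crossSize lam ρ cα D f₁ z s := by
  have := h.f₁_nonneg s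
  have := solSize_nonneg h h0 h1 z s
  have : 0 < 1 - ρ := by linarith [h.rho_lt_one]
  unfold crossSize
  positivity

theorem expect_pairLaw {f : (List (S × A) × S) × (A × S) → ℝ} (hf : Intg (pairLaw M π H) f) :
    expect (pairLaw M π H) f
      = expect H fun p => expect (stepAction M π p.2) fun q => f (p, q) := by
  rw [pairLaw, expect_bind hf]
  refine expect_congr fun p hp => ?_
  exact expect_map (intg_map.1 (hf.of_bind hp))

theorem pairLaw_of_fst {f : List (S × A) × S → ℝ} (hf : Intg H f) :
    (Intg (pairLaw M π H) fun j => f j.1) ∧ expect (pairLaw M π H) (fun j => f j.1)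
      = expect H f := by
  rw [← pairLaw_fst (M := M) (π := π) (H := H)] at hf
  have hi := intg_map.1 hf
  exact ⟨hi, by rw [← expect_map hi, pairLaw_fst]⟩

theorem pairLaw_of_extend {f : List (S × A) × S → ℝ} (hf : Intg (H.bind (histStep M π)) f) :
    (Intg (pairLaw M π H) fun j => f (extendHist j.1 j.2)) ∧
      expect (H.bind (histStep M π)) f
        = expect (pairLaw M π H) fun j => f (extendHist j.1 j.2) := by
  rw [← pairLaw_extend] at hf ⊢
  have hi := intg_map.1 hf
  exact ⟨hi, expect_map hi⟩

/-- One step of the recursion of the expected Lyapunov function. -/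
theorem HistLaw.lyapunov_expect_le [Finite A] (hc : ChainAssumption M π μ rhat)
    (hf : FeatureAssumption μ ψ ψhat)
    (h : StabilityAssumption M π μ ψ ρ f₁ f₂ f₃) (h0 : 0 ≤ lam) (h1 : lam < 1)
    (hne : (constSpace ψ)ᗮ ≠ ⊥) (hcα : cThreshold d lam ψhat (drift M π μ ψ lam) ≤ cα)
    (hcα0 : 0 ≤ cα) (hstar : IsTDSolution M π μ ψ lam θstar)
    (hpt : ‖pt (rbar M π μ) θstar‖ ≤ D / 2) (hα : 0 ≤ α)
    (hH : HistLaw M π ψ lam B s₁ n H) (hB : f₃ s₁ ≤ B) {F₃ : ℝ} (hF : B ≤ F₃)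
    (hg : ∀ {n : ℕ} {H : PMF (List (S × A) × S)}, HistLaw M π ψ lam B s₁ n H →
      ExpectLE H (fun p => solSize lam ρ f₁ (histTrace lam ψ p.1) p.2 ^ 2) g)
    {x : List (S × A) × S → Iter d} (hx : ∀ p, H p ≠ 0 → ‖x p‖ ≤ D / 2)
    (hθ : ∀ p, (x p).snd ∈ (constSpace ψ)ᗮ)
    (hstep : ∀ p q, H p ≠ 0 → x (extendHist p q) = tdStep (constSpace ψ) cα (D / 2) α
      (M.reward p.2 q.1) (ψ p.2) (ψ q.2) (lam • histTrace lam ψ p.1 + ψ p.2) (x p)) :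
    expect (H.bind (histStep M π)) (fun p => sqErr (rbar M π μ) θstar (x p))
        + α * expect (H.bind (histStep M π)) (fun p =>
          crossTerm M π μ ψ lam cα θstar (x p) (histTrace lam ψ p.1) p.2)
      ≤ (1 - drift M π μ ψ lam * α) * expect H (fun p => sqErr (rbar M π μ) θstar (x p))
        + α * expect H (fun p => crossTerm M π μ ψ lam cα θstar (x p) (histTrace lam ψ p.1) p.2)
        + α ^ 2 * (2 * (2 * bhat lam cα F₃ + D ^ 2 / 2 * That lam cα F₃)
          + (3 * (cα ^ 2 * √(f₂ s₁) / (1 - ρ) ^ 2) + (243 / 4 * D ^ 2 + 3) * g)) := by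
  have hμ := stationary_secondMoments hc hf
  have hD : 0 ≤ D := by linarith [norm_nonneg (pt (rbar M π μ) θstar)]
  have hH' := hH.next h h0 h1 hB
  have cross0 := fun p : List (S × A) × S =>
    crossSize_nonneg h h0 h1 hcα0 hD (histTrace lam ψ p.1) p.2
  have cH := expectLE_crossSize hD hcα0 h.rho_lt_one h.f₁_nonneg (solSize_nonneg h h0 h1)
    (hH.f₁_sq h) (hg hH)
  have cH' := expectLE_crossSize hD hcα0 h.rho_lt_one h.f₁_nonneg (solSize_nonneg h h0 h1)
    (hH'.f₁_sq h) (hg hH')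
  have lH' := expectLE_lipSize_sq (cα := cα) (D := D) (hH'.f₁_sq h) (hg hH')
  -- No moment argument is needed: every transition ends with the projection onto the ball.
  have hx' : ∀ p, (H.bind (histStep M π)) p ≠ 0 → ‖x p‖ ≤ D / 2 := fun p hp => by
    obtain ⟨p', hp', h2⟩ := (PMF.mem_support_bind_iff _ _ _).1 hp
    obtain ⟨q, -, rfl⟩ := (PMF.mem_support_map_iff _ _ _).1 h2
    rw [hstep _ _ hp']
    exact norm_tdStep_le (by linarith) _ _ _ _ _
  obtain ⟨iW, -⟩ := intg_crossTerm h hμ h0 h1 hcα0 hpt hx cH cross0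
  obtain ⟨iW', -⟩ := intg_crossTerm h hμ h0 h1 hcα0 hpt hx' cH' cross0
  have iE := intg_sqErr hpt hx
  have iE' := intg_sqErr hpt hx'
  have upd := hH.updSq_moment (cα := cα) h h0 h1 hB hF hD x hx
  have iU := upd.intg fun _ => updSq_nonneg _ _ _ _ _ _
  rw [← pairLaw_extend] at cH' lH'
  have lJ := lH'.of_map fun p => sq_nonneg _
  have iL := lJ.intg fun _ => sq_nonneg _
  have iC := (cH'.of_map cross0).intg fun j => cross0 _
  have htr : ∀ j : (List (S × A) × S) × (A × S), histTrace lam ψ (extendHist j.1 j.2).1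
      = lam • histTrace lam ψ j.1.1 + ψ j.1.2 := fun j => rfl
  have hsn : ∀ j : (List (S × A) × S) × (A × S), (extendHist j.1 j.2).2 = j.2.2 := fun j => rfl
  simp only [htr, hsn] at iL iC lJ
  set J := pairLaw M π H with hJ
  -- The first-order part of the step, with the iterate frozen in the cross term at the next state;
  -- this freezing is what makes the Poisson equation applicable.
  set F₁ : (List (S × A) × S) × (A × S) → ℝ := fun j =>
    2 * (((x j.1).fst - rbar M π μ) * (cα * (M.reward j.1.2 j.2.1 - (x j.1).fst))
      + tdErr (M.reward j.1.2 j.2.1) (ψ j.1.2) (ψ j.2.2) (x j.1)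
        * inner ℝ ((x j.1).snd - θstar) (lam • histTrace lam ψ j.1.1 + ψ j.1.2))
    + crossTerm M π μ ψ lam cα θstar (x j.1) (lam • histTrace lam ψ j.1.1 + ψ j.1.2) j.2.2
    with hF₁
  have iF : Intg J F₁ := by
    refine (((Intg.const J (2 * D ^ 2)).add iU).mono fun j hj => ?_).add
      (iC.mono fun j hj => ?_)
    · exact (abs_first_order_le hpt (hx _ (pairLaw_support hj))).trans (le_abs_self _)
    · exact (abs_crossTerm_le h hμ h0 h1 hcα0 hpt (hx _ (pairLaw_support hj)) _ _).trans
        (le_abs_self _)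
  have eF : expect J F₁ = expect H fun p => expect (stepAction M π p.2) fun q => F₁ (p, q) :=
    expect_pairLaw iF
  have iF' : Intg H fun p => expect (stepAction M π p.2) fun q => F₁ (p, q) := by
    refine (Intg.expect_of_bind iF).mono fun p hp => le_of_eq ?_
    rw [expect_map (intg_map.1 (Intg.of_bind iF hp))]
  have lF : expect J F₁ ≤ expect H (fun p =>
      crossTerm M π μ ψ lam cα θstar (x p) (histTrace lam ψ p.1) p.2)
      - drift M π μ ψ lam * expect H (fun p => sqErr (rbar M π μ) θstar (x p)) := by
    rw [eF, ← expect_const_mul iE, ← expect_sub iW (iE.const_mul _)]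
    refine expect_mono iF' (iW.sub (iE.const_mul _)) fun p _ => ?_
    -- The noise is replaced by the current cross term, and the remaining mean drift, doubled,
    -- contracts at rate 2·Δ/2 = Δ.
    rw [hF₁, expect_first_order h hμ h0 h1 θstar (x p) (histTrace lam ψ p.1) p.2]
    have := mean_drift_le hc hf h h0 h1 hne hcα hstar (hθ p) (x p).fst
    unfold sqErr
    linarith
  obtain ⟨iEJ, eEJ⟩ := pairLaw_of_fst (M := M) (π := π) iE
  rw [← expect_const_mul iW', ← expect_add iE' (iW'.const_mul α)]
  have iS := iE'.add (iW'.const_mul α)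
  obtain ⟨iS', eS⟩ := pairLaw_of_extend iS
  rw [eS]
  have iQ := (iU.const_mul 2).add iL
  have key : expect J (fun j => sqErr (rbar M π μ) θstar (x (extendHist j.1 j.2))
        + α * crossTerm M π μ ψ lam cα θstar (x (extendHist j.1 j.2))
          (lam • histTrace lam ψ j.1.1 + ψ j.1.2) j.2.2)
      ≤ expect J fun j => sqErr (rbar M π μ) θstar (x j.1) + α * F₁ j
        + α ^ 2 * (2 * updSq cα (M.reward j.1.2 j.2.1) (ψ j.1.2) (ψ j.2.2)
          (lam • histTrace lam ψ j.1.1 + ψ j.1.2) (x j.1)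
          + lipSize lam ρ cα D f₁ (lam • histTrace lam ψ j.1.1 + ψ j.1.2) j.2.2 ^ 2) := by
    refine expect_mono iS' ((iEJ.add (iF.const_mul α)).add (iQ.const_mul _)) fun j hj => ?_
    exact lyapunov_step_le h hμ h0 h1 hcα0 hα hpt (hx _ (pairLaw_support hj))
      (Submodule.sub_mem _ (hθ _) hstar.1) _ _ _ _ (hstep _ _ (pairLaw_support hj))
  refine key.trans ?_
  rw [expect_add (iEJ.add (iF.const_mul α)) (iQ.const_mul _), expect_add iEJ (iF.const_mul α),
    expect_const_mul iF, expect_const_mul iQ, expect_add (iU.const_mul 2) iL,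
    expect_const_mul iU, eEJ]
  have t1 := mul_le_mul_of_nonneg_left lF hα
  have t2 := mul_le_mul_of_nonneg_left
    (add_le_add (mul_le_mul_of_nonneg_left upd.2 zero_le_two) lJ.2) (sq_nonneg α)
  linarith

/-- Everything that the recursion produces is dominated by the single constant C. The factor 27/4 is
(243/4)/9, since C contains 9gD². The two maxima with 1 give 2D² ≤ C, and Δ ≤ c_α gives Δ²D² ≤ C
through c_α² ≤ `That`. -/
theorem CV_bounds (h : StabilityAssumption M π μ ψ ρ f₁ f₂ f₃) (h1 : lam < 1) {Δ : ℝ}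
    (hΔ : 0 ≤ Δ) (hΔc : Δ ≤ cα) (xn : ℝ) (s₀ s₁ : S)
    (hg : g = ghat d lam ρ ψhat (psiPrime M π μ ψ) rhat ‖ψ s₀‖ (f₂ s₀ + f₂ s₁) (f₂ s₁) (f₃ s₁))
    (hg0 : 0 ≤ g) {C : ℝ} (hC : C = CV M π μ ψ lam cα rhat ψhat ρ f₂ f₃ D xn s₀ s₁) :
    2 * (2 * bhat lam cα (f₃ s₀ + f₃ s₁) + D ^ 2 / 2 * That lam cα (f₃ s₀ + f₃ s₁))
        + (3 * (cα ^ 2 * √(f₂ s₁) / (1 - ρ) ^ 2) + (243 / 4 * D ^ 2 + 3) * g) ≤ 27 / 4 * C ∧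
      3 / 2 * D ^ 2 + 2 * (cα ^ 2 * √(f₂ s₁) / (1 - ρ) ^ 2) + (9 / 2 * D ^ 2 + 2) * g ≤ C ∧
      2 * D ^ 2 ≤ C ∧ Δ ^ 2 * D ^ 2 ≤ C := by
  have hl : 0 < 1 - lam := by linarith
  have hr : 0 < 1 - ρ := by linarith [h.rho_lt_one]
  have e₀ := h.f₃_nonneg s₀
  have e₁ := h.f₃_nonneg s₁
  have hc1 : cα ^ 2 * √(f₂ s₁) / (1 - ρ) ^ 2 ≤ cα ^ 2 * √(f₂ s₀ + f₂ s₁) / (1 - ρ) ^ 2 := by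
    gcongr
    linarith [h.f₂_nonneg s₀]
  have hc2 : 0 ≤ cα ^ 2 * √(f₂ s₁) / (1 - ρ) ^ 2 := by positivity
  have hb : 0 ≤ bhat lam cα (f₃ s₀ + f₃ s₁) := by unfold bhat; positivity
  have hT : Δ ^ 2 ≤ That lam cα (f₃ s₀ + f₃ s₁) := by
    have h2 : Δ ^ 2 ≤ cα ^ 2 := pow_le_pow_left₀ hΔ hΔc 2
    have h3 : 0 ≤ √(f₃ s₀ + f₃ s₁) / (1 - lam) ^ 2 + 4 * (f₃ s₀ + f₃ s₁) / (1 - lam) ^ 2 := by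
      positivity
    unfold That
    linarith
  have hC2 : C = Ahat (That lam cα (f₃ s₀ + f₃ s₁)) g * D ^ 2
      + Bhat (That lam cα (f₃ s₀ + f₃ s₁)) g (bhat lam cα (f₃ s₀ + f₃ s₁)) ρ cα xn
        (f₂ s₀ + f₂ s₁) := by rw [hC, hg]; rfl
  have e3 : 16 * cα ^ 2 * √(f₂ s₀ + f₂ s₁) / (1 - ρ) ^ 2
      = 16 * (cα ^ 2 * √(f₂ s₀ + f₂ s₁) / (1 - ρ) ^ 2) := by ring
  unfold Ahat Bhat at hC2
  rw [e3] at hC2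
  set T := That lam cα (f₃ s₀ + f₃ s₁)
  set bb := bhat lam cα (f₃ s₀ + f₃ s₁)
  set c1 := cα ^ 2 * √(f₂ s₁) / (1 - ρ) ^ 2
  set c2 := cα ^ 2 * √(f₂ s₀ + f₂ s₁) / (1 - ρ) ^ 2
  have hT0 : 0 ≤ T := (sq_nonneg Δ).trans hT
  have m1 : T * D ^ 2 ≤ max T 1 * D ^ 2 :=
    mul_le_mul_of_nonneg_right (le_max_left _ _) (sq_nonneg D)
  have m2 : 1 * D ^ 2 ≤ max T 1 * D ^ 2 :=
    mul_le_mul_of_nonneg_right (le_max_right _ _) (sq_nonneg D)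
  have m3 : 9 * g * D ^ 2 ≤ max (9 * g) 1 * D ^ 2 :=
    mul_le_mul_of_nonneg_right (le_max_left _ _) (sq_nonneg D)
  have m4 : 1 * D ^ 2 ≤ max (9 * g) 1 * D ^ 2 :=
    mul_le_mul_of_nonneg_right (le_max_right _ _) (sq_nonneg D)
  have m5 : Δ ^ 2 * D ^ 2 ≤ T * D ^ 2 := mul_le_mul_of_nonneg_right hT (sq_nonneg D)
  have q1 : 0 ≤ T * xn ^ 2 := by positivity
  have q2 : 0 ≤ xn ^ 2 * g := by positivity
  have q3 : 0 ≤ D ^ 2 * g := by positivity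
  have q4 : 0 ≤ T * D ^ 2 := by positivity
  have q5 : 0 ≤ D ^ 2 := sq_nonneg D
  refine ⟨?_, ?_, ?_, ?_⟩ <;> nlinarith

theorem feature_fourth_le (h : StabilityAssumption M π μ ψ ρ f₁ f₂ f₃) (s : S) :
    ‖ψ s‖ ^ 4 ≤ f₃ s := by
  have := (h.feature_moment s 0).2
  rwa [stateLaw_zero, expect_pure] at this

theorem histIter_snd_mem {x₀ : Iter d} {radius : ℝ} (hx₀ : x₀.snd ∈ (constSpace ψ)ᗮ)
    (σ : ℕ → ℝ) (l : List (S × A)) (s : S) :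
    (histIter M ψ lam cα radius σ x₀ l s).snd ∈ (constSpace ψ)ᗮ := by
  induction l generalizing s with
  | nil => exact hx₀
  | cons q l ih => exact tdStep_snd_mem _ _ _ _ (ih _)

/-- The recursion satisfied by the expected squared errors `err n` and the expected cross
terms `cross n`. -/
theorem exists_error_recursion [Finite A] (hc : ChainAssumption M π μ rhat)
    (hf : FeatureAssumption μ ψ ψhat)
    (h : StabilityAssumption M π μ ψ ρ f₁ f₂ f₃) (h0 : 0 ≤ lam) (h1 : lam < 1)
    (hne : (constSpace ψ)ᗮ ≠ ⊥) (hcα : cThreshold d lam ψhat (drift M π μ ψ lam) ≤ cα)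
    (hstar : IsTDSolution M π μ ψ lam θstar)
    (hpt : ‖pt (rbar M π μ) θstar‖ ≤ D / 2) {x₀ : Iter d} (hx₀ : x₀.snd ∈ (constSpace ψ)ᗮ)
    {H : ℕ → PMF (List (S × A) × S)}
    (hH1 : ∀ p, H 1 p ≠ 0 → p.2 = s₁ ∧ ∃ a, p.1 = [(s₀, a)])
    (hHs : ∀ k ≥ 1, H (k + 1) = (H k).bind (histStep M π)) (xn : ℝ)
    {C : ℝ} (hC : C = CV M π μ ψ lam cα rhat ψhat ρ f₂ f₃ D xn s₀ s₁)
    {σ : ℕ → ℝ} (hσ : ∀ n, 0 ≤ σ n) :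
    2 * D ^ 2 ≤ C ∧ drift M π μ ψ lam ^ 2 * D ^ 2 ≤ C ∧ ∃ err cross : ℕ → ℝ,
      (∀ n, ExpectLE (H (n + 1)) (fun p => sqErr (rbar M π μ) θstar
        (histIter M ψ lam cα (D / 2) σ x₀ p.1 p.2)) (err n)) ∧
      (∀ n, 0 ≤ err n) ∧ (∀ n, err n ≤ D ^ 2) ∧ (∀ n, |cross n| ≤ C) ∧
      ∀ n, err (n + 1) + σ (n + 1) * cross (n + 1)
        ≤ (1 - drift M π μ ψ lam * σ (n + 1)) * err n + σ (n + 1) * cross n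
          + σ (n + 1) ^ 2 * (27 / 4 * C) := by
  have hμ := stationary_secondMoments hc hf
  have hD : 0 ≤ D := by linarith [norm_nonneg (pt (rbar M π μ) θstar)]
  have hΔ := (drift_isLeast hc hf h h0 h1 hne).2
  have hΔc := (cThreshold_bound hΔ h1 hcα).1
  have hcα0 : 0 ≤ cα := hΔ.le.trans hΔc
  have hb0 := feature_fourth_le h s₀
  have hlaw : ∀ n, HistLaw M π ψ lam (‖ψ s₀‖ ^ 4 + f₃ s₁) s₁ n (H (n + 1)) := by
    intro n
    induction n with
    | zero => exact HistLaw.init h0 h1 (le_add_of_nonneg_right (h.f₃_nonneg s₁)) hH1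
    | succ n ih =>
      rw [hHs (n + 1) (Nat.le_add_left 1 n)]
      exact ih.next h h0 h1 (le_add_of_nonneg_left (by positivity))
  have hg : ∀ {n : ℕ} {H : PMF (List (S × A) × S)},
      HistLaw M π ψ lam (‖ψ s₀‖ ^ 4 + f₃ s₁) s₁ n H → _ := fun hH =>
    hH.solSize_sq h h0 h1 rfl ψhat (psiPrime M π μ ψ) rhat hf.ψhat_nonneg
  have hg0 := (hg (hlaw 0)).nonneg fun _ => sq_nonneg _
  obtain ⟨b1, b2, b3, b4⟩ := CV_bounds (D := D) h h1 hΔ.le hΔc xn s₀ s₁ rfl hg0 hC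
  set x : List (S × A) × S → Iter d := fun p => histIter M ψ lam cα (D / 2) σ x₀ p.1 p.2 with hx
  have hxD : ∀ n p, H (n + 1) p ≠ 0 → ‖x p‖ ≤ D / 2 := fun n p hp => by
    -- The initial point need not lie in the ball. A nonempty history guarantees that the iterate
    -- has been projected at least once.
    have hl := (hlaw n).length p hp
    obtain ⟨l, s⟩ := p
    cases l with
    | nil => simp at hl
    | cons q l => exact norm_tdStep_le (by linarith) _ _ _ _ _
  have hcross := fun n => intg_crossTerm h hμ h0 h1 hcα0 hpt (hxD n)
    (expectLE_crossSize hD hcα0 h.rho_lt_one h.f₁_nonneg (solSize_nonneg h h0 h1)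
      ((hlaw n).f₁_sq h) (hg (hlaw n)))
    (fun p => crossSize_nonneg h h0 h1 hcα0 hD (histTrace lam ψ p.1) p.2)
  refine ⟨b3, b4, fun n => expect (H (n + 1)) fun p => sqErr (rbar M π μ) θstar (x p),
    fun n => expect (H (n + 1)) fun p =>
      crossTerm M π μ ψ lam cα θstar (x p) (histTrace lam ψ p.1) p.2,
    fun n => (intg_sqErr hpt (hxD n)).expectLE le_rfl,
    fun n => expect_nonneg fun p _ => sqErr_nonneg _ _ _,
    fun n => ?_, fun n => ((hcross n).2).trans b2, fun n => ?_⟩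
  · refine (expect_mono (intg_sqErr hpt (hxD n)) (Intg.const _ (D ^ 2))
      fun p hp => sqErr_le_sq hpt (hxD n p hp)).trans_eq (expect_const _ _)
  · have key := (hlaw n).lyapunov_expect_le (D := D) (α := σ (n + 1)) hc hf h h0 h1 hne hcα hcα0
      hstar hpt (hσ _) (le_add_of_nonneg_left (by positivity))
      (add_le_add hb0 (le_refl (f₃ s₁))) hg (x := x) (hxD n)
      (fun p => histIter_snd_mem hx₀ σ p.1 p.2) (fun p q hp => by
        -- The step size used is read off from the length of the history, which is n + 1 on the
        -- support.
        have hl := (hlaw n).length p hp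
        rw [hx, ← hl]
        rfl)
    rw [← hHs (n + 1) (Nat.le_add_left 1 n)] at key
    have := mul_le_mul_of_nonneg_left b1 (sq_nonneg (σ (n + 1)))
    linarith

end ErrorRecursion

end AvgTD

end

open scoped ENNReal

noncomputable section

namespace AvgTD

/-! ### Scalar recursions for constant and diminishing step sizes -/

section RealRecursion

variable {Δ α C D e₀ : ℝ} {err cross : ℕ → ℝ}

/-- The sequence err + α·cross contracts by 1 - Δα up to a remainder of order α². Here `err n`
belongs to time n + 1, and halving the exponential rate pays for this shift. The initial error is
not propagated: at time one D² ≤ C/2 is available. -/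
theorem const_step_bound (hΔ : 0 < Δ) (hα : 0 < α) (hα1 : α ≤ 1) (he₀ : 0 ≤ e₀)
    (hD : 2 * D ^ 2 ≤ C) (hΔD : Δ ^ 2 * D ^ 2 ≤ C) (herr : ∀ n, err n ≤ D ^ 2)
    (hcross : ∀ n, |cross n| ≤ C)
    (hrec : ∀ n, err (n + 1) + α * cross (n + 1)
      ≤ (1 - Δ * α) * err n + α * cross n + α ^ 2 * (27 / 4 * C)) (n : ℕ) :
    err n ≤ (e₀ + 2 * C) * Real.exp (-(Δ * α * (n + 1 : ℕ) / 2)) + 3 * C * α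
      + 12 * C * α / Δ := by
  have hC : 0 ≤ C := le_trans (by positivity) hD
  have hexp := Real.exp_pos (-(Δ * α * (n + 1 : ℕ) / 2))
  have hmain : 2 * C * Real.exp (-(Δ * α * (n + 1 : ℕ) / 2))
      ≤ (e₀ + 2 * C) * Real.exp (-(Δ * α * (n + 1 : ℕ) / 2)) := by
    refine mul_le_mul_of_nonneg_right (by linarith) hexp.le
  -- When Δα ≥ 1 the contraction factor is useless, but then D² ≤ Δα·D² ≤ Cα/Δ, so the last term
  -- alone bounds the error.
  rcases le_or_gt 1 (Δ * α) with h1 | h1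
  · have h2 : D ^ 2 ≤ 12 * C * α / Δ := by
      rw [le_div_iff₀ hΔ]
      have h3 : D ^ 2 * Δ * 1 ≤ D ^ 2 * Δ * (Δ * α) :=
        mul_le_mul_of_nonneg_left h1 (by positivity)
      have h4 : Δ ^ 2 * D ^ 2 * α ≤ C * α := mul_le_mul_of_nonneg_right hΔD hα.le
      have h5 : 0 ≤ C * α := by positivity
      nlinarith
    have h3 : 0 ≤ 2 * C * Real.exp (-(Δ * α * (n + 1 : ℕ) / 2)) := by positivity
    have h4 : 0 ≤ 3 * C * α := by positivity
    linarith [herr n]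
  · have hq : 0 ≤ 1 - Δ * α := by linarith
    have hu : ∀ n, err n + α * cross n
        ≤ (1 - Δ * α) ^ n * (D ^ 2 + α * C) + α / Δ * (27 / 4 * C + Δ * C) := by
      intro n
      induction n with
      | zero =>
        have h2 := mul_le_mul_of_nonneg_left ((le_abs_self _).trans (hcross 0)) hα.le
        have h3 : 0 ≤ α / Δ * (27 / 4 * C + Δ * C) := by positivity
        rw [pow_zero, one_mul]
        linarith [herr 0]
      | succ n ih =>
        have h2 := mul_le_mul_of_nonneg_left ih hq
        have h3 := mul_le_mul_of_nonneg_left ((le_abs_self _).trans (hcross n))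
          (show 0 ≤ Δ * α ^ 2 by positivity)
        -- The chosen constant is the fixed point of the recursion. Its summand ΔC pays for writing
        -- (1 - Δα)·err + α·cross as (1 - Δα)(err + α·cross) + Δα²·cross.
        have e : (1 - Δ * α) * (α / Δ * (27 / 4 * C + Δ * C))
            = α / Δ * (27 / 4 * C + Δ * C) - α ^ 2 * (27 / 4 * C + Δ * C) := by
          field_simp
        rw [pow_succ]
        linarith [hrec n]
    have h2 := mul_le_mul_of_nonneg_left (neg_le_of_abs_le (hcross n)) hα.le
    have e : α / Δ * (27 / 4 * C + Δ * C) = 27 / 4 * (C * α / Δ) + C * α := by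
      field_simp
    have e2 : 12 * C * α / Δ = 12 * (C * α / Δ) := by ring
    have h3 : 0 ≤ C * α / Δ := by positivity
    have hCα : 0 ≤ C * α := by positivity
    have key : (1 - Δ * α) ^ n * (D ^ 2 + α * C)
        ≤ 2 * C * Real.exp (-(Δ * α * (n + 1 : ℕ) / 2)) + C * α := by
      -- For n = 0 the contraction power is 1 and the exponential is still at least 1/2. Afterwards
      -- n + 1 ≥ (n + 2)/2 makes the power at full rate smaller than the exponential at half rate.
      rcases n with _ | n
      · have h4 := Real.add_one_le_exp (-(Δ * α * (0 + 1 : ℕ) / 2))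
        push_cast at h4 ⊢
        have h5 : 1 / 2 ≤ Real.exp (-(Δ * α * (0 + 1) / 2)) := by linarith
        have h6 := mul_le_mul_of_nonneg_left h5 (show 0 ≤ 2 * C by positivity)
        rw [pow_zero, one_mul]
        nlinarith
      · have h4 : (1 - Δ * α) ^ (n + 1) ≤ Real.exp (-(Δ * α * (n + 1 + 1 : ℕ) / 2)) := by
          have h5 : 1 - Δ * α ≤ Real.exp (-(Δ * α)) := by
            linarith [Real.add_one_le_exp (-(Δ * α))]
          refine (pow_le_pow_left₀ hq h5 _).trans ?_
          rw [← Real.exp_nat_mul]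
          refine Real.exp_le_exp.2 ?_
          push_cast
          have h6 : 0 ≤ Δ * α * n := by positivity
          nlinarith
        have h5 : D ^ 2 + α * C ≤ 2 * C := by nlinarith
        have h6 := mul_le_mul h4 h5 (by positivity) (Real.exp_pos _).le
        linarith
    linarith [hu n]

variable {K : ℝ}

theorem one_sub_le_rpow_div {β m : ℝ} (hβ : 1 ≤ β) (hm : 0 < m) :
    1 - β / (m + 1) ≤ (m / (m + 1)) ^ β := by
  have h1 : -1 ≤ -(1 / (m + 1)) := by
    rw [neg_le_neg_iff, div_le_one (by linarith)]
    linarith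
  have h2 := one_add_mul_self_le_rpow_one_add h1 hβ
  have e : 1 + -(1 / (m + 1)) = m / (m + 1) := by
    field_simp
    ring
  rw [e] at h2
  refine le_trans (le_of_eq ?_) h2
  ring

/-- The coefficient of `1 / (k + K)` in the bound for diminishing step sizes. -/
def decayCoeff (Δ α C : ℝ) : ℝ :=
  4 * (6 + 2 * Δ) * C * Real.exp 1 * α ^ 2 / (Δ * α / 2 - 1)

/-- The part 8ΔCα² of the numerator equals 16Cα·(Δα/2), and Δα/2 exceeds the denominator Δα/2 - 1.
-/
theorem le_decayCoeff (hΔ : 0 < Δ) (hα : 0 < α) (hβ : 1 < Δ * α / 2) (hC : 0 ≤ C) :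
    16 * (C * α) ≤ decayCoeff Δ α C := by
  unfold decayCoeff
  rw [le_div_iff₀ (by linarith)]
  have h1 : 1 ≤ Real.exp 1 := Real.one_le_exp zero_le_one
  have h2 : 4 * (6 + 2 * Δ) * C * 1 * α ^ 2 ≤ 4 * (6 + 2 * Δ) * C * Real.exp 1 * α ^ 2 := by
    gcongr
  have h3 : 0 ≤ C * α := by positivity
  have h4 : 0 ≤ C * α ^ 2 := by positivity
  nlinarith

theorem sq_mul_le_decayCoeff (hΔ : 0 < Δ) (hβ : 1 < Δ * α / 2) (hC : 0 ≤ C) :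
    α ^ 2 * (27 / 4 * C + 3 / 2 * Δ * C) ≤ decayCoeff Δ α C * (Δ * α - 1) := by
  have h0 : 0 < Δ * α / 2 - 1 := by linarith
  have h1 : 1 ≤ Real.exp 1 := Real.one_le_exp zero_le_one
  have h2 : 4 * (6 + 2 * Δ) * C * 1 * α ^ 2 ≤ 4 * (6 + 2 * Δ) * C * Real.exp 1 * α ^ 2 := by
    gcongr
  have h3 : decayCoeff Δ α C * (Δ * α / 2 - 1) = 4 * (6 + 2 * Δ) * C * Real.exp 1 * α ^ 2 := by
    exact div_mul_cancel₀ _ h0.ne'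
  have h4 : 0 ≤ decayCoeff Δ α C := by unfold decayCoeff; positivity
  have h5 : decayCoeff Δ α C * (Δ * α / 2 - 1) ≤ decayCoeff Δ α C * (Δ * α - 1) :=
    mul_le_mul_of_nonneg_left (by linarith) h4
  have h6 : 0 ≤ C * α ^ 2 := by positivity
  have h7 : 0 ≤ Δ * (C * α ^ 2) := by positivity
  linarith

/-- Q/m almost solves the recursion: the remainder takes at most 2β - 1 of the decrement 2β·Q/m²,
and what is left, Q/m², exceeds Q/m - Q/(m+1). -/
theorem one_sub_mul_decay_le {β m Q N : ℝ} (hm : 0 < m) (hQ : 0 ≤ Q)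
    (hN : N ≤ Q * (2 * β - 1)) : (1 - 2 * β / m) * (Q / m) + N / m ^ 2 ≤ Q / (m + 1) := by
  have h1 := div_le_div_of_nonneg_right hN (show 0 ≤ m ^ 2 by positivity)
  have e1 : Q / (m + 1) - (Q / m - Q / m ^ 2) = Q / (m ^ 2 * (m + 1)) := by
    field_simp
    ring
  have h2 : 0 ≤ Q / (m ^ 2 * (m + 1)) := by positivity
  have e2 : (1 - 2 * β / m) * (Q / m) + Q * (2 * β - 1) / m ^ 2 = Q / m - Q / m ^ 2 := by
    field_simp
    ring
  linarith

theorem one_sub_mul_rpow_le {β m : ℝ} (hβ : 1 ≤ β) (hm : 0 < m) (hK : 0 ≤ K) :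
    (1 - 2 * β / m) * (K / m) ^ β ≤ (K / (m + 1)) ^ β := by
  have e : K / (m + 1) = m / (m + 1) * (K / m) := by field_simp
  rw [e, Real.mul_rpow (by positivity) (by positivity)]
  refine mul_le_mul_of_nonneg_right ?_ (by positivity)
  refine le_trans ?_ (one_sub_le_rpow_div hβ hm)
  have : β / (m + 1) ≤ 2 * β / m :=
    div_le_div₀ (by linarith) (by linarith) hm (by linarith)
  linarith

theorem diminishing_step_bound (hΔ : 0 < Δ) (hα : 2 / Δ < α) (hK : 2 ≤ K) (he₀ : 0 ≤ e₀)
    (hD : 2 * D ^ 2 ≤ C) (hΔD : Δ ^ 2 * D ^ 2 ≤ C) (herr : ∀ n, err n ≤ D ^ 2)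
    (hcross : ∀ n, |cross n| ≤ C)
    (hrec : ∀ n : ℕ, err (n + 1) + α / ((n + 1 : ℕ) + K) * cross (n + 1)
      ≤ (1 - Δ * (α / ((n + 1 : ℕ) + K))) * err n + α / ((n + 1 : ℕ) + K) * cross n
        + (α / ((n + 1 : ℕ) + K)) ^ 2 * (27 / 4 * C)) (n : ℕ) :
    err n ≤ (e₀ + 2 * C) * (K / ((n + 1 : ℕ) + K)) ^ (Δ * α / 2) + C * α / ((n + 1 : ℕ) + K)
      + decayCoeff Δ α C / ((n + 1 : ℕ) + K) := by
  have hC : 0 ≤ C := le_trans (by positivity) hD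
  have hα0 : 0 < α := lt_trans (by positivity) hα
  have hΔα : 2 < Δ * α := by rwa [div_lt_iff₀ hΔ, mul_comm] at hα
  set β := Δ * α / 2 with hβ
  have hβ1 : 1 < β := by linarith
  set Q := decayCoeff Δ α C with hQ
  have hQ1 : 16 * (C * α) ≤ Q := le_decayCoeff hΔ hα0 hβ1 hC
  have hQ2 : α ^ 2 * (27 / 4 * C + 3 / 2 * Δ * C) ≤ Q * (2 * β - 1) := by
    have := sq_mul_le_decayCoeff (α := α) hΔ hβ1 hC
    rwa [hβ, mul_div_cancel₀ _ (two_ne_zero' ℝ)]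
  have hCα : 0 ≤ C * α := by positivity
  -- For early times the contraction factor may be negative. There 1/m is not yet small and the
  -- uniform bound D² is already below Q/m.
  have hsmall : ∀ m : ℝ, 0 < m → m ≤ 2 * β + 1 → D ^ 2 + C * α / m ≤ Q / m := by
    intro m hm hmβ
    rw [← sub_nonneg]
    have e : Q / m - (D ^ 2 + C * α / m) = (Q - D ^ 2 * m - C * α) / m := by
      field_simp
      ring
    rw [e]
    refine div_nonneg ?_ hm.le
    have h1 : D ^ 2 * m ≤ D ^ 2 * (3 * β) :=
      mul_le_mul_of_nonneg_left (by linarith) (sq_nonneg D)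
    have h2 : Δ * D ^ 2 ≤ C := by nlinarith [sq_nonneg ((Δ - 1) * D), sq_nonneg D]
    have h3 := mul_le_mul_of_nonneg_right h2 hα0.le
    have h4 : D ^ 2 * (3 * β) = 3 / 2 * (Δ * D ^ 2 * α) := by rw [hβ]; ring
    linarith
  have hK0 : 0 < K := by linarith
  -- The weight of `cross n` is the step size of the next update, so consecutive values of u differ
  -- from the recursion by a multiple of α/m - α/(m+1).
  set u : ℕ → ℝ := fun n => err n + α / ((n + 1 : ℕ) + K) * cross n with hu
  have hm0 : ∀ n : ℕ, 0 < ((n + 1 : ℕ) : ℝ) + K := fun n => by positivity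
  have hu0 : ∀ n, u n ≤ D ^ 2 + C * α / ((n + 1 : ℕ) + K) := fun n => by
    have h1 := mul_le_mul_of_nonneg_left ((le_abs_self _).trans (hcross n))
      (div_nonneg hα0.le (hm0 n).le)
    have e : C * α / ((n + 1 : ℕ) + K) = α / ((n + 1 : ℕ) + K) * C := by ring
    rw [e]
    exact add_le_add (herr n) h1
  have hp0 : ∀ n : ℕ, 0 ≤ (e₀ + 2 * C) * (K / ((n + 1 : ℕ) + K)) ^ β := fun n => by
    have := hm0 n
    positivity
  have claim : ∀ n, u n ≤ (e₀ + 2 * C) * (K / ((n + 1 : ℕ) + K)) ^ β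
      + Q / ((n + 1 : ℕ) + K) := by
    intro n
    induction n with
    | zero =>
      rcases le_or_gt (((0 + 1 : ℕ) : ℝ) + K) (2 * β + 1) with h1 | h1
      · exact (hu0 0).trans ((hsmall _ (hm0 0) h1).trans (le_add_of_nonneg_left (hp0 0)))
      -- Here K > 2β, so Bernoulli's inequality keeps the power above 1/2, and half of 2C already
      -- covers D².
      · have h2 := one_sub_le_rpow_div hβ1.le hK0
        have h3 : β / (K + 1) ≤ 1 / 2 := by
          rw [div_le_div_iff₀ (by linarith) two_pos]
          push_cast at h1
          linarith
        have e : ((0 + 1 : ℕ) : ℝ) + K = K + 1 := by push_cast; ring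
        have h4 := hu0 0
        rw [e] at h4 ⊢
        have h5 : 1 / 2 ≤ (K / (K + 1)) ^ β := by linarith
        have h6 := mul_le_mul_of_nonneg_left h5 (show 0 ≤ e₀ + 2 * C by positivity)
        have h7 : C * α / (K + 1) ≤ Q / (K + 1) :=
          div_le_div_of_nonneg_right (by linarith) (by linarith)
        nlinarith
    | succ n ih =>
      have hm := hm0 n
      set m : ℝ := ((n + 1 : ℕ) : ℝ) + K with hmdef
      have e : ((n + 1 + 1 : ℕ) : ℝ) + K = m + 1 := by rw [hmdef]; push_cast; ring
      have h0 := hu0 (n + 1)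
      have hp := hp0 (n + 1)
      rw [e] at h0 hp ⊢
      rcases lt_or_ge m (2 * β) with h1 | h1
      · exact h0.trans ((hsmall _ (by linarith) (by linarith)).trans
          (le_add_of_nonneg_left hp))
      · have hstep : u (n + 1) ≤ (1 - 2 * β / m) * u n
            + α ^ 2 * (27 / 4 * C + 3 / 2 * Δ * C) / m ^ 2 := by
          have r := hrec n
          rw [← hmdef] at r
          have eu : u n = err n + α / m * cross n := rfl
          have eu' : u (n + 1) = err (n + 1) + α / (m + 1) * cross (n + 1) := by
            rw [hu]
            simp only [e]
          -- The decrease of the step size is at most α/m², which is of second order because 1 < β =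
          -- Δα/2. It contributes ΔC/2, which with ΔC from the contraction makes 3ΔC/2.
          have hd : α / m - α / (m + 1) ≤ α ^ 2 / m ^ 2 * (Δ / 2) := by
            have ed : α / m - α / (m + 1) = α / (m * (m + 1)) := by field_simp; ring
            have ed2 : α ^ 2 / m ^ 2 * (Δ / 2) = (α * β) / m ^ 2 := by rw [hβ]; ring
            rw [ed, ed2]
            refine div_le_div₀ (by positivity) (by nlinarith) (by positivity) (by nlinarith)
          have hd0 : 0 ≤ α / m - α / (m + 1) := by
            rw [sub_nonneg]
            exact div_le_div_of_nonneg_left hα0.le hm (by linarith)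
          have t1 : -((α / m - α / (m + 1)) * cross (n + 1))
              ≤ α ^ 2 / m ^ 2 * (Δ / 2) * C := by
            rw [← mul_neg]
            exact (mul_le_mul_of_nonneg_left ((neg_le_abs _).trans (hcross _)) hd0).trans
              (mul_le_mul_of_nonneg_right hd hC)
          have t2 : Δ * (α / m) ^ 2 * cross n ≤ Δ * (α / m) ^ 2 * C :=
            mul_le_mul_of_nonneg_left ((le_abs_self _).trans (hcross n)) (by positivity)
          have e3 : 2 * β / m = Δ * (α / m) := by rw [hβ]; ring
          have e4 : α ^ 2 * (27 / 4 * C + 3 / 2 * Δ * C) / m ^ 2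
              = (α / m) ^ 2 * (27 / 4 * C) + Δ * (α / m) ^ 2 * C
                + α ^ 2 / m ^ 2 * (Δ / 2) * C := by
            rw [div_pow]; ring
          rw [eu, eu', e3, e4]
          linarith
        have hc0 : 0 ≤ 1 - 2 * β / m := by
          rw [sub_nonneg, div_le_one hm]
          exact h1
        refine hstep.trans ?_
        have s1 := mul_le_mul_of_nonneg_left ih hc0
        have s2 := one_sub_mul_rpow_le hβ1.le hm hK0.le
        have s3 := mul_le_mul_of_nonneg_left s2 (show 0 ≤ e₀ + 2 * C by positivity)
        have s4 := one_sub_mul_decay_le hm (by linarith) hQ2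
        rw [mul_add, mul_left_comm] at s1
        linarith
  have h1 := mul_le_mul_of_nonneg_left (neg_le_of_abs_le (hcross n))
    (div_nonneg hα0.le (hm0 n).le)
  have e : C * α / ((n + 1 : ℕ) + K) = α / ((n + 1 : ℕ) + K) * C := by ring
  have h2 := claim n
  rw [e]
  simp only [hu] at h2
  linarith

end RealRecursion

end AvgTD

end

open scoped ENNReal

noncomputable section

namespace AvgTD

/-! ### Transfer of the recursion to trajectories -/

section Trajectory

open MeasureTheory

variable {S A Ω : Type*} [Countable S] [Finite A] [MeasurableSpace Ω] {d : ℕ} {M : MDP S A}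
  {π : S → PMF A} {μ : PMF S} {ψ : S → Vec d} {ρ lam rhat ψhat cα D : ℝ} {f₁ f₂ f₃ : S → ℝ}
  {θstar : Vec d} {ℙ : Measure Ω} {X : ℕ → Ω → S} {U : ℕ → Ω → A}

theorem MeanLE.mono_const {P : Measure Ω} {Z : Ω → ℝ} {c c' : ℝ} (h : MeanLE P Z c)
    (hc : c ≤ c') : MeanLE P Z c' := ⟨h.1, h.2.trans hc⟩

theorem meanLE_const (P : Measure Ω) [IsProbabilityMeasure P] (c : ℝ) :
    MeanLE P (fun _ => c) c := ⟨integrable_const c, by simp⟩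

/-- Conditional error bounds `err k` along a trajectory, with their recursion. -/
theorem IsTrajectory.exists_error_bounds [IsProbabilityMeasure ℙ]
    (hX : IsTrajectory M π ℙ X U) {s₀ s₁ : S}
    (hev : ℙ {ω | X 0 ω = s₀ ∧ X 1 ω = s₁} ≠ 0) (hc : ChainAssumption M π μ rhat)
    (hf : FeatureAssumption μ ψ ψhat)
    (h : StabilityAssumption M π μ ψ ρ f₁ f₂ f₃) (h0 : 0 ≤ lam) (h1 : lam < 1)
    (hne : (constSpace ψ)ᗮ ≠ ⊥) (hcα : cThreshold d lam ψhat (drift M π μ ψ lam) ≤ cα)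
    (hstar : IsTDSolution M π μ ψ lam θstar)
    (hpt : ‖pt (rbar M π μ) θstar‖ ≤ D / 2) {x₀ : Iter d} (hx₀ : x₀.snd ∈ (constSpace ψ)ᗮ)
    (xn : ℝ) {C : ℝ} (hC : C = CV M π μ ψ lam cα rhat ψhat ρ f₂ f₃ D xn s₀ s₁)
    {σ : ℕ → ℝ} (hσ : ∀ n, 0 ≤ σ n) :
    2 * D ^ 2 ≤ C ∧ drift M π μ ψ lam ^ 2 * D ^ 2 ≤ C ∧ ∃ err cross : ℕ → ℝ,
      (∀ k, MeanLE (ProbabilityTheory.cond ℙ {ω | X 0 ω = s₀ ∧ X 1 ω = s₁})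
        (fun ω => sqErr (rbar M π μ) θstar (iterates M ψ lam cα (D / 2) σ x₀
          (fun i => X i ω) (fun i => U i ω) k)) (err k)) ∧
      (∀ k (g : Iter d → ℝ), (∀ x, 0 ≤ g x) → (∀ x, g x ^ 2 ≤ sqErr (rbar M π μ) θstar x) →
        MeanLE (ProbabilityTheory.cond ℙ {ω | X 0 ω = s₀ ∧ X 1 ω = s₁})
        (fun ω => g (iterates M ψ lam cα (D / 2) σ x₀
          (fun i => X i ω) (fun i => U i ω) k)) (√(err k))) ∧
      err 0 = sqErr (rbar M π μ) θstar x₀ ∧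
      (∀ n, err (n + 1) ≤ D ^ 2) ∧ (∀ n, |cross n| ≤ C) ∧
      ∀ n, err (n + 2) + σ (n + 1) * cross (n + 1)
        ≤ (1 - drift M π μ ψ lam * σ (n + 1)) * err (n + 1) + σ (n + 1) * cross n
          + σ (n + 1) ^ 2 * (27 / 4 * C) := by
  have hprob : IsProbabilityMeasure
      (ProbabilityTheory.cond ℙ {ω | X 0 ω = s₀ ∧ X 1 ω = s₁}) :=
    ProbabilityTheory.cond_isProbabilityMeasure hev
  obtain ⟨H, hH1, hHs, hHe⟩ := hX.exists_histLaw s₀ s₁ hev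
  obtain ⟨b1, b2, err, cross, herr, herr0, herrD, hcross, hrec⟩ :=
    exists_error_recursion hc hf h h0 h1 hne hcα hstar hpt hx₀ hH1 hHs xn hC hσ
  -- The recursion for the history starts at time one; the deterministic error at time zero is
  -- prepended.
  obtain ⟨e, e0, es⟩ : ∃ e : ℕ → ℝ, e 0 = sqErr (rbar M π μ) θstar x₀ ∧
      ∀ n, e (n + 1) = err n := ⟨fun k => match k with
        | 0 => sqErr (rbar M π μ) θstar x₀
        | n + 1 => err n, rfl, fun _ => rfl⟩
  refine ⟨b1, b2, e, cross, fun k => ?_, fun k g hg0 hg => ?_, e0,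
    fun n => (es n).trans_le (herrD n), hcross, fun n => ?_⟩
  · rcases k with _ | n
    · rw [e0]
      exact meanLE_const _ (sqErr (rbar M π μ) θstar x₀)
    · rw [es]
      simp only [iterates_eq_histIter]
      have key := hHe (n + 1) (fun p => sqErr (rbar M π μ) θstar
        (histIter M ψ lam cα (D / 2) σ x₀ p.1 p.2)) (fun p => sqErr_nonneg _ _ _) _ (herr n)
      exact key
  · rcases k with _ | n
    · rw [e0]
      exact (meanLE_const _ (g x₀)).mono_const (Real.le_sqrt_of_sq_le (hg x₀))
    · rw [es]
      simp only [iterates_eq_histIter]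
      have hle : ExpectLE (H (n + 1)) (fun p => g (histIter M ψ lam cα (D / 2) σ x₀ p.1 p.2))
          (√(err n)) :=
        ((herr n).mono (fun _ => sq_nonneg _) fun p _ => hg _).le_sqrt fun p => hg0 _
      have key := hHe (n + 1) (fun p => g (histIter M ψ lam cα (D / 2) σ x₀ p.1 p.2))
        (fun p => hg0 _) _ hle
      exact key
  · rw [es, es]
    exact hrec n

end Trajectory

end AvgTD

end

/-! ### The theorem: error bounds and sample complexity -/

open AvgTD in
theorem theorem3 {S A Ω : Type*} [Countable S] [Finite A] [MeasurableSpace Ω] {d : ℕ}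
    (M : MDP S A) (π : S → PMF A) (μ : PMF S) (ψ : S → Vec d)
    (lam cα rhat ψhat ρ : ℝ) (f₁ f₂ f₃ : S → ℝ)
    (hlam₀ : 0 ≤ lam) (hlam₁ : lam < 1)
    (hchain : ChainAssumption M π μ rhat)
    (hfeat : FeatureAssumption μ ψ ψhat)
    (hstab : StabilityAssumption M π μ ψ ρ f₁ f₂ f₃)
    (hne : (constSpace ψ)ᗮ ≠ ⊥)
    (hcα : cThreshold d lam ψhat (drift M π μ ψ lam) ≤ cα) :
    (IsLeast (driftValues M π μ ψ lam) (drift M π μ ψ lam) ∧ 0 < drift M π μ ψ lam) ∧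
    ∃ θstar : Vec d, IsTDSolution M π μ ψ lam θstar ∧
      (∀ θ, IsTDSolution M π μ ψ lam θ → θ = θstar) ∧
      ∀ (D : ℝ), ‖pt (rbar M π μ) θstar‖ ≤ D / 2 →
      ∀ (r₀ : ℝ) (θ₀ : Vec d), θ₀ ∈ (constSpace ψ)ᗮ →
      ∀ (ℙ : MeasureTheory.Measure Ω) [MeasureTheory.IsProbabilityMeasure ℙ]
        (X : ℕ → Ω → S) (U : ℕ → Ω → A), IsTrajectory M π ℙ X U →
      ∀ s₀ s₁ : S, ℙ {ω | X 0 ω = s₀ ∧ X 1 ω = s₁} ≠ 0 →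
        let Δ := drift M π μ ψ lam
        let r := rbar M π μ
        let C := CV M π μ ψ lam cα rhat ψhat ρ f₂ f₃ D ‖pt r θstar‖ s₀ s₁
        let φ := phiZero r θstar (pt r₀ θ₀) C
        let E := ProbabilityTheory.cond ℙ {ω | X 0 ω = s₀ ∧ X 1 ω = s₁}
        let x : (ℕ → ℝ) → ℕ → Ω → Iter d := fun α k ω =>
          iterates M ψ lam cα (D / 2) α (pt r₀ θ₀) (fun i => X i ω) (fun i => U i ω) k
        -- (a) constant step size
        (∀ α : ℝ, 0 < α → α ≤ 1 → ∀ k : ℕ,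
          MeanLE E (fun ω => sqErr r θstar (x (fun _ => α) k ω))
            (φ * Real.exp (-(Δ * α * k / 2)) + 3 * C * α + 12 * C * α / Δ)) ∧
        -- (b) diminishing step size, with the resulting sample complexity
        (∀ α K : ℝ, 2 / Δ < α → max α 2 ≤ K →
          (∀ k : ℕ,
            MeanLE E (fun ω => sqErr r θstar (x (fun i => α / (i + K)) k ω))
              (φ * (K / (k + K)) ^ (Δ * α / 2) + C * α / (k + K)
                + 4 * (6 + 2 * Δ) * C * Real.exp 1 * α ^ 2
                  / ((Δ * α / 2 - 1) * (k + K)))) ∧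
          (∀ ε : ℝ, 0 < ε → ∀ k : ℕ,
            (φ * K + C * α + 4 * (6 + 2 * Δ) * C * Real.exp 1 * α ^ 2 / (Δ * α / 2 - 1)) / ε ^ 2
              ≤ k →
            MeanLE E (fun ω => |(x (fun i => α / (i + K)) k ω).fst - r|) ε ∧
            MeanLE E (fun ω => ‖(x (fun i => α / (i + K)) k ω).snd - θstar‖) ε)) := by
  have hdrift := drift_isLeast hchain hfeat hstab hlam₀ hlam₁ hne
  refine ⟨hdrift, ?_⟩
  obtain ⟨θstar, hstar, huniq⟩ := exists_unique_solution hchain hfeat hstab hlam₀ hlam₁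
  refine ⟨θstar, hstar, huniq, ?_⟩
  intro D hpt r₀ θ₀ hθ₀ ℙ _ X U hX s₀ s₁ hev Δ r C φ E x
  have hΔ : 0 < Δ := hdrift.2
  have hx₀ : (pt r₀ θ₀).snd ∈ (constSpace ψ)ᗮ := hθ₀
  have he₀ : 0 ≤ sqErr r θstar (pt r₀ θ₀) := sqErr_nonneg _ _ _
  constructor
  · intro α hα hα1 k
    obtain ⟨b1, b2, err, cross, herr, -, h0, hD, hcross, hrec⟩ :=
      hX.exists_error_bounds hev hchain hfeat hstab hlam₀ hlam₁ hne hcα hstar hpt hx₀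
        ‖pt r θstar‖ (C := C) rfl (σ := fun _ => α) fun _ => hα.le
    have hC : 0 ≤ C := le_trans (by positivity) b1
    refine (herr k).mono_const ?_
    -- Only at k = 0 is the initial error in φ itself needed; later times are governed by the
    -- recursion from time one.
    rcases k with _ | n
    · rw [h0]
      have h2 : 0 ≤ 3 * C * α + 12 * C * α / Δ := by positivity
      simp only [φ, phiZero, Nat.cast_zero, mul_zero, zero_div, neg_zero, Real.exp_zero, mul_one]
      linarith
    · exact const_step_bound hΔ hα hα1 he₀ b1 b2 hD hcross hrec n
  · intro α K hα hK
    have hK2 : 2 ≤ K := (le_max_right _ _).trans hK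
    have hα0 : 0 < α := lt_trans (by positivity) hα
    have hβ : 1 < Δ * α / 2 := by
      rw [div_lt_iff₀ hΔ] at hα
      linarith
    obtain ⟨b1, b2, err, cross, herr, hsqrt, h0, hD, hcross, hrec⟩ :=
      hX.exists_error_bounds hev hchain hfeat hstab hlam₀ hlam₁ hne hcα hstar hpt hx₀
        ‖pt r θstar‖ (C := C) rfl (σ := fun i => α / (i + K)) fun i => by positivity
    have hC : 0 ≤ C := le_trans (by positivity) b1
    have hφ : 0 ≤ φ := by
      simp only [φ, phiZero]
      positivity
    have hQ : 0 ≤ decayCoeff Δ α C := (by positivity : 0 ≤ 16 * (C * α)).trans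
      (le_decayCoeff hΔ hα0 hβ hC)
    have hbound : ∀ k : ℕ, err k ≤ φ * (K / (k + K)) ^ (Δ * α / 2) + C * α / (k + K)
        + decayCoeff Δ α C / (k + K) := by
      rintro (_ | n)
      · rw [h0, Nat.cast_zero, zero_add, div_self (by linarith), Real.one_rpow]
        have h2 : 0 ≤ C * α / K + decayCoeff Δ α C / K := by positivity
        simp only [φ, phiZero]
        linarith
      · exact diminishing_step_bound hΔ hα hK2 he₀ b1 b2 hD hcross hrec n
    refine ⟨fun k => (herr k).mono_const ((hbound k).trans_eq ?_), fun ε hε k hk => ?_⟩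
    · rw [decayCoeff, div_div]
    · have hk0 : 0 < (k : ℝ) + K := by positivity
      have herrε : √(err k) ≤ ε := by
        refine Real.sqrt_le_iff.2 ⟨hε.le, (hbound k).trans ?_⟩
        -- The base is at most 1 and the exponent exceeds 1, so all three terms of the bound are of
        -- order 1/(k + K) and combine into a single quotient.
        have h2 : (K / (k + K)) ^ (Δ * α / 2) ≤ K / (k + K) := by
          refine Real.rpow_le_self_of_le_one (by positivity) ?_ hβ.le
          rw [div_le_one hk0]
          exact le_add_of_nonneg_left k.cast_nonneg
        have h3 := mul_le_mul_of_nonneg_left h2 hφ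
        have e : φ * (K / (k + K)) + C * α / (k + K) + decayCoeff Δ α C / (k + K)
            = (φ * K + C * α + decayCoeff Δ α C) / (k + K) := by ring
        have h4 : (φ * K + C * α + decayCoeff Δ α C) / (k + K) ≤ ε ^ 2 := by
          rw [div_le_iff₀ hk0]
          rw [div_le_iff₀ (by positivity)] at hk
          have h5 : 0 ≤ K * ε ^ 2 := by positivity
          unfold decayCoeff
          linarith
        linarith
      refine ⟨(hsqrt k (fun y => |y.fst - r|) (fun y => abs_nonneg _) fun y => ?_).mono_const
        herrε, (hsqrt k (fun y => ‖y.snd - θstar‖) (fun y => norm_nonneg _)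
          fun y => ?_).mono_const herrε⟩
      · rw [sq_abs]
        exact le_add_of_nonneg_right (sq_nonneg _)
      · exact le_add_of_nonneg_left (sq_nonneg _)
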